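/- **Setting.** A *Wigner matrix* of size $n\ge 1$ is a random Hermitian $n\times n$ matrix $M_n=(\xi_{ij})$ such that the $\xi_{ij}$, $1\le i\le j\le n$, are jointly independent; for $i<j$, $\xi_{ij}$ has mean $0$ and variance $\mathbf E|\xi_{ij}|^2=1$, and $\operatorname{Re}\xi_{ij}$, $\operatorname{Im}\xi_{ij}$ are independent; the (real) diagonal entries $\xi_{ii}$ have mean $0$ and a common variance $\sigma^2>0$. It obeys *Condition C0* with constants $C,C'>0$ if $\mathbf P(|\xi_{ij}|\ge t^{C})\le e^{-t}$ for all $i,j$ and all $t\ge C'$. Two Wigner matrices $M_n=(\xi_{ij})$, $M'_n=(\xi'_{ij})$ on the same probability space *match moments to order $m$* if $\mathbf E(\operatorname{Re}\xi_{ij})^k(\operatorname{Im}\xi_{ij})^l=\mathbf E(\operatorname{Re}\xi'_{ij})^k(\operatorname{Im}\xi'_{ij})^l$ for all $i,j$ and all integers $k,l\ge0$ with $k+l\le m$. They are *adjacent* if (almost surely) $\xi_{ij}=\xi'_{ij}$ except possibly at one position $(i,j)=(a,b)$ and its transpose $(b,a)$, and $\xi_{ab},\xi'_{ab}$ have identical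 real parts or identical imaginary parts. Put $\rho_{sc}(x)=\frac1{2\pi}(4-x^2)_+^{1/2}$ and, for $\operatorname{Im}z>0$, $s_{sc}(z)=\int_{\mathbf R}\frac{\rho_{sc}(x)}{x-z}\,dx$, $s_W(z)=\frac1n\operatorname{tr}(W-z)^{-1}$, and, with $\eta=\operatorname{Im}z$, $A(W)=n\eta\,(s_W(z)-s_{sc}(z))$. **Proposition (Stability of moments).** For every integer $m\ge0$ and all $C,C',K>0$ there are constants $c,B>0$, depending only on $m,C,C',K$, such that the following holds for every $n\ge1$. Let $M_n,M'_n$ be adjacent Wigner matrices obeying Condition C0 with constants $C,C'$, whose moments match to order $m$. Let $z=E+\sqrt{-1}\,\eta$ with $E\in[-3,3]$ and $0<\eta\le Kn^{100}$, and set $W_n=\frac1{\sqrt n}M_n$, $W'_n=\frac1{\sqrt n}M'_n$. Then for every even integer $k\ge\log n$, $$\mathbf E|A(W_n)|^k\;\le\;\bigl(1+B\,n^{-(m+1)/2}\bigr)\,\mathbf E|A(W'_n)|^k+(Bk)^k+B\,n^{Bk}\exp\bigl(-(n\eta)^c\bigr)$$ (with the convention $0^0=1$ when $k=0$). -/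

import Mathlib

open MeasureTheory ProbabilityTheory

namespace Wigner

variable {Ω : Type*} [MeasurableSpace Ω] {n : ℕ}

/-- `M` is an `n × n` Wigner matrix on the probability space `(Ω, μ)`: a random Hermitian matrix
whose entries on and above the diagonal are jointly independent, centred and square integrable,
with `𝔼 |ξ i j|² = 1` for `i < j`, with `𝔼 (ξ i i)² = σ²` for one `σ > 0` and all `i`, and such
that the real and imaginary parts of each entry above the diagonal are independent. -/
structure IsWigner (M : Ω → Matrix (Fin n) (Fin n) ℂ) (μ : Measure Ω) : Prop where
  measurable : ∀ i j, Measurable fun ω => M ω i j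
  hermitian : ∀ ω, (M ω).IsHermitian
  indep : iIndepFun (fun (p : {p : Fin n × Fin n // p.1 ≤ p.2}) ω => M ω p.1.1 p.1.2) μ
  memLp_two : ∀ i j, MemLp (fun ω => M ω i j) 2 μ
  mean_zero : ∀ i j, ∫ ω, M ω i j ∂μ = 0
  variance_offDiag : ∀ i j, i < j → ∫ ω, ‖M ω i j‖ ^ 2 ∂μ = 1
  variance_diag : ∃ σ : ℝ, 0 < σ ∧ ∀ i, ∫ ω, ‖M ω i i‖ ^ 2 ∂μ = σ ^ 2
  indep_re_im : ∀ i j, i < j → IndepFun (fun ω => (M ω i j).re) (fun ω => (M ω i j).im) μ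

/-- The exponential decay condition with constants `C`, `C'`:
`ℙ(|ξ i j| ≥ t ^ C) ≤ e ^ (-t)` for all `i, j` and all `t ≥ C'`. -/
def ExpDecay (M : Ω → Matrix (Fin n) (Fin n) ℂ) (μ : Measure Ω) (C C' : ℝ) : Prop :=
  ∀ i j, ∀ t : ℝ, C' ≤ t → μ.real {ω | t ^ C ≤ ‖M ω i j‖} ≤ Real.exp (-t)

/-- `M` and `M'` have matching moments to order `m`. -/
def MatchMoments (M M' : Ω → Matrix (Fin n) (Fin n) ℂ) (μ : Measure Ω) (m : ℕ) : Prop :=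
  ∀ i j, ∀ k l : ℕ, k + l ≤ m →
    ∫ ω, (M ω i j).re ^ k * (M ω i j).im ^ l ∂μ = ∫ ω, (M' ω i j).re ^ k * (M' ω i j).im ^ l ∂μ

/-- `M` and `M'` are (real-)adjacent: almost surely, their entries agree except possibly at one
position `(a, b)` and its transpose `(b, a)`, and the entries at `(a, b)` have identical real
parts or identical imaginary parts. -/
def Adjacent (M M' : Ω → Matrix (Fin n) (Fin n) ℂ) (μ : Measure Ω) : Prop :=
  ∃ a b : Fin n,
    (∀ i j, (i, j) ≠ (a, b) → (i, j) ≠ (b, a) → ∀ᵐ ω ∂μ, M ω i j = M' ω i j) ∧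
    ((∀ᵐ ω ∂μ, (M ω a b).re = (M' ω a b).re) ∨ (∀ᵐ ω ∂μ, (M ω a b).im = (M' ω a b).im))

/-- The density of the semicircular distribution. -/
noncomputable def rhoSC (x : ℝ) : ℝ := 1 / (2 * Real.pi) * Real.sqrt (max (4 - x ^ 2) 0)

/-- The Stieltjes transform of the semicircular distribution. -/
noncomputable def stieltjesSC (z : ℂ) : ℂ := ∫ x : ℝ, 1 / ((x : ℂ) - z) * (rhoSC x : ℂ)

/-- The Stieltjes transform `(1/n) tr (W - z)⁻¹` of an `n × n` matrix. -/
noncomputable def stieltjes (W : Matrix (Fin n) (Fin n) ℂ) (z : ℂ) : ℂ :=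
  1 / (n : ℂ) * ((W - z • (1 : Matrix (Fin n) (Fin n) ℂ))⁻¹).trace

/-- The normalization `W = M / √n`. -/
noncomputable def normalize (M : Matrix (Fin n) (Fin n) ℂ) : Matrix (Fin n) (Fin n) ℂ :=
  ((1 / Real.sqrt n : ℝ) : ℂ) • M

/-- The deviation `A(W) = n η (s_W(z) - s_sc(z))`, where `η = Im z`. -/
noncomputable def deviation (W : Matrix (Fin n) (Fin n) ℂ) (z : ℂ) : ℂ :=
  (n : ℂ) * (z.im : ℂ) * (stieltjes W z - stieltjesSC z)

end Wigner

/-! The deviation equals `η tr G - w`, where `G` is the resolvent and `w = n η s_sc(z)` is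
deterministic, and its modulus never exceeds `3 n`. Hence an event whose probability is at most a
power of `n` times `exp (-(n η) ^ c)` contributes only to the last term of the bound, and it
suffices to compare the two moments on a good event.

Exchange of one real variable. Adjacent matrices have the form `M = Y + ξ V`, `M' = Y' + ξ' V` with
`Y = Y'` almost surely, `V` a fixed Hermitian matrix supported on `(a, b)` and `(b, a)`, `Y`
independent of `ξ` and `Y'` of `ξ'` (`Adjacent.exists_direction`, `indepFun_remainderAt`). Fix a
value of `Y` for which the four resolvent entries at `a, b` are at most `14`. Then `φ(τ) = η tr G(τ)
- w` along `Y / √n + τ V` is holomorphic near `0` and varies by at most `1` there, because the Ward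
identity bounds the change of the trace by `1 / η`. For real `t`, `|φ(t)| ^ k` is the restriction of
the holomorphic function `φ(τ) ^ (k/2) * conj (φ(conj τ)) ^ (k/2)`, of size at most `e P ^ k` with
`P = max |φ(0)| k`, since `(P + 1) ^ k ≤ e P ^ k` for `P ≥ k`. Cauchy's estimates thus give a Taylor
expansion whose constants, relative to `P ^ k`, do not depend on `k`. Matching moments cancel the
terms up to order `m`; what remains is `O(n ^ (-(m+1)/2)) P ^ k`. Finally `P ^ k ≤ e |φ(t)| ^ k + e
k ^ k` for typical `t`, which produces the factor `1 + B n ^ (-(m+1)/2)` and the term `(B k) ^ k`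
(`integral_norm_pow_swap_le`).

Boundedness of the resolvent. Only `|G_ij| ≤ 7` with overwhelming probability is needed, not
closeness to the semicircle law. It is propagated down dyadic scales of `η`: halving `η` at most
doubles `G_aa`, and the Schur complement formula with concentrated quadratic forms gives `(z + s)
G_aa ≈ -1`; averaging over `a` gives `(z + s) s ≈ -1`, which keeps `z + s` away from `0` and
restores the bound `7` (`Concentrated.bootstrap_step`, `norm_green_le_of_concentrated`).

Concentration of the quadratic forms follows from Markov's inequality for high moments. These are
bounded by adding the variables one at a time, each time using that `L ^ (2 p)` is 2-smooth with a
constant polynomial in `p` (`integral_norm_add_pow_le`); the order of the moment is then optimised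
(`exists_moment_order`). -/

namespace Wigner

/-! ### Resolvents of Hermitian matrices and the Ward identity. -/

section Green

variable {ι : Type*} [Fintype ι] [DecidableEq ι]

/-- The resolvent `(H - z)⁻¹`. -/
noncomputable def green (H : Matrix ι ι ℂ) (z : ℂ) : Matrix ι ι ℂ :=
  (H - z • (1 : Matrix ι ι ℂ))⁻¹

/-- A kernel vector `v` would give `⟨v, H v⟩ = z ‖v‖²`, whose left side is real. -/
lemma det_sub_smul_ne_zero {H : Matrix ι ι ℂ} (hH : H.IsHermitian) {z : ℂ} (hz : z.im ≠ 0) :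
    (H - z • (1 : Matrix ι ι ℂ)).det ≠ 0 := by
  intro h0
  obtain ⟨v, hv, hv0⟩ := Matrix.exists_mulVec_eq_zero_iff.mpr h0
  rw [Matrix.sub_mulVec, sub_eq_zero, Matrix.smul_mulVec, Matrix.one_mulVec] at hv0
  have h1 := hH.im_star_dotProduct_mulVec_self v
  rw [hv0, dotProduct_smul, smul_eq_mul] at h1
  have h2 : star v ⬝ᵥ v = ((∑ i, ‖v i‖ ^ 2 : ℝ) : ℂ) := by
    simp [dotProduct, Complex.conj_mul']
  rw [h2] at h1
  simp only [RCLike.im_to_complex, Complex.im_mul_ofReal] at h1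
  rcases mul_eq_zero.mp h1 with h | h
  · exact hz h
  · apply hv
    ext i
    have := (Finset.sum_eq_zero_iff_of_nonneg (fun i _ => by positivity)).mp h i (Finset.mem_univ i)
    simpa using this

lemma sub_mul_green {H : Matrix ι ι ℂ} {z : ℂ} (h : (H - z • (1 : Matrix ι ι ℂ)).det ≠ 0) :
    (H - z • (1 : Matrix ι ι ℂ)) * green H z = 1 :=
  Matrix.mul_nonsing_inv _ (isUnit_iff_ne_zero.mpr h)

lemma green_mul_sub {H : Matrix ι ι ℂ} {z : ℂ} (h : (H - z • (1 : Matrix ι ι ℂ)).det ≠ 0) :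
    green H z * (H - z • (1 : Matrix ι ι ℂ)) = 1 :=
  Matrix.nonsing_inv_mul _ (isUnit_iff_ne_zero.mpr h)

/-- The resolvent identity. -/
lemma green_sub_green {H H' : Matrix ι ι ℂ} {z z' : ℂ}
    (h : (H - z • (1 : Matrix ι ι ℂ)).det ≠ 0) (h' : (H' - z' • (1 : Matrix ι ι ℂ)).det ≠ 0) :
    green H z - green H' z' =
      green H z * ((H' - z' • (1 : Matrix ι ι ℂ)) - (H - z • (1 : Matrix ι ι ℂ))) * green H' z' := by
  rw [mul_sub, sub_mul, green_mul_sub h, mul_assoc, sub_mul_green h']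
  simp

lemma conjTranspose_green {H : Matrix ι ι ℂ} (hH : H.IsHermitian) (z : ℂ) :
    (green H z).conjTranspose = green H (starRingEnd ℂ z) := by
  rw [green, Matrix.conjTranspose_nonsing_inv, green, Matrix.conjTranspose_sub, hH.eq,
    Matrix.conjTranspose_smul, Matrix.conjTranspose_one]
  rfl

/-- The Ward identity: the resolvent identity for `z` and its conjugate reads `G - G* = (z - conj z)
G G*`; take the diagonal entry. It replaces a sum of `n` squares by one entry over `η`, and is the
source of every gain below. -/
lemma ward_row {H : Matrix ι ι ℂ} (hH : H.IsHermitian) {z : ℂ} (hz : 0 < z.im) (a : ι) :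
    z.im * ∑ j, ‖green H z a j‖ ^ 2 = (green H z a a).im := by
  have h1 := det_sub_smul_ne_zero hH hz.ne'
  have h2 : (H - (starRingEnd ℂ z) • (1 : Matrix ι ι ℂ)).det ≠ 0 :=
    det_sub_smul_ne_zero hH (by simpa using hz.ne')
  have h := green_sub_green h1 h2
  rw [← conjTranspose_green hH, sub_sub_sub_cancel_left, ← sub_smul] at h
  have h3 := congrFun (congrFun h a) a
  rw [Matrix.sub_apply, Matrix.conjTranspose_apply, Matrix.mul_smul, Matrix.smul_mul, mul_one,
    Matrix.smul_apply, Matrix.mul_apply] at h3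
  have h4 : ∑ j, green H z a j * (green H z).conjTranspose j a
      = ((∑ j, ‖green H z a j‖ ^ 2 : ℝ) : ℂ) := by
    push_cast
    exact Finset.sum_congr rfl fun j _ => by
      rw [Matrix.conjTranspose_apply]; exact Complex.mul_conj' _
  rw [h4, smul_eq_mul] at h3
  have h5 := congrArg Complex.im h3
  rw [Complex.im_mul_ofReal] at h5
  simp at h5
  linarith

lemma ward_col {H : Matrix ι ι ℂ} (hH : H.IsHermitian) {z : ℂ} (hz : 0 < z.im) (a : ι) :
    z.im * ∑ j, ‖green H z j a‖ ^ 2 = (green H z a a).im := by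
  have h1 := det_sub_smul_ne_zero hH hz.ne'
  have h2 : (H - (starRingEnd ℂ z) • (1 : Matrix ι ι ℂ)).det ≠ 0 :=
    det_sub_smul_ne_zero hH (by simpa using hz.ne')
  have h := green_sub_green h2 h1
  rw [← conjTranspose_green hH, sub_sub_sub_cancel_left, ← sub_smul] at h
  have h3 := congrFun (congrFun h a) a
  rw [Matrix.sub_apply, Matrix.conjTranspose_apply, Matrix.mul_smul, Matrix.smul_mul, mul_one,
    Matrix.smul_apply, Matrix.mul_apply] at h3
  have h4 : ∑ j, (green H z).conjTranspose a j * green H z j a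
      = ((∑ j, ‖green H z j a‖ ^ 2 : ℝ) : ℂ) := by
    push_cast
    exact Finset.sum_congr rfl fun j _ => by
      rw [Matrix.conjTranspose_apply]; exact Complex.conj_mul' _
  rw [h4, smul_eq_mul] at h3
  have h5 := congrArg Complex.im h3
  rw [Complex.im_mul_ofReal] at h5
  simp at h5
  linarith

lemma im_green_nonneg {H : Matrix ι ι ℂ} (hH : H.IsHermitian) {z : ℂ} (hz : 0 < z.im) (a : ι) :
    0 ≤ (green H z a a).im := by
  rw [← ward_row hH hz a]; positivity

lemma norm_green_diag_le {H : Matrix ι ι ℂ} (hH : H.IsHermitian) {z : ℂ} (hz : 0 < z.im) (a : ι) :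
    ‖green H z a a‖ ≤ 1 / z.im := by
  have h1 := ward_row hH hz a
  have h2 : ‖green H z a a‖ ^ 2 ≤ ∑ j, ‖green H z a j‖ ^ 2 :=
    Finset.single_le_sum (f := fun j => ‖green H z a j‖ ^ 2) (fun i _ => by positivity)
      (Finset.mem_univ a)
  have h3 : (green H z a a).im ≤ ‖green H z a a‖ := (le_abs_self _).trans (Complex.abs_im_le_norm _)
  rw [le_div_iff₀ hz]
  by_contra! h
  have h5 := mul_le_mul_of_nonneg_left h2 hz.le
  have h6 : 0 < ‖green H z a a‖ := by
    rcases (norm_nonneg (green H z a a)).eq_or_lt with h0 | h0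
    · rw [← h0] at h; linarith
    · exact h0
  nlinarith

lemma norm_green_le {H : Matrix ι ι ℂ} (hH : H.IsHermitian) {z : ℂ} (hz : 0 < z.im) (a b : ι) :
    ‖green H z a b‖ ≤ 1 / z.im := by
  have h1 := ward_row hH hz a
  have h2 : ‖green H z a b‖ ^ 2 ≤ ∑ j, ‖green H z a j‖ ^ 2 :=
    Finset.single_le_sum (f := fun j => ‖green H z a j‖ ^ 2) (fun i _ => by positivity)
      (Finset.mem_univ b)
  have h3 : (green H z a a).im ≤ ‖green H z a a‖ := (le_abs_self _).trans (Complex.abs_im_le_norm _)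
  have h4 := norm_green_diag_le hH hz a
  have h5 := mul_le_mul_of_nonneg_left h2 hz.le
  have h6 : ‖green H z a b‖ ^ 2 ≤ (1 / z.im) ^ 2 := by
    rw [div_pow, one_pow, le_div_iff₀ (by positivity)]
    rw [le_div_iff₀ hz] at h4
    nlinarith
  exact (sq_le_sq₀ (norm_nonneg _) (by positivity)).mp h6

/-- If the diagonal entry vanished, the Ward identity would annihilate the whole row `a` of an
invertible matrix. -/
lemma norm_green_diag_pos {H : Matrix ι ι ℂ} (hH : H.IsHermitian) {z : ℂ} (hz : 0 < z.im) (a : ι) :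
    0 < ‖green H z a a‖ := by
  rw [norm_pos_iff]
  intro h0
  have h1 := ward_row hH hz a
  rw [h0, Complex.zero_im] at h1
  have h2 : ∑ j, ‖green H z a j‖ ^ 2 = 0 := by
    rcases mul_eq_zero.mp h1 with h | h
    · exact absurd h hz.ne'
    · exact h
  have h3 := congrFun (congrFun (green_mul_sub (det_sub_smul_ne_zero hH hz.ne')) a) a
  rw [Matrix.mul_apply, Matrix.one_apply_eq, Finset.sum_eq_zero] at h3
  · exact zero_ne_one h3
  · intro j _
    have := (Finset.sum_eq_zero_iff_of_nonneg (fun i _ => by positivity)).mp h2 j (Finset.mem_univ j)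
    have : green H z a j = 0 := by simpa using this
    rw [this, zero_mul]

/-- Entries of products of two resolvents are controlled through the Ward identity. -/
lemma norm_sum_green_mul_green_le {H H' : Matrix ι ι ℂ} (hH : H.IsHermitian) (hH' : H'.IsHermitian)
    {z z' : ℂ} (hz : 0 < z.im) (hz' : 0 < z'.im) (a b : ι) :
    ‖(green H z * green H' z') a b‖ ^ 2 ≤
      ((green H z a a).im / z.im) * ((green H' z' b b).im / z'.im) := by
  rw [Matrix.mul_apply]
  have h1 : ‖∑ j, green H z a j * green H' z' j b‖ ≤ ∑ j, ‖green H z a j‖ * ‖green H' z' j b‖ :=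
    (norm_sum_le _ _).trans (le_of_eq (by simp))
  have h2 := Finset.sum_mul_sq_le_sq_mul_sq Finset.univ (fun j => ‖green H z a j‖)
    (fun j => ‖green H' z' j b‖)
  rw [← ward_row hH hz a, ← ward_col hH' hz' b, mul_div_cancel_left₀ _ hz.ne',
    mul_div_cancel_left₀ _ hz'.ne']
  exact (pow_le_pow_left₀ (norm_nonneg _) h1 2).trans h2

/-- Halving the imaginary part at most doubles a diagonal entry of the resolvent. -/
lemma norm_green_diag_le_two_mul {H : Matrix ι ι ℂ} (hH : H.IsHermitian) {z w : ℂ}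
    (hz : 0 < z.im) (hre : w.re = z.re) (him : w.im = 2 * z.im) (a : ι) :
    ‖green H z a a‖ ≤ 2 * ‖green H w a a‖ := by
  have hw : 0 < w.im := by rw [him]; positivity
  have h := green_sub_green (det_sub_smul_ne_zero hH hz.ne') (det_sub_smul_ne_zero hH hw.ne')
  rw [sub_sub_sub_cancel_left, ← sub_smul, Matrix.mul_smul, mul_one, Matrix.smul_mul] at h
  have h1 := congrFun (congrFun h a) a
  rw [Matrix.sub_apply, Matrix.smul_apply, smul_eq_mul] at h1
  have h2 := norm_sum_green_mul_green_le hH hH hz hw a a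
  set x := ‖green H z a a‖
  set y := ‖green H w a a‖
  have hx : (green H z a a).im ≤ x := (le_abs_self _).trans (Complex.abs_im_le_norm _)
  have hy : (green H w a a).im ≤ y := (le_abs_self _).trans (Complex.abs_im_le_norm _)
  have hx0 : 0 ≤ x := norm_nonneg _
  have hy0 : 0 ≤ y := norm_nonneg _
  have hzw : z - w = ((-z.im : ℝ) : ℂ) * Complex.I := by
    apply Complex.ext <;> simp [hre, him]
    ring
  have hnzw : ‖z - w‖ = z.im := by
    rw [hzw, norm_mul, Complex.norm_I, mul_one, Complex.norm_real, Real.norm_eq_abs, abs_neg,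
      abs_of_pos hz]
  have h3 : x - y ≤ z.im * ‖(green H z * green H w) a a‖ := by
    calc x - y ≤ ‖green H z a a - green H w a a‖ := norm_sub_norm_le _ _
      _ = _ := by rw [h1, norm_mul, hnzw]
  have h4 : (z.im * ‖(green H z * green H w) a a‖) ^ 2 ≤ x * y / 2 := by
    rw [mul_pow]
    calc z.im ^ 2 * ‖(green H z * green H w) a a‖ ^ 2
        ≤ z.im ^ 2 * (((green H z a a).im / z.im) * ((green H w a a).im / w.im)) := by gcongr
      _ = (green H z a a).im * (green H w a a).im / 2 := by rw [him]; field_simp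
      _ ≤ x * y / 2 := by
        have := im_green_nonneg hH hw a
        gcongr
  -- `(x - y)² ≤ x y / 2` factors as `(x - 2 y) (x - y / 2) ≤ 0`, which fails for `x > 2 y ≥ 0`.
  by_contra! hxy
  have h5 : (x - y) ^ 2 ≤ x * y / 2 :=
    (pow_le_pow_left₀ (by linarith) h3 2).trans h4
  nlinarith

end Green

/-! ### Deletion of rows and columns, and Schur complements. -/

section Schur

variable {ι : Type*} [DecidableEq ι]

/-- The matrix `H` with the rows and columns in `S` replaced by zero. -/
def zeroOut (S : Finset ι) (H : Matrix ι ι ℂ) : Matrix ι ι ℂ :=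
  Matrix.of fun i j => if i ∈ S ∨ j ∈ S then 0 else H i j

lemma zeroOut_apply (S : Finset ι) (H : Matrix ι ι ℂ) (i j : ι) :
    zeroOut S H i j = if i ∈ S ∨ j ∈ S then 0 else H i j := rfl

lemma isHermitian_zeroOut (S : Finset ι) {H : Matrix ι ι ℂ} (hH : H.IsHermitian) :
    (zeroOut S H).IsHermitian := by
  ext i j
  rw [Matrix.conjTranspose_apply, zeroOut_apply, zeroOut_apply]
  by_cases h : i ∈ S ∨ j ∈ S
  · rw [if_pos h, if_pos h.symm, star_zero]
  · rw [if_neg h, if_neg (fun h' => h h'.symm), hH.apply]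

lemma zeroOut_zeroOut (S T : Finset ι) (H : Matrix ι ι ℂ) :
    zeroOut S (zeroOut T H) = zeroOut (S ∪ T) H := by
  ext i j
  simp only [zeroOut_apply, Finset.mem_union]
  split_ifs <;> tauto

variable [Fintype ι]

/-- Zeroing a row and column, instead of removing them, keeps the index type; the price is a
decoupled `1 × 1` block `-z`, hence the extra `-1 / z` at `(a, a)`. The proof checks that the right
side is an inverse. -/
lemma green_zeroOut_singleton {H : Matrix ι ι ℂ} (hH : H.IsHermitian) {z : ℂ} (hz : 0 < z.im)
    (a : ι) : green (zeroOut {a} H) z = Matrix.of fun i k =>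
      green H z i k - green H z i a * green H z a k / green H z a a
        + if i = a ∧ k = a then -1 / z else 0 := by
  have hz0 : z ≠ 0 := by rintro rfl; simp at hz
  have hG : green H z a a ≠ 0 := norm_pos_iff.mp (norm_green_diag_pos hH hz a)
  have hone := sub_mul_green (det_sub_smul_ne_zero hH hz.ne')
  have hent (i k : ι) : ∑ j, (H - z • (1 : Matrix ι ι ℂ)) i j * green H z j k = if i = k then 1 else 0 := by
    rw [← Matrix.mul_apply, hone, Matrix.one_apply]
  refine Matrix.inv_eq_right_inv ?_
  ext i k
  rw [Matrix.mul_apply, Matrix.one_apply]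
  by_cases hia : i = a
  · subst hia
    rw [Finset.sum_eq_single i]
    · simp only [Matrix.sub_apply, zeroOut_apply, Finset.mem_singleton, Matrix.smul_apply, Matrix.of_apply]
      simp only [true_or, if_true, Matrix.one_apply_eq, smul_eq_mul, true_and, eq_comm (a := k)]
      rw [mul_div_cancel_left₀ _ hG, sub_self, zero_add]
      split_ifs
      · field_simp; ring
      · simp
    · intro j _ hj
      simp [zeroOut_apply, Matrix.one_apply_ne hj.symm]
    · simp
  · have : ∀ j, (zeroOut {a} H - z • (1 : Matrix ι ι ℂ)) i j * (Matrix.of fun i k =>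
          green H z i k - green H z i a * green H z a k / green H z a a
          + if i = a ∧ k = a then -1 / z else 0) j k
        = (H - z • (1 : Matrix ι ι ℂ)) i j * green H z j k
          - (H - z • (1 : Matrix ι ι ℂ)) i j * green H z j a * (green H z a k / green H z a a) := by
      intro j
      by_cases hja : j = a
      · subst hja
        simp only [Matrix.sub_apply, zeroOut_apply, Matrix.smul_apply, Matrix.one_apply_ne hia]
        rw [mul_assoc _ (green H z j j), mul_div_cancel₀ _ hG]
        simp
      · simp only [Matrix.sub_apply, zeroOut_apply, Matrix.smul_apply, Matrix.of_apply,
          Finset.mem_singleton, hia, hja, false_or, if_false, false_and, add_zero]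
        ring
    simp_rw [this, Finset.sum_sub_distrib, ← Finset.sum_mul, hent]
    simp [hia]

/-- Deleting one row and column changes the trace of the resolvent by at most `2 / η`. -/
lemma norm_trace_green_zeroOut_singleton_sub_le {H : Matrix ι ι ℂ} (hH : H.IsHermitian) {z : ℂ}
    (hz : 0 < z.im) (a : ι) :
    ‖(green (zeroOut {a} H) z).trace - (green H z).trace‖ ≤ 2 / z.im := by
  have hG := norm_green_diag_pos hH hz a
  have h1 : (green (zeroOut {a} H) z).trace - (green H z).trace
      = -((green H z * green H z) a a / green H z a a) + -1 / z := by
    rw [green_zeroOut_singleton hH hz, Matrix.trace, Matrix.trace, ← Finset.sum_sub_distrib,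
      Matrix.mul_apply, Finset.sum_div, ← Finset.sum_neg_distrib]
    have : (-1 / z : ℂ) = ∑ i, if i = a then -1 / z else 0 := by simp
    conv_rhs => rw [this]
    rw [← Finset.sum_add_distrib]
    refine Finset.sum_congr rfl fun i _ => ?_
    simp only [Matrix.diag_apply, Matrix.of_apply, and_self]
    ring
  have h2 := norm_sum_green_mul_green_le hH hH hz hz a a
  have him : (green H z a a).im ≤ ‖green H z a a‖ :=
    (le_abs_self _).trans (Complex.abs_im_le_norm _)
  -- Cauchy–Schwarz and Ward give `|(G²)_aa| ≤ Im G_aa / η`, so the quotient by `G_aa` costs only `1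
  -- / η`, however small `G_aa` is.
  have h3 : ‖(green H z * green H z) a a‖ ≤ ‖green H z a a‖ / z.im := by
    refine (sq_le_sq₀ (norm_nonneg _) (by positivity)).mp (h2.trans ?_)
    rw [← sq]
    have := im_green_nonneg hH hz a
    gcongr
  have h4 : ‖-1 / z‖ ≤ 1 / z.im := by
    rw [norm_div, norm_neg, norm_one]
    exact one_div_le_one_div_of_le hz ((le_abs_self _).trans (Complex.abs_im_le_norm _))
  rw [h1]
  calc _ ≤ ‖(green H z * green H z) a a / green H z a a‖ + ‖-1 / z‖ := by
        refine (norm_add_le _ _).trans (by rw [norm_neg])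
    _ ≤ 1 / z.im + 1 / z.im := by
        gcongr
        rw [norm_div, div_le_iff₀ hG]
        exact h3.trans_eq (by ring)
    _ = 2 / z.im := by ring

lemma norm_trace_green_zeroOut_pair_sub_le {H : Matrix ι ι ℂ} (hH : H.IsHermitian) {z : ℂ}
    (hz : 0 < z.im) (a b : ι) :
    ‖(green (zeroOut {a, b} H) z).trace - (green H z).trace‖ ≤ 4 / z.im := by
  have h1 := norm_trace_green_zeroOut_singleton_sub_le hH hz b
  have h2 := norm_trace_green_zeroOut_singleton_sub_le (isHermitian_zeroOut {b} hH) hz a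
  rw [zeroOut_zeroOut] at h2
  calc _ = ‖((green (zeroOut ({a} ∪ {b}) H) z).trace - (green (zeroOut {b} H) z).trace)
        + ((green (zeroOut {b} H) z).trace - (green H z).trace)‖ := by
        rw [sub_add_sub_cancel]; rfl
    _ ≤ 2 / z.im + 2 / z.im := (norm_add_le _ _).trans (add_le_add h2 h1)
    _ = 4 / z.im := by ring

lemma green_zeroOut_apply_eq_zero (S : Finset ι) {H : Matrix ι ι ℂ} (hH : H.IsHermitian) {z : ℂ}
    (hz : 0 < z.im) {i y : ι} (hi : i ∉ S) (hy : y ∈ S) : green (zeroOut S H) z i y = 0 := by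
  have hz0 : z ≠ 0 := by rintro rfl; simp at hz
  have h := congrFun (congrFun (green_mul_sub
    (det_sub_smul_ne_zero (isHermitian_zeroOut S hH) hz.ne')) i) y
  rw [Matrix.mul_apply, Matrix.one_apply_ne (by rintro rfl; exact hi hy),
    Finset.sum_eq_single y] at h
  · simpa [zeroOut_apply, hy, hz0] using h
  · intro j _ hj
    simp [zeroOut_apply, hy, Matrix.one_apply_ne hj]
  · simp

/-- The bilinear form in the Schur complement formula for the rows `x` and `w`. -/
noncomputable def schurForm (S : Finset ι) (H : Matrix ι ι ℂ) (z : ℂ) (x w : ι) : ℂ :=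
  ∑ i ∈ Sᶜ, ∑ j ∈ Sᶜ, H x i * green (zeroOut S H) z i j * H j w

/-- This is the resolvent identity for `H` and its minor: the minor's resolvent is block diagonal,
so its own `(i, y)` entry drops out, and in a row outside `S` the two matrices differ only in the
columns of `S`. -/
lemma green_apply_eq_neg_sum (S : Finset ι) {H : Matrix ι ι ℂ} (hH : H.IsHermitian) {z : ℂ}
    (hz : 0 < z.im) {i y : ι} (hi : i ∉ S) (hy : y ∈ S) :
    green H z i y = -∑ j ∈ Sᶜ, ∑ w ∈ S, green (zeroOut S H) z i j * H j w * green H z w y := by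
  have h := congrFun (congrFun (green_sub_green
    (det_sub_smul_ne_zero (isHermitian_zeroOut S hH) hz.ne')
    (det_sub_smul_ne_zero hH hz.ne')) i) y
  rw [sub_sub_sub_cancel_right, Matrix.sub_apply, green_zeroOut_apply_eq_zero S hH hz hi hy,
    zero_sub, mul_assoc, Matrix.mul_apply] at h
  rw [← neg_eq_iff_eq_neg, h, ← Finset.sum_compl_add_sum S]
  rw [Finset.sum_eq_zero (s := S), add_zero]
  · refine Finset.sum_congr rfl fun j hj => ?_
    rw [Finset.mem_compl] at hj
    rw [Matrix.mul_apply, ← Finset.sum_compl_add_sum S, Finset.sum_eq_zero (s := Sᶜ), zero_add,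
      Finset.mul_sum]
    · refine Finset.sum_congr rfl fun w hw => ?_
      simp [zeroOut_apply, hw, mul_assoc]
    · intro w hw
      rw [Finset.mem_compl] at hw
      simp [zeroOut_apply, hw, hj]
  · intro j hj
    rw [green_zeroOut_apply_eq_zero S hH hz hi hj, zero_mul]

/-- The Schur complement formula. -/
lemma sum_schur_mul_green (S : Finset ι) {H : Matrix ι ι ℂ} (hH : H.IsHermitian) {z : ℂ}
    (hz : 0 < z.im) {x y : ι} (hx : x ∈ S) (hy : y ∈ S) :
    ∑ w ∈ S, (H x w - schurForm S H z x w - if x = w then z else 0) * green H z w y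
      = if x = y then 1 else 0 := by
  have h := congrFun (congrFun (sub_mul_green (det_sub_smul_ne_zero hH hz.ne')) x) y
  rw [Matrix.mul_apply, Matrix.one_apply, ← Finset.sum_compl_add_sum S] at h
  rw [← h]
  -- Eliminating the entries of `G` outside `S` turns the coupling to the complement of `S` into the
  -- quadratic form `schurForm`.
  have h1 : ∑ i ∈ Sᶜ, (H - z • (1 : Matrix ι ι ℂ)) x i * green H z i y
      = -∑ w ∈ S, schurForm S H z x w * green H z w y := by
    simp_rw [schurForm, Finset.sum_mul]
    rw [Finset.sum_comm, ← Finset.sum_neg_distrib]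
    refine Finset.sum_congr rfl fun i hi => ?_
    rw [Finset.mem_compl] at hi
    rw [green_apply_eq_neg_sum S hH hz hi hy, Finset.sum_comm (s := S)]
    have : x ≠ i := by rintro rfl; exact hi hx
    simp only [Matrix.sub_apply, Matrix.smul_apply, Matrix.one_apply_ne this, smul_zero, sub_zero,
      mul_neg, Finset.mul_sum]
    congr 1
    refine Finset.sum_congr rfl fun j _ => Finset.sum_congr rfl fun w _ => ?_
    ring
  rw [h1, neg_add_eq_sub, ← Finset.sum_sub_distrib]
  refine Finset.sum_congr rfl fun w _ => ?_
  simp only [Matrix.sub_apply, Matrix.smul_apply, Matrix.one_apply, smul_eq_mul, mul_ite, mul_one,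
    mul_zero]
  ring

end Schur

/-! ### From concentrated Schur forms to bounded resolvent entries. -/

section Bootstrap

variable {n : ℕ}

/-- The entries of `H` are at most `r`, and the Schur complement forms of all pairs of rows are
within `l / n` times a Hilbert–Schmidt norm of their expectation given the other rows. -/
def Concentrated (H : Matrix (Fin n) (Fin n) ℂ) (z : ℂ) (l r : ℝ) : Prop :=
  ∀ a b x w : Fin n, x ∈ ({a, b} : Finset (Fin n)) → w ∈ ({a, b} : Finset (Fin n)) →
    ‖H x w‖ ≤ r ∧
    ‖schurForm {a, b} H z x w - if x = w then
        (1 / n : ℂ) * ∑ i ∈ ({a, b} : Finset (Fin n))ᶜ, green (zeroOut {a, b} H) z i i else 0‖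
      ≤ l / n * √(∑ i, ∑ j, ‖green (zeroOut {a, b} H) z i j‖ ^ 2)

lemma sum_norm_green_sq {ι : Type*} [Fintype ι] [DecidableEq ι] {H : Matrix ι ι ℂ}
    (hH : H.IsHermitian) {z : ℂ} (hz : 0 < z.im) :
    ∑ i, ∑ j, ‖green H z i j‖ ^ 2 = (green H z).trace.im / z.im := by
  rw [eq_div_iff hz.ne', mul_comm, Finset.mul_sum, Matrix.trace, Complex.im_sum]
  exact Finset.sum_congr rfl fun i _ => ward_row hH hz i

lemma norm_trace_green_le {H : Matrix (Fin n) (Fin n) ℂ} {z : ℂ} {c : ℝ}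
    (h : ∀ a, ‖green H z a a‖ ≤ c) : ‖(green H z).trace‖ ≤ n * c := by
  refine (norm_sum_le _ _).trans ((Finset.sum_le_sum fun a _ => h a).trans ?_)
  simp

/-- By Ward the Hilbert–Schmidt norm squared is `Im tr G' / η`, and `tr G'` is at most `14 n` from
the a priori bound plus `4 / η ≤ 4 n` from deleting two rows: this is the `18`. The `6` is the `4 /
η` again, for replacing the minor's trace by `tr G`, plus `2 / η` for the two deleted diagonal
entries. -/
lemma Concentrated.norm_schur_error_le {H : Matrix (Fin n) (Fin n) ℂ} (hH : H.IsHermitian)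
    {z : ℂ} (hz : 0 < z.im) {l r : ℝ} (hl : 0 ≤ l) (hc : Concentrated H z l r)
    (hn : 1 ≤ n * z.im) (hs : ∀ a, ‖green H z a a‖ ≤ 14) {a b x w : Fin n}
    (hx : x ∈ ({a, b} : Finset (Fin n))) (hw : w ∈ ({a, b} : Finset (Fin n))) :
    ‖H x w - schurForm {a, b} H z x w + if x = w then (1 / n : ℂ) * (green H z).trace else 0‖
      ≤ r + l * √(18 / (n * z.im)) + 6 / (n * z.im) := by
  obtain ⟨h1, h2⟩ := hc a b x w hx hw
  set S : Finset (Fin n) := {a, b} with hS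
  set G' := green (zeroOut S H) z with hG'
  have hn0 : (0 : ℝ) < n := by
    rcases Nat.eq_zero_or_pos n with h | h
    · subst h; norm_num at hn
    · exact_mod_cast h
  have htr := norm_trace_green_zeroOut_pair_sub_le hH hz a b
  rw [← hS, ← hG'] at htr
  have htr0 := norm_trace_green_le hs
  have hhs : l / n * √(∑ i, ∑ j, ‖G' i j‖ ^ 2) ≤ l * √(18 / (n * z.im)) := by
    rw [hG', sum_norm_green_sq (isHermitian_zeroOut S hH) hz, ← hG', div_mul_eq_mul_div, mul_div_assoc]
    refine mul_le_mul_of_nonneg_left ?_ hl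
    rw [div_le_iff₀ hn0, Real.sqrt_le_left (by positivity), mul_pow, Real.sq_sqrt (by positivity)]
    have h4 : G'.trace.im ≤ 4 / z.im + n * 14 := by
      calc G'.trace.im ≤ ‖G'.trace‖ := (le_abs_self _).trans (Complex.abs_im_le_norm _)
        _ = ‖(G'.trace - (green H z).trace) + (green H z).trace‖ := by rw [sub_add_cancel]
        _ ≤ _ := (norm_add_le _ _).trans (add_le_add htr htr0)
    have h5 : 4 / z.im ≤ 4 * n := by
      rw [div_le_iff₀ hz]; nlinarith
    calc G'.trace.im / z.im ≤ (18 * n) / z.im := by gcongr; linarith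
      _ = 18 / (n * z.im) * n ^ 2 := by field_simp
  have hdiag : ‖(if x = w then (1 / n : ℂ) * (green H z).trace else 0) - (if x = w then
        (1 / n : ℂ) * ∑ i ∈ Sᶜ, G' i i else 0)‖ ≤ 6 / (n * z.im) := by
    split_ifs
    · rw [← mul_sub, norm_mul]
      have h6 : (green H z).trace - ∑ i ∈ Sᶜ, G' i i
          = -(G'.trace - (green H z).trace) + ∑ i ∈ S, G' i i := by
        rw [Matrix.trace, Matrix.trace, ← Finset.sum_compl_add_sum S (fun i => G'.diag i)]
        simp only [Matrix.diag_apply]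
        ring
      have h7 : ‖∑ i ∈ S, G' i i‖ ≤ 2 / z.im := by
        calc _ ≤ ∑ i ∈ S, 1 / z.im := (norm_sum_le _ _).trans (Finset.sum_le_sum fun i _ =>
              norm_green_diag_le (isHermitian_zeroOut S hH) hz i)
          _ = S.card * (1 / z.im) := by simp
          _ ≤ 2 * (1 / z.im) := by
            gcongr; exact_mod_cast Finset.card_le_two
          _ = _ := by ring
      have h8 : ‖(1 / n : ℂ)‖ = 1 / n := by simp
      rw [h6, h8]
      calc _ ≤ 1 / (n : ℝ) * (4 / z.im + 2 / z.im) := by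
            gcongr
            refine (norm_add_le _ _).trans (add_le_add ?_ h7)
            rwa [norm_neg]
        _ = _ := by field_simp; norm_num
    · simp; positivity
  have heq : H x w - schurForm S H z x w + (if x = w then (1 / n : ℂ) * (green H z).trace else 0)
      = H x w + -(schurForm S H z x w - if x = w then (1 / n : ℂ) * ∑ i ∈ Sᶜ, G' i i else 0)
        + ((if x = w then (1 / n : ℂ) * (green H z).trace else 0) - (if x = w then
        (1 / n : ℂ) * ∑ i ∈ Sᶜ, G' i i else 0)) := by ring
  rw [heq]
  refine (norm_add_le _ _).trans (add_le_add ((norm_add_le _ _).trans (add_le_add h1 ?_)) hdiag)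
  rw [norm_neg]
  exact h2.trans hhs

/-- A priori bounded diagonal resolvent entries of a concentrated matrix satisfy a better bound,
and then `z + s` is bounded away from zero. -/
lemma Concentrated.bootstrap_step {H : Matrix (Fin n) (Fin n) ℂ} (hH : H.IsHermitian)
    {z : ℂ} (hz : 0 < z.im) (hz4 : ‖z‖ ≤ 4) {l r : ℝ} (hl : 0 ≤ l) (hc : Concentrated H z l r)
    (hn : 1 ≤ n * z.im) (hε : r + l * √(18 / (n * z.im)) + 6 / (n * z.im) ≤ 1 / 1000)
    (hs : ∀ a, ‖green H z a a‖ ≤ 14) :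
    1 / 6 ≤ ‖z + (1 / n : ℂ) * (green H z).trace‖ ∧ ∀ a, ‖green H z a a‖ ≤ 7 := by
  have hn0 : (0 : ℝ) < n := by
    rcases Nat.eq_zero_or_pos n with h | h
    · subst h; norm_num at hn
    · exact_mod_cast h
  set s := (1 / n : ℂ) * (green H z).trace with hs_def
  have key : ∀ a, ∃ e : ℂ, ‖e‖ ≤ 1 / 1000 ∧ (e - (z + s)) * green H z a a = 1 := by
    intro a
    -- The pair is allowed to degenerate: `{a, a} = {a}` gives the scalar Schur formula for one row.
    have ha : a ∈ ({a, a} : Finset (Fin n)) := by simp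
    refine ⟨_, (hc.norm_schur_error_le hH hz hl hn hs ha ha).trans hε, ?_⟩
    have := sum_schur_mul_green {a, a} hH hz ha ha
    simp only [Finset.mem_singleton, Finset.insert_eq_of_mem, Finset.sum_singleton, if_true] at this ⊢
    linear_combination this
  have hlow : ∀ a : Fin n, 1 / 15 ≤ ‖z + s‖ := by
    intro a
    obtain ⟨e, he, h1⟩ := key a
    have h2 : ‖e - (z + s)‖ * ‖green H z a a‖ = 1 := by rw [← norm_mul, h1, norm_one]
    have h3 : 1 / 14 ≤ ‖e - (z + s)‖ := by
      have := hs a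
      rw [div_le_iff₀ (by norm_num), ← h2]
      gcongr
    have h4 : ‖e - (z + s)‖ ≤ ‖e‖ + ‖z + s‖ := norm_sub_le _ _
    norm_num at *; linarith
  have hclose : ∀ a, ‖(z + s) * green H z a a + 1‖ ≤ 14 / 1000 := by
    intro a
    obtain ⟨e, he, h1⟩ := key a
    have : (z + s) * green H z a a + 1 = e * green H z a a := by rw [← h1]; ring
    rw [this, norm_mul]
    calc ‖e‖ * ‖green H z a a‖ ≤ 1 / 1000 * 14 := by gcongr; exact hs a
      _ = _ := by norm_num
  have havg : ‖(z + s) * s + 1‖ ≤ 14 / 1000 := by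
    have h1 : (z + s) * s + 1 = (1 / n : ℂ) * ∑ a, ((z + s) * green H z a a + 1) := by
      have hn' : (n : ℂ) ≠ 0 := by exact_mod_cast hn0.ne'
      rw [Finset.sum_add_distrib, ← Finset.mul_sum]
      nth_rewrite 2 [hs_def]
      simp only [Matrix.trace, Matrix.diag_apply, Finset.sum_const, Finset.card_univ,
        Fintype.card_fin, nsmul_eq_mul, mul_one]
      field_simp
    have h8 : ‖(1 / n : ℂ)‖ = 1 / n := by simp
    rw [h1, norm_mul, h8, one_div_mul_eq_div, div_le_iff₀ hn0]
    refine (norm_sum_le _ _).trans ((Finset.sum_le_sum fun a _ => hclose a).trans ?_)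
    simp [mul_comm]
  -- If `|z + s| < 1/6`, then `|s| < 1/6 + 4` and `|(z + s) s| ≤ 25/36`, too small for `(z + s) s`
  -- to lie within `14/1000` of `-1`.
  have h6 : 1 / 6 ≤ ‖z + s‖ := by
    by_contra! h
    have h1 : ‖s‖ ≤ ‖z + s‖ + ‖z‖ := by
      calc ‖s‖ = ‖(z + s) - z‖ := by rw [add_sub_cancel_left]
        _ ≤ _ := norm_sub_le _ _
    have h2 : (1 : ℝ) ≤ ‖(z + s) * s + 1‖ + ‖z + s‖ * ‖s‖ := by
      calc (1 : ℝ) = ‖((z + s) * s + 1) - (z + s) * s‖ := by simp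
        _ ≤ _ := (norm_sub_le _ _).trans (by rw [norm_mul])
    have : ‖z + s‖ * ‖s‖ ≤ 1 / 6 * (1 / 6 + 4) := by
      gcongr; linarith
    norm_num at *; linarith
  refine ⟨h6, fun a => ?_⟩
  have h1 := hclose a
  have h2 : ‖z + s‖ * ‖green H z a a‖ ≤ 14 / 1000 + 1 := by
    calc ‖z + s‖ * ‖green H z a a‖ = ‖((z + s) * green H z a a + 1) - 1‖ := by
          rw [add_sub_cancel_right, norm_mul]
      _ ≤ _ := (norm_sub_le _ _).trans (by rw [norm_one]; gcongr)
  by_contra! h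
  have : 1 / 6 * 7 ≤ ‖z + s‖ * ‖green H z a a‖ := by gcongr
  norm_num at *; linarith

/-- The smallness condition at the lowest scale is thereby inherited by all higher ones. -/
lemma error_mono {l r η η' : ℝ} (hl : 0 ≤ l) (hη : 0 < (n : ℝ) * η) (h : η ≤ η') :
    r + l * √(18 / (n * η')) + 6 / (n * η') ≤ r + l * √(18 / (n * η)) + 6 / (n * η) := by
  have : 0 ≤ (n : ℝ) := Nat.cast_nonneg n
  gcongr

/-- If a matrix is concentrated at all dyadic scales above `z`, then the diagonal entries of its
resolvent at `z` are bounded. -/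
lemma norm_green_diag_le_of_concentrated {H : Matrix (Fin n) (Fin n) ℂ} (hH : H.IsHermitian)
    {l r : ℝ} (hl : 0 ≤ l) {E : ℝ} (hE : |E| ≤ 3) (N : ℕ) :
    ∀ η : ℝ, 0 < η → 1 ≤ 2 ^ N * η → 1 ≤ n * η →
      (r + l * √(18 / (n * η)) + 6 / (n * η) ≤ 1 / 1000) →
      (∀ k < N, Concentrated H ⟨E, 2 ^ k * η⟩ l r) →
      ∀ a, ‖green H ⟨E, η⟩ a a‖ ≤ 7 := by
  induction N with
  | zero =>
    intro η hη h1 _ _ _ a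
    refine (norm_green_diag_le hH hη a).trans ?_
    rw [div_le_iff₀ hη]
    simp at h1
    linarith
  | succ N ih =>
    intro η hη h1 hn hε hc a
    by_cases h2 : 1 ≤ η
    · refine (norm_green_diag_le hH (z := ⟨E, η⟩) hη a).trans ?_
      rw [div_le_iff₀ hη]
      linarith
    push Not at h2
    -- The dyadic scales above `2 η` are those above `η` without the lowest one, which is kept for
    -- the bootstrap at `η` itself.
    have hprev := ih (2 * η) (by positivity) (by rw [pow_succ] at h1; linarith) (by nlinarith)
      ((error_mono hl (by linarith) (by linarith)).trans hε)
      (fun k hk => by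
        have := hc (k + 1) (by omega)
        rw [pow_succ, mul_assoc] at this
        exact this)
    have h14 : ∀ a, ‖green H ⟨E, η⟩ a a‖ ≤ 14 := fun a =>
      (norm_green_diag_le_two_mul hH (z := ⟨E, η⟩) (w := ⟨E, 2 * η⟩) hη rfl rfl a).trans (by
        linarith [hprev a])
    have h0 := hc 0 (by omega)
    rw [pow_zero, one_mul] at h0
    have hz4 : ‖(⟨E, η⟩ : ℂ)‖ ≤ 4 := by
      refine (Complex.norm_le_abs_re_add_abs_im _).trans ?_
      simp only
      rw [abs_of_pos hη]
      linarith
    exact (h0.bootstrap_step hH (z := ⟨E, η⟩) hη hz4 hl hn hε h14).2 a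

/-- The same hypotheses bound the off-diagonal entries of the resolvent. -/
lemma norm_green_le_of_concentrated {H : Matrix (Fin n) (Fin n) ℂ} (hH : H.IsHermitian)
    {l r : ℝ} (hl : 0 ≤ l) {z : ℂ} (hE : |z.re| ≤ 3) (hz : 0 < z.im) (hz1 : z.im ≤ 1)
    (hn : 1 ≤ n * z.im) (hε : r + l * √(18 / (n * z.im)) + 6 / (n * z.im) ≤ 1 / 1000)
    (hc : ∀ k < n, Concentrated H ⟨z.re, 2 ^ k * z.im⟩ l r) (x y : Fin n) :
    ‖green H z x y‖ ≤ 7 := by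
  have hn0 : 0 < n := by
    rcases Nat.eq_zero_or_pos n with h | h
    · subst h; norm_num at hn
    · exact h
  -- Since `n ≤ 2 ^ n`, at most `n` doublings lift `η ≥ 1 / n` above `1`, where the resolvent is
  -- trivially bounded.
  have h2n : 1 ≤ 2 ^ n * z.im := by
    refine hn.trans ?_
    gcongr
    exact_mod_cast Nat.lt_two_pow_self.le
  have hdiag : ∀ a, ‖green H z a a‖ ≤ 7 :=
    norm_green_diag_le_of_concentrated hH hl hE n z.im hz h2n hn hε hc
  have hc0 : Concentrated H z l r := by simpa using hc 0 hn0
  have h14 : ∀ a, ‖green H z a a‖ ≤ 14 := fun a => (hdiag a).trans (by norm_num)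
  have hz4 : ‖z‖ ≤ 4 := by
    refine (Complex.norm_le_abs_re_add_abs_im _).trans ?_
    rw [abs_of_pos hz]
    linarith
  have hlow := (hc0.bootstrap_step hH hz hz4 hl hn hε h14).1
  rcases eq_or_ne x y with rfl | hxy
  · exact hdiag x
  set s := (1 / n : ℂ) * (green H z).trace
  have hx : x ∈ ({x, y} : Finset (Fin n)) := by simp
  have hy : y ∈ ({x, y} : Finset (Fin n)) := by simp
  have h := sum_schur_mul_green {x, y} hH hz hx hy
  rw [Finset.sum_pair hxy, if_pos rfl, if_neg hxy, if_neg hxy] at h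
  have e1 := (hc0.norm_schur_error_le hH hz hl hn h14 hx hx).trans hε
  have e2 := (hc0.norm_schur_error_le hH hz hl hn h14 hx hy).trans hε
  rw [if_pos rfl] at e1
  rw [if_neg hxy] at e2
  set u := H x x - schurForm {x, y} H z x x + s
  set v := H x y - schurForm {x, y} H z x y + 0
  -- Row `x` of the `2 × 2` Schur system for `{x, y}`: both coefficients `u, v` are at most
  -- `1/1000`, while `|z + s| ≥ 1/6`, so the off-diagonal entry is in fact small.
  have h3 : (z + s) * green H z x y = u * green H z x y + v * green H z y y := by
    linear_combination -h
  have h4 : ‖z + s‖ * ‖green H z x y‖ ≤ 1 / 1000 * ‖green H z x y‖ + 1 / 1000 * 7 := by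
    rw [← norm_mul, h3]
    refine (norm_add_le _ _).trans ?_
    rw [norm_mul, norm_mul]
    gcongr
    exact hdiag y
  have h5 : 1 / 6 * ‖green H z x y‖ ≤ ‖z + s‖ * ‖green H z x y‖ := by gcongr
  linarith

end Bootstrap

/-! ### Complex perturbations of one entry and its transpose. -/

section Perturbation

variable {ι : Type*} [Fintype ι]

/-- `V` vanishes outside of the positions `(a, b)` and `(b, a)`, where it is at most `1`. -/
def PairSupported (V : Matrix ι ι ℂ) (a b : ι) : Prop :=
  ∀ i j, (‖V i j‖ ≤ 1) ∧ (¬((i = a ∧ j = b) ∨ (i = b ∧ j = a)) → V i j = 0)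

/-- The sum has at most two nonzero terms; for `a = b` the two positions coincide, so the same bound
covers diagonal entries. -/
lemma PairSupported.norm_sum_le {V : Matrix ι ι ℂ} {a b : ι} (hV : PairSupported V a b)
    {f : ι → ι → ℂ} {c : ℝ} (hab : ‖f a b‖ ≤ c) (hba : ‖f b a‖ ≤ c) :
    ‖∑ i, ∑ j, V i j * f i j‖ ≤ 2 * c := by
  classical
  have hc : 0 ≤ c := (norm_nonneg _).trans hab
  have hsub : ∑ i, ∑ j, V i j * f i j
      = ∑ p ∈ ({(a, b), (b, a)} : Finset (ι × ι)), V p.1 p.2 * f p.1 p.2 := by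
    rw [← Finset.sum_product', Finset.univ_product_univ]
    symm
    refine Finset.sum_subset (Finset.subset_univ _) fun p _ hp => ?_
    rw [(hV p.1 p.2).2, zero_mul]
    rintro (⟨h1, h2⟩ | ⟨h1, h2⟩) <;> apply hp <;> simp [← h1, ← h2]
  rw [hsub]
  calc _ ≤ ∑ p ∈ ({(a, b), (b, a)} : Finset (ι × ι)), c := by
        refine norm_sum_le_of_le _ fun p hp => ?_
        rw [norm_mul]
        have h1 : ‖f p.1 p.2‖ ≤ c := by
          rcases Finset.mem_insert.mp hp with rfl | hp
          · exact hab
          · rw [Finset.mem_singleton.mp hp]; exact hba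
        exact (mul_le_mul (hV _ _).1 h1 (norm_nonneg _) zero_le_one).trans_eq (one_mul _)
    _ ≤ 2 * c := by
        rw [Finset.sum_const, nsmul_eq_mul]
        gcongr
        exact_mod_cast Finset.card_le_two

lemma mul_mul_apply_eq_sum (A V B : Matrix ι ι ℂ) (x y : ι) :
    (A * V * B) x y = ∑ i, ∑ j, V i j * (A x i * B j y) := by
  simp_rw [Matrix.mul_apply, Finset.sum_mul]
  rw [Finset.sum_comm]
  exact Finset.sum_congr rfl fun i _ => Finset.sum_congr rfl fun j _ => by ring

variable [DecidableEq ι]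

/-- The resolvent entries with both indices among `a`, `b` are at most `c`. -/
def BlockBounded (H : Matrix ι ι ℂ) (z : ℂ) (a b : ι) (c : ℝ) : Prop :=
  ‖green H z a a‖ ≤ c ∧ ‖green H z a b‖ ≤ c ∧ ‖green H z b a‖ ≤ c ∧ ‖green H z b b‖ ≤ c

lemma green_add_smul_sub {H V : Matrix ι ι ℂ} {z τ : ℂ}
    (h : (H - z • (1 : Matrix ι ι ℂ)).det ≠ 0)
    (h' : (H + τ • V - z • (1 : Matrix ι ι ℂ)).det ≠ 0) :
    green (H + τ • V) z - green H z = -τ • (green H z * V * green (H + τ • V) z) := by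
  rw [← neg_sub, green_sub_green h h', sub_sub_sub_cancel_right, add_sub_cancel_left,
    Matrix.mul_smul, Matrix.smul_mul, neg_smul]

/-- Small perturbations supported on a pair of positions preserve invertibility. -/
lemma det_add_smul_ne_zero {H V : Matrix ι ι ℂ} {z τ : ℂ} {a b : ι} {c : ℝ}
    (h : (H - z • (1 : Matrix ι ι ℂ)).det ≠ 0) (hV : PairSupported V a b)
    (hc : BlockBounded H z a b c) (hτ : 4 * c * ‖τ‖ ≤ 1) :
    (H + τ • V - z • (1 : Matrix ι ι ℂ)).det ≠ 0 := by
  intro h0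
  obtain ⟨v, hv, hv0⟩ := Matrix.exists_mulVec_eq_zero_iff.mpr h0
  obtain ⟨h1, h2, h3, h4⟩ := hc
  have hc0 : 0 ≤ c := (norm_nonneg _).trans h1
  have e1 : v = -τ • (green H z).mulVec (V.mulVec v) := by
    have : (H - z • (1 : Matrix ι ι ℂ)).mulVec v = -τ • V.mulVec v := by
      rw [add_sub_right_comm, Matrix.add_mulVec, Matrix.smul_mulVec] at hv0
      rw [eq_neg_of_add_eq_zero_left hv0, neg_smul]
    have h5 := congrArg (green H z).mulVec this
    rwa [Matrix.mulVec_mulVec, green_mul_sub h, Matrix.one_mulVec, Matrix.mulVec_smul] at h5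
  have e2 : ∀ x, v x = -τ * ∑ i, ∑ j, V i j * (green H z x i * v j) := by
    intro x
    conv_lhs => rw [e1]
    simp only [Pi.smul_apply, smul_eq_mul, Matrix.mulVec, dotProduct, Finset.mul_sum]
    exact Finset.sum_congr rfl fun i _ => Finset.sum_congr rfl fun j _ => by ring
  -- A kernel vector satisfies `v = -τ G V v`, and `V v` sees only `v a` and `v b`. Their maximum is
  -- at most half of itself, hence zero, and then all of `v` vanishes.
  set M := max ‖v a‖ ‖v b‖ with hM
  have hM0 : 0 ≤ M := (norm_nonneg _).trans (le_max_left _ _)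
  have hx : ∀ x, ‖green H z x a‖ ≤ c → ‖green H z x b‖ ≤ c → ‖v x‖ ≤ M / 2 := by
    intro x hxa hxb
    rw [e2 x, norm_mul, norm_neg]
    calc ‖τ‖ * _ ≤ ‖τ‖ * (2 * (c * M)) := by
          gcongr
          refine hV.norm_sum_le ?_ ?_ <;> rw [norm_mul]
          · gcongr; exact le_max_right _ _
          · gcongr; exact le_max_left _ _
      _ = (4 * c * ‖τ‖) * (M / 2) := by ring
      _ ≤ 1 * (M / 2) := by gcongr
      _ = _ := one_mul _
  have hM1 : M ≤ M / 2 := max_le (hx a h1 h2) (hx b h3 h4)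
  have hM2 : M = 0 := by linarith
  have hva : v a = 0 := norm_le_zero_iff.mp (hM2 ▸ le_max_left _ _)
  have hvb : v b = 0 := norm_le_zero_iff.mp (hM2 ▸ le_max_right _ _)
  apply hv
  ext x
  rw [e2 x, Pi.zero_apply, neg_mul, neg_eq_zero]
  have := hV.norm_sum_le (f := fun i j => green H z x i * v j) (c := 0) (by simp [hvb])
    (by simp [hva])
  rw [mul_zero] at this
  rw [norm_le_zero_iff.mp this, mul_zero]

/-- In `U = G - τ G V U` the entries of `U` on the right have row index `a` or `b`, so each column
closes on itself: the larger entry `M` obeys `M ≤ c + M / 2`. -/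
lemma BlockBounded.add_smul {H V : Matrix ι ι ℂ} {z τ : ℂ} {a b : ι} {c : ℝ}
    (h : (H - z • (1 : Matrix ι ι ℂ)).det ≠ 0) (hV : PairSupported V a b)
    (hc : BlockBounded H z a b c) (hτ : 4 * c * ‖τ‖ ≤ 1) :
    BlockBounded (H + τ • V) z a b (2 * c) := by
  have h' := det_add_smul_ne_zero h hV hc hτ
  obtain ⟨h1, h2, h3, h4⟩ := hc
  have hc0 : 0 ≤ c := (norm_nonneg _).trans h1
  set U := green (H + τ • V) z with hU
  have e : ∀ x y, U x y = green H z x y - τ * ∑ i, ∑ j, V i j * (green H z x i * U j y) := by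
    intro x y
    have := congrFun (congrFun (green_add_smul_sub h h') x) y
    rw [Matrix.sub_apply, Matrix.smul_apply, mul_mul_apply_eq_sum, smul_eq_mul] at this
    linear_combination this
  have key : ∀ y, ‖green H z a y‖ ≤ c → ‖green H z b y‖ ≤ c →
      ‖U a y‖ ≤ 2 * c ∧ ‖U b y‖ ≤ 2 * c := by
    intro y hay hby
    set M := max ‖U a y‖ ‖U b y‖ with hM
    have hM0 : 0 ≤ M := (norm_nonneg _).trans (le_max_left _ _)
    have hx : ∀ x, ‖green H z x a‖ ≤ c → ‖green H z x b‖ ≤ c → ‖green H z x y‖ ≤ c →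
        ‖U x y‖ ≤ c + M / 2 := by
      intro x hxa hxb hxy
      rw [e x y]
      refine (norm_sub_le _ _).trans (add_le_add hxy ?_)
      rw [norm_mul]
      calc ‖τ‖ * _ ≤ ‖τ‖ * (2 * (c * M)) := by
            gcongr
            refine hV.norm_sum_le ?_ ?_ <;> rw [norm_mul]
            · gcongr; exact le_max_right _ _
            · gcongr; exact le_max_left _ _
        _ = (4 * c * ‖τ‖) * (M / 2) := by ring
        _ ≤ 1 * (M / 2) := by gcongr
        _ = _ := one_mul _
    have hM1 : M ≤ c + M / 2 := max_le (hx a h1 h2 hay) (hx b h3 h4 hby)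
    have hM2 : M ≤ 2 * c := by linarith
    exact ⟨(le_max_left _ _).trans hM2, (le_max_right _ _).trans hM2⟩
  exact ⟨(key a h1 h3).1, (key b h2 h4).1, (key a h1 h3).2, (key b h2 h4).2⟩

/-- A small perturbation supported on a pair of positions changes the trace of the resolvent by
`O(1 / η)`. -/
lemma norm_trace_green_add_smul_sub_le {H V : Matrix ι ι ℂ} (hH : H.IsHermitian) {z τ : ℂ}
    (hz : 0 < z.im) {a b : ι} {c : ℝ} (hV : PairSupported V a b)
    (hc : BlockBounded H z a b c) (hτ : 4 * c * ‖τ‖ ≤ 1) :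
    ‖(green (H + τ • V) z).trace - (green H z).trace‖ ≤ 1 / z.im := by
  have h := det_sub_smul_ne_zero hH hz.ne'
  have h' := det_add_smul_ne_zero h hV hc hτ
  have hb := hc.add_smul h hV hτ
  obtain ⟨u1, u2, u3, u4⟩ := hb
  obtain ⟨h1, h2, h3, h4⟩ := hc
  have hc0 : 0 ≤ c := (norm_nonneg _).trans h1
  set G := green H z with hG
  set U := green (H + τ • V) z with hU
  have e := green_add_smul_sub h h'
  rw [← hG, ← hU] at e
  have hsq : ∀ x y, ‖G x x‖ ≤ c → ‖G y y‖ ≤ c → ‖(G * G) x y‖ ≤ c / z.im := by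
    intro x y hx hy
    refine (sq_le_sq₀ (norm_nonneg _) (by positivity)).mp
      ((norm_sum_green_mul_green_le hH hH hz hz x y).trans ?_)
    have i1 := im_green_nonneg hH hz x
    have i2 := im_green_nonneg hH hz y
    rw [← hG] at i1 i2 ⊢
    rw [sq]
    have i3 := (le_abs_self _).trans ((Complex.abs_im_le_norm (G x x)).trans hx)
    have i4 := (le_abs_self _).trans ((Complex.abs_im_le_norm (G y y)).trans hy)
    gcongr
  have hUG : ∀ x y, ‖U x a‖ ≤ 2 * c → ‖U x b‖ ≤ 2 * c → ‖G x x‖ ≤ c → ‖G y y‖ ≤ c →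
      ‖(U * G) x y‖ ≤ 2 * (c / z.im) := by
    intro x y hxa hxb hx hy
    have e' : green H z - green (H + τ • V) z
        = green (H + τ • V) z * (τ • V) * green H z := by
      rw [← neg_sub, green_sub_green h' h, sub_sub_sub_cancel_right, ← sub_sub, sub_self, zero_sub,
        Matrix.mul_neg, Matrix.neg_mul, neg_neg]
    -- For complex `τ` the perturbed matrix is not Hermitian and Ward is not available for `U`;
    -- expanding `U` once more leaves only `G²`, to which it does apply.
    have e2 : U * G = G * G - τ • (U * V * (G * G)) := by
      rw [← hG, ← hU] at e'
      have : U = G - U * (τ • V) * G := by rw [← e', sub_sub_cancel]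
      conv_lhs => rw [this]
      rw [sub_mul, Matrix.mul_smul, Matrix.smul_mul, Matrix.smul_mul, mul_assoc (U * V)]
    rw [e2, Matrix.sub_apply, Matrix.smul_apply, mul_mul_apply_eq_sum, smul_eq_mul]
    have : ‖τ * ∑ i, ∑ j, V i j * (U x i * (G * G) j y)‖ ≤ c / z.im := by
      rw [norm_mul]
      calc ‖τ‖ * _ ≤ ‖τ‖ * (2 * ((2 * c) * (c / z.im))) := by
            gcongr
            refine hV.norm_sum_le ?_ ?_ <;> rw [norm_mul]
            · gcongr; exact hsq b y h4 hy
            · gcongr; exact hsq a y h1 hy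
        _ = (4 * c * ‖τ‖) * (c / z.im) := by ring
        _ ≤ 1 * (c / z.im) := by gcongr
        _ = _ := one_mul _
    calc _ ≤ c / z.im + c / z.im := (norm_sub_le _ _).trans (add_le_add (hsq x y hx hy) this)
      _ = _ := by ring
  have htr : U.trace - G.trace = -τ * ∑ i, ∑ j, V i j * (U * G) j i := by
    rw [← Matrix.trace_sub, e, Matrix.trace_smul, Matrix.trace_mul_comm, ← mul_assoc,
      Matrix.trace_mul_comm, smul_eq_mul, Matrix.trace]
    congr 1
  rw [htr, norm_mul, norm_neg]
  calc ‖τ‖ * _ ≤ ‖τ‖ * (2 * (2 * (c / z.im))) := by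
        gcongr
        exact hV.norm_sum_le (hUG b a u3 u4 h4 h1) (hUG a b u1 u2 h1 h4)
    _ = (4 * c * ‖τ‖) * (1 / z.im) := by ring
    _ ≤ 1 * (1 / z.im) := by gcongr
    _ = _ := one_mul _

/-- The trace of the resolvent is a holomorphic function of the perturbation parameter. -/
lemma differentiableAt_trace_green_add_smul {H V : Matrix ι ι ℂ} {z τ : ℂ}
    (h : (H + τ • V - z • (1 : Matrix ι ι ℂ)).det ≠ 0) :
    DifferentiableAt ℂ (fun τ : ℂ => (green (H + τ • V) z).trace) τ := by
  have hent : ∀ i j, Differentiable ℂ fun τ : ℂ => (H + τ • V - z • (1 : Matrix ι ι ℂ)) i j := by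
    intro i j
    simp only [Matrix.sub_apply, Matrix.add_apply, Matrix.smul_apply, smul_eq_mul]
    fun_prop
  have hdet : Differentiable ℂ fun τ : ℂ => (H + τ • V - z • (1 : Matrix ι ι ℂ)).det := by
    simp only [Matrix.det_apply]
    exact Differentiable.fun_sum fun σ _ => Differentiable.const_smul
      (Differentiable.fun_finsetProd fun j _ => hent _ _) _
  have hadj : ∀ i, Differentiable ℂ fun τ : ℂ =>
      (H + τ • V - z • (1 : Matrix ι ι ℂ)).adjugate i i := by
    intro i
    simp only [Matrix.adjugate_apply, Matrix.det_apply]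
    refine Differentiable.fun_sum fun σ _ => Differentiable.const_smul ?_ _
    refine Differentiable.fun_finsetProd fun j _ => ?_
    by_cases hj : σ j = i
    · simp only [hj, Matrix.updateRow_self]
      exact differentiable_const _
    · simp only [Matrix.updateRow_ne hj]
      exact hent _ _
  simp only [green, Matrix.inv_def, Ring.inverse_eq_inv', Matrix.trace_smul, smul_eq_mul]
  refine (hdet.differentiableAt.inv h).mul ?_
  simp only [Matrix.trace, Matrix.diag_apply]
  exact DifferentiableAt.fun_sum fun i _ => (hadj i).differentiableAt

end Perturbation

/-! ### Taylor expansion of high powers of the modulus. -/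

section Taylor

/-- Taylor expansion of a bounded holomorphic function, with Cauchy's bounds on the coefficients
and on the remainder. -/
lemma exists_taylor_coeff {F : ℂ → ℂ} {R r A : ℝ} (hr : 0 < r) (hrR : r < R)
    (hF : DifferentiableOn ℂ F (Metric.ball 0 R)) (hA : ∀ τ, ‖τ‖ < R → ‖F τ‖ ≤ A) (m : ℕ) :
    ∃ c : ℕ → ℂ, (∀ j, ‖c j‖ ≤ A / r ^ j) ∧ ∀ τ : ℂ, ‖τ‖ ≤ r / 2 →
      ‖F τ - ∑ j ∈ Finset.range (m + 1), c j * τ ^ j‖ ≤ 2 * A * (‖τ‖ / r) ^ (m + 1) := by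
  have hc : ∀ j, ‖((j.factorial : ℂ)⁻¹ * iteratedDeriv j F 0)‖ ≤ A / r ^ j := by
    intro j
    have hsub : Metric.closedBall (0 : ℂ) r ⊆ Metric.ball 0 R := Metric.closedBall_subset_ball hrR
    have h1 := Complex.norm_iteratedDeriv_le_of_forall_mem_sphere_norm_le (c := 0) (F := ℂ) (f := F) (R := r)
      (C := A) j hr (DifferentiableOn.diffContOnCl (by
        rw [closure_ball _ hr.ne']
        exact hF.mono hsub)) (fun τ hτ => hA τ (by
          rw [mem_sphere_zero_iff_norm] at hτ; linarith))
    rw [norm_mul, norm_inv, Complex.norm_natCast, inv_mul_le_iff₀ (by positivity)]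
    exact h1.trans_eq (by ring)
  refine ⟨fun j => (j.factorial : ℂ)⁻¹ * iteratedDeriv j F 0, hc, fun τ hτ => ?_⟩
  have hsum := Complex.hasSum_taylorSeries_on_ball (c := 0) (r := R) (f := F) hF
    (z := τ) (by rw [mem_ball_zero_iff]; linarith)
  simp only [sub_zero, smul_eq_mul] at hsum
  have hx0 : 0 ≤ ‖τ‖ / r := by positivity
  have hx1 : ‖τ‖ / r ≤ 1 / 2 := by rw [div_le_iff₀ hr]; linarith
  have hterm : ∀ j, ‖(j.factorial : ℂ)⁻¹ * (τ ^ j * iteratedDeriv j F 0)‖ ≤ A * (‖τ‖ / r) ^ j := by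
    intro j
    calc _ = ‖(j.factorial : ℂ)⁻¹ * iteratedDeriv j F 0‖ * ‖τ‖ ^ j := by
          rw [norm_mul, norm_mul, norm_mul, norm_pow]; ring
      _ ≤ A / r ^ j * ‖τ‖ ^ j := by gcongr; exact hc j
      _ = _ := by rw [div_pow]; ring
  have htail := (hasSum_nat_add_iff' (m + 1)).mpr hsum
  have hA0 : 0 ≤ A := (norm_nonneg _).trans (hA 0 (by simpa using hr.trans hrR))
  have hgeo : HasSum (fun j => A * (‖τ‖ / r) ^ (j + (m + 1)))
      (A * (‖τ‖ / r) ^ (m + 1) * (1 - ‖τ‖ / r)⁻¹) := by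
    have := (hasSum_geometric_of_lt_one hx0 (by linarith)).mul_left (A * (‖τ‖ / r) ^ (m + 1))
    have e : (fun j => A * (‖τ‖ / r) ^ (j + (m + 1)))
        = fun j => A * (‖τ‖ / r) ^ (m + 1) * (‖τ‖ / r) ^ j := by
      funext j; ring
    rw [e]
    exact this
  have hle := htail.norm_le_of_bounded hgeo fun j => hterm _
  have heq : ∑ j ∈ Finset.range (m + 1), (j.factorial : ℂ)⁻¹ * (τ ^ j * iteratedDeriv j F 0)
      = ∑ j ∈ Finset.range (m + 1), (j.factorial : ℂ)⁻¹ * iteratedDeriv j F 0 * τ ^ j :=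
    Finset.sum_congr rfl fun j _ => by ring
  rw [heq] at hle
  refine hle.trans ?_
  have : (1 - ‖τ‖ / r)⁻¹ ≤ 2 := by
    rw [inv_le_comm₀ (by linarith) (by norm_num)]
    linarith
  calc _ ≤ A * (‖τ‖ / r) ^ (m + 1) * 2 := by gcongr
    _ = _ := by ring

/-- `(1 + 1/x) ^ k ≤ e` as soon as `x ≥ k`. This is why `|φ(0)|` is always replaced by its maximum
with `k`: a variation of `φ` by `1` then costs a constant, uniformly in `k`. -/
lemma add_one_pow_le {x : ℝ} {k : ℕ} (hk : 1 ≤ k) (hx : (k : ℝ) ≤ x) :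
    (x + 1) ^ k ≤ Real.exp 1 * x ^ k := by
  have hk0 : (0 : ℝ) < k := by exact_mod_cast hk
  have hx0 : 0 < x := hk0.trans_le hx
  calc (x + 1) ^ k = (1 + 1 / x) ^ k * x ^ k := by
        rw [← mul_pow]; congr 1; field_simp
    _ ≤ (Real.exp (1 / x)) ^ k * x ^ k := by
        gcongr
        rw [add_comm]
        exact Real.add_one_le_exp _
    _ = Real.exp (k * (1 / x)) * x ^ k := by rw [← Real.exp_nat_mul]
    _ ≤ Real.exp 1 * x ^ k := by
        gcongr
        rw [mul_one_div, div_le_one hx0]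
        exact hx

/-- A power of the modulus of a holomorphic function varying by at most `1` is, on the real line,
well approximated by polynomials. -/
lemma exists_taylor_coeff_norm_pow {φ : ℂ → ℂ} {R r : ℝ} (hr : 0 < r) (hrR : r < R)
    (hφ : DifferentiableOn ℂ φ (Metric.ball 0 R)) (h1 : ∀ τ, ‖τ‖ < R → ‖φ τ - φ 0‖ ≤ 1)
    {k : ℕ} (hk : 1 ≤ k) (hk2 : Even k) (m : ℕ) :
    ∃ c : ℕ → ℝ, (∀ j, |c j| ≤ Real.exp 1 * max ‖φ 0‖ k ^ k / r ^ j) ∧ ∀ t : ℝ, |t| ≤ r / 2 →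
      |‖φ t‖ ^ k - ∑ j ∈ Finset.range (m + 1), c j * t ^ j|
        ≤ 2 * (Real.exp 1 * max ‖φ 0‖ k ^ k) * (|t| / r) ^ (m + 1) := by
  obtain ⟨κ, rfl⟩ := hk2
  -- The double conjugation makes the second factor holomorphic, and on the real axis the product is
  -- `|φ| ^ (2 κ)`.
  set F : ℂ → ℂ := fun τ => φ τ ^ κ * (starRingEnd ℂ (φ (starRingEnd ℂ τ))) ^ κ with hFdef
  have hφat : ∀ τ, ‖τ‖ < R → DifferentiableAt ℂ φ τ := fun τ hτ =>
    (hφ τ (by simpa using hτ)).differentiableAt (Metric.isOpen_ball.mem_nhds (by simpa using hτ))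
  have hF : DifferentiableOn ℂ F (Metric.ball 0 R) := by
    intro τ hτ
    rw [mem_ball_zero_iff] at hτ
    refine DifferentiableAt.differentiableWithinAt ?_
    refine ((hφat τ hτ).pow κ).mul (DifferentiableAt.pow ?_ κ)
    have h2 := (hφat (starRingEnd ℂ τ) (by simpa using hτ)).conj_conj
    rw [Complex.conj_conj] at h2
    exact h2
  have hP : ∀ τ, ‖τ‖ < R → ‖φ τ‖ ≤ max ‖φ 0‖ (κ + κ : ℕ) + 1 := by
    intro τ hτ
    have h2 : ‖φ τ‖ ≤ ‖φ 0‖ + ‖φ τ - φ 0‖ := by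
      simpa using norm_add_le (φ 0) (φ τ - φ 0)
    have := h1 τ hτ
    have := le_max_left ‖φ 0‖ ((κ + κ : ℕ) : ℝ)
    linarith
  have hA : ∀ τ, ‖τ‖ < R → ‖F τ‖ ≤ Real.exp 1 * max ‖φ 0‖ (κ + κ : ℕ) ^ (κ + κ) := by
    intro τ hτ
    refine le_trans ?_ (add_one_pow_le hk (le_max_right _ _))
    rw [hFdef]
    simp only [norm_mul, norm_pow, RCLike.norm_conj]
    rw [pow_add]
    have h2 := hP (starRingEnd ℂ τ) (by simpa using hτ)
    have h3 := hP τ hτ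
    gcongr
  obtain ⟨c, hc, hc'⟩ := exists_taylor_coeff hr hrR hF hA m
  refine ⟨fun j => (c j).re, fun j => (Complex.abs_re_le_norm _).trans (hc j), fun t ht => ?_⟩
  have h2 := hc' t (by simpa using ht)
  have h3 : F t = ((‖φ t‖ ^ (κ + κ) : ℝ) : ℂ) := by
    simp only [hFdef, Complex.conj_ofReal]
    rw [← mul_pow, Complex.mul_conj']
    push_cast
    ring
  have h4 : (F t - ∑ j ∈ Finset.range (m + 1), c j * (t : ℂ) ^ j).re
      = ‖φ t‖ ^ (κ + κ) - ∑ j ∈ Finset.range (m + 1), (c j).re * t ^ j := by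
    rw [h3, Complex.sub_re, Complex.ofReal_re, Complex.re_sum]
    congr 1
    refine Finset.sum_congr rfl fun j _ => ?_
    rw [← Complex.ofReal_pow, Complex.re_mul_ofReal]
  rw [← h4]
  refine (Complex.abs_re_le_norm _).trans (h2.trans_eq ?_)
  simp

end Taylor

/-! ### Exchange of the law of one real variable. -/

section Swap

/-- Two laws with matching moments to order `m` integrate a function with good polynomial
approximations almost equally. -/
lemma abs_integral_sub_le_of_moments {ν ν' : Measure ℝ} [IsProbabilityMeasure ν]
    [IsProbabilityMeasure ν'] {m : ℕ} (hint : Integrable (fun t : ℝ => |t| ^ (m + 1)) ν)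
    (hint' : Integrable (fun t : ℝ => |t| ^ (m + 1)) ν')
    (hmom : ∀ j ≤ m, ∫ t, t ^ j ∂ν = ∫ t, t ^ j ∂ν') {Λ δ T : ℝ}
    (hΛ : ∫ t, |t| ^ (m + 1) ∂ν ≤ Λ) (hΛ' : ∫ t, |t| ^ (m + 1) ∂ν' ≤ Λ)
    (hδ : ν.real {t | T < |t|} ≤ δ) (hδ' : ν'.real {t | T < |t|} ≤ δ)
    {g : ℝ → ℝ} (hg : Measurable g) {F D : ℝ} (hF : 0 ≤ F) (hD : 0 ≤ D) (hgF : ∀ t, |g t| ≤ F)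
    (c : ℕ → ℝ) (hc : ∀ t, |g t - ∑ j ∈ Finset.range (m + 1), c j * t ^ j|
      ≤ {t : ℝ | T < |t|}.indicator (fun _ => F) t + D * |t| ^ (m + 1)) :
    |∫ t, g t ∂ν - ∫ t, g t ∂ν'| ≤ 2 * (F * δ + D * Λ) := by
  have hset : MeasurableSet {t : ℝ | T < |t|} := measurableSet_lt measurable_const measurable_norm
  have key : ∀ (ρ : Measure ℝ) [IsProbabilityMeasure ρ],
      Integrable (fun t : ℝ => |t| ^ (m + 1)) ρ → ∫ t, |t| ^ (m + 1) ∂ρ ≤ Λ →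
      ρ.real {t | T < |t|} ≤ δ →
      |∫ t, g t ∂ρ - ∑ j ∈ Finset.range (m + 1), c j * ∫ t, t ^ j ∂ρ| ≤ F * δ + D * Λ := by
    intro ρ _ h1 h2 h3
    have hpow : ∀ j ∈ Finset.range (m + 1), Integrable (fun t : ℝ => c j * t ^ j) ρ := by
      intro j hj
      refine Integrable.const_mul ?_ _
      refine Integrable.mono' (h1.add (integrable_const 1)) (by fun_prop) (.of_forall fun t => ?_)
      simp only [norm_pow, Real.norm_eq_abs, Pi.add_apply]
      rcases le_total |t| 1 with h | h
      · have := pow_le_one₀ (n := j) (abs_nonneg t) h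
        have : 0 ≤ |t| ^ (m + 1) := by positivity
        linarith
      · have := pow_le_pow_right₀ h (Finset.mem_range.mp hj).le
        linarith
    have hgi : Integrable g ρ :=
      Integrable.of_bound hg.aestronglyMeasurable F (.of_forall fun t => hgF t)
    have hind : Integrable ({t : ℝ | T < |t|}.indicator (fun _ => F)) ρ :=
      (integrable_const F).indicator hset
    have e : ∫ t, g t ∂ρ - ∑ j ∈ Finset.range (m + 1), c j * ∫ t, t ^ j ∂ρ
        = ∫ t, (g t - ∑ j ∈ Finset.range (m + 1), c j * t ^ j) ∂ρ := by
      rw [integral_sub hgi (integrable_finsetSum _ hpow), integral_finsetSum _ hpow]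
      simp_rw [integral_const_mul]
    rw [e]
    refine (norm_integral_le_of_norm_le (hind.add (h1.const_mul D))
      (.of_forall fun t => by rw [Real.norm_eq_abs]; exact hc t)).trans ?_
    simp only [Pi.add_apply]
    rw [integral_add hind (h1.const_mul D), integral_const_mul, integral_indicator_const _ hset,
      smul_eq_mul, mul_comm (ρ.real _)]
    gcongr
  have k1 := key ν hint hΛ hδ
  have k2 := key ν' hint' hΛ' hδ'
  have e : ∑ j ∈ Finset.range (m + 1), c j * ∫ t, t ^ j ∂ν
      = ∑ j ∈ Finset.range (m + 1), c j * ∫ t, t ^ j ∂ν' :=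
    Finset.sum_congr rfl fun j hj => by rw [hmom j (by simpa [Nat.lt_succ_iff] using hj)]
  rw [e] at k1
  rw [abs_le] at *
  constructor <;> linarith [k1.1, k1.2, k2.1, k2.2]

variable {n : ℕ}

/-- Deterministic bound (`n` from the trace, `2 n` from the shift) that pays for every exceptional
event. -/
lemma norm_im_mul_trace_green_sub_le {H : Matrix (Fin n) (Fin n) ℂ} (hH : H.IsHermitian) {z : ℂ}
    (hz : 0 < z.im) {w : ℂ} (hw : ‖w‖ ≤ 2 * n) :
    ‖(z.im : ℂ) * (green H z).trace - w‖ ≤ 3 * n := by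
  have h1 := norm_trace_green_le (norm_green_diag_le hH hz)
  have h2 : ‖(z.im : ℂ) * (green H z).trace‖ ≤ n := by
    rw [norm_mul, Complex.norm_real, Real.norm_eq_abs, abs_of_pos hz]
    calc z.im * _ ≤ z.im * (n * (1 / z.im)) := by gcongr
      _ = n := by field_simp
  linarith [norm_sub_le ((z.im : ℂ) * (green H z).trace) w]

lemma isHermitian_add_smul {H V : Matrix (Fin n) (Fin n) ℂ} (hH : H.IsHermitian)
    (hV : V.IsHermitian) (t : ℝ) : (H + (t : ℂ) • V).IsHermitian := by
  refine hH.add ?_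
  rw [Matrix.IsHermitian, Matrix.conjTranspose_smul, hV.eq]
  simp

lemma continuous_trace_green_add_smul {H V : Matrix (Fin n) (Fin n) ℂ} (hH : H.IsHermitian)
    (hV : V.IsHermitian) {z : ℂ} (hz : 0 < z.im) :
    Continuous fun t : ℝ => (green (H + (t : ℂ) • V) z).trace := by
  rw [continuous_iff_continuousAt]
  intro t
  have h := differentiableAt_trace_green_add_smul
    (det_sub_smul_ne_zero (isHermitian_add_smul hH hV t) hz.ne')
  exact ContinuousAt.comp (f := fun t : ℝ => (t : ℂ))
    (g := fun τ : ℂ => (green (H + τ • V) z).trace) h.continuousAt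
    Complex.continuous_ofReal.continuousAt

/-- The factor of the error terms in the exchange of one entry. -/
noncomputable def swapConst (m : ℕ) (Λ : ℝ) : ℝ :=
  2 * Real.exp 1 * ((m + 2) * Real.exp 1 * 224 ^ (m + 1)) * Λ + 2 +
    2 * ((m + 2) * Real.exp 1 * 224 ^ (m + 1)) * Λ

/-- Exchanging the law of one real parameter of a matrix with bounded resolvent entries at its
position for a law with matching moments. -/
lemma integral_norm_pow_swap_le (hn : 1 ≤ n) {H V : Matrix (Fin n) (Fin n) ℂ}
    (hH : H.IsHermitian) (hV : V.IsHermitian) {z : ℂ} (hz : 0 < z.im) {a b : Fin n}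
    (hVab : PairSupported V a b) (hb : BlockBounded H z a b 14) {w : ℂ} (hw : ‖w‖ ≤ 2 * n)
    {k : ℕ} (hk : 1 ≤ k) (hk2 : Even k) {m : ℕ} {ν ν' : Measure ℝ} [IsProbabilityMeasure ν]
    [IsProbabilityMeasure ν'] (hint : Integrable (fun t : ℝ => |t| ^ (m + 1)) ν)
    (hint' : Integrable (fun t : ℝ => |t| ^ (m + 1)) ν')
    (hmom : ∀ j ≤ m, ∫ t, t ^ j ∂ν = ∫ t, t ^ j ∂ν') {Λ δ : ℝ}
    (hΛ : ∫ t, |t| ^ (m + 1) ∂ν ≤ Λ) (hΛ' : ∫ t, |t| ^ (m + 1) ∂ν' ≤ Λ)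
    (hδ : ν.real {t | √n / 224 < |t|} ≤ δ) (hδ' : ν'.real {t | √n / 224 < |t|} ≤ δ) :
    ∫ t : ℝ, ‖(z.im : ℂ) * (green (H + ((t / √n : ℝ) : ℂ) • V) z).trace - w‖ ^ k ∂ν ≤
      (1 + swapConst m Λ * (n : ℝ) ^ (-((m : ℝ) + 1) / 2)) *
        ∫ t : ℝ, ‖(z.im : ℂ) * (green (H + ((t / √n : ℝ) : ℂ) • V) z).trace - w‖ ^ k ∂ν'
        + swapConst m Λ * (k : ℝ) ^ k + swapConst m Λ * (3 * n : ℝ) ^ k * δ := by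
  have hn0 : (0 : ℝ) < n := by exact_mod_cast hn
  have hn1 : (1 : ℝ) ≤ n := by exact_mod_cast hn
  have hs0 : 0 < √(n : ℝ) := Real.sqrt_pos.mpr hn0
  have hk0 : (0 : ℝ) < k := by exact_mod_cast hk
  set φ : ℂ → ℂ := fun τ => (z.im : ℂ) * (green (H + τ • V) z).trace - w with hφ
  have hφ1 : ∀ τ, ‖τ‖ < 1 / 56 → ‖φ τ - φ 0‖ ≤ 1 := by
    intro τ hτ
    have := norm_trace_green_add_smul_sub_le hH hz hVab hb (τ := τ) (by linarith)
    simp only [hφ, zero_smul, add_zero, sub_sub_sub_cancel_right]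
    rw [← mul_sub, norm_mul, Complex.norm_real, Real.norm_eq_abs, abs_of_pos hz]
    calc z.im * _ ≤ z.im * (1 / z.im) := by gcongr
      _ = 1 := by field_simp
  have hφd : DifferentiableOn ℂ φ (Metric.ball 0 (1 / 56)) := by
    intro τ hτ
    rw [mem_ball_zero_iff] at hτ
    have h := det_add_smul_ne_zero (det_sub_smul_ne_zero hH hz.ne') hVab hb (τ := τ) (by linarith)
    exact (((differentiableAt_trace_green_add_smul h).const_mul _).sub_const _).differentiableWithinAt
  set P : ℝ := max ‖φ 0‖ k with hP
  have hP0 : 0 < P := hk0.trans_le (le_max_right _ _)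
  -- With block bound `14` the perturbation lemmas need `4 * 14 * |τ| ≤ 1`, i.e. radius `1/56`;
  -- Cauchy's estimates use half of it, and the remainder bound half again. This is the origin of
  -- the threshold `√n / 224`.
  obtain ⟨c, hc, hc'⟩ := exists_taylor_coeff_norm_pow (r := 1 / 112) (by norm_num) (by norm_num)
    hφd hφ1 hk hk2 m
  set A : ℝ := Real.exp 1 * P ^ k with hA
  have hA0 : 0 ≤ A := by positivity
  set g : ℝ → ℝ := fun t => ‖φ ((t / √n : ℝ) : ℂ)‖ ^ k with hg
  have hherm : ∀ t : ℝ, (H + (t : ℂ) • V).IsHermitian := isHermitian_add_smul hH hV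
  have hφF : ∀ t : ℝ, ‖φ t‖ ≤ 3 * n := fun t => norm_im_mul_trace_green_sub_le (hherm t) hz hw
  have hg0 : ∀ t, 0 ≤ g t := fun t => by positivity
  have hgF : ∀ t, |g t| ≤ (3 * n : ℝ) ^ k := fun t => by
    rw [abs_of_nonneg (hg0 t)]
    exact pow_le_pow_left₀ (norm_nonneg _) (hφF _) k
  have hgc : Continuous g := by
    have := continuous_trace_green_add_smul hH hV hz
    exact (((continuous_const.mul (this.comp (continuous_id.div_const _))).sub
      continuous_const).norm).pow k
  set C₃ : ℝ := (m + 2) * Real.exp 1 * 224 ^ (m + 1) with hC₃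
  have hC₃0 : 0 ≤ C₃ := by positivity
  set s : ℝ := √n ^ (m + 1) with hs
  have hs1 : 0 < s := by positivity
  have hsinv : (n : ℝ) ^ (-((m : ℝ) + 1) / 2) = 1 / s := by
    rw [hs, neg_div, Real.rpow_neg hn0.le, one_div, Real.sqrt_eq_rpow, ← Real.rpow_natCast,
      ← Real.rpow_mul hn0.le]
    congr 2
    push_cast; ring
  have happrox : ∀ t, |g t - ∑ j ∈ Finset.range (m + 1), (c j / √n ^ j) * t ^ j|
      ≤ {t : ℝ | √n / 224 < |t|}.indicator (fun _ => (3 * n : ℝ) ^ k) t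
        + (C₃ * P ^ k / s) * |t| ^ (m + 1) := by
    intro t
    have hq : ∑ j ∈ Finset.range (m + 1), (c j / √n ^ j) * t ^ j
        = ∑ j ∈ Finset.range (m + 1), c j * (t / √n) ^ j :=
      Finset.sum_congr rfl fun j _ => by rw [div_pow]; ring
    have habs : |t / √n| = |t| / √n := by rw [abs_div, abs_of_pos hs0]
    have hD : (C₃ * P ^ k / s) * |t| ^ (m + 1) = (m + 2) * A * (224 * (|t| / √n)) ^ (m + 1) := by
      rw [hC₃, hA, hs, mul_pow, div_pow]; ring
    rw [hq, hD]
    -- Beyond the threshold `224 |t| / √n ≥ 1`, so every monomial is dominated by the one of degree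
    -- `m + 1`; the polynomial fits into the same error term and only `g` itself needs the
    -- indicator.
    by_cases ht : √n / 224 < |t|
    · rw [Set.indicator_of_mem (by exact ht)]
      have hx1 : 1 ≤ 224 * (|t| / √n) := by
        rw [mul_div_assoc', le_div_iff₀ hs0]
        linarith
      have hsum : |∑ j ∈ Finset.range (m + 1), c j * (t / √n) ^ j|
          ≤ (m + 1) * (A * (224 * (|t| / √n)) ^ (m + 1)) := by
        refine (Finset.abs_sum_le_sum_abs _ _).trans ?_
        calc _ ≤ ∑ j ∈ Finset.range (m + 1), A * (224 * (|t| / √n)) ^ (m + 1) := by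
              refine Finset.sum_le_sum fun j hj => ?_
              rw [abs_mul, abs_pow, habs]
              calc |c j| * (|t| / √n) ^ j ≤ A / (1 / 112) ^ j * (|t| / √n) ^ j := by
                    gcongr; exact hc j
                _ = A * (112 * (|t| / √n)) ^ j := by rw [div_pow, mul_pow, one_pow]; field_simp
                _ ≤ A * (224 * (|t| / √n)) ^ j := by gcongr; norm_num
                _ ≤ _ := by
                  gcongr
                  exact (Finset.mem_range.mp hj).le
          _ = _ := by simp
      have hX : 0 ≤ A * (224 * (|t| / √n)) ^ (m + 1) := by positivity
      calc _ ≤ |g t| + |∑ j ∈ Finset.range (m + 1), c j * (t / √n) ^ j| := abs_sub _ _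
        _ ≤ _ := by
          have := hgF t
          nlinarith
    · rw [Set.indicator_of_notMem (by exact ht), zero_add]
      push Not at ht
      have h1 : |t / √n| ≤ 1 / 112 / 2 := by
        rw [habs, div_le_iff₀ hs0]; linarith
      refine (hc' _ h1).trans ?_
      rw [habs, div_div_eq_mul_div, div_one, mul_comm (|t| / √n)]
      gcongr
      · linarith [Nat.cast_nonneg (α := ℝ) m]
      · norm_num
  -- The Taylor error is measured by `φ(0)`, the conclusion by an average over `ν'`. For small `t`
  -- passing from `φ(0)` to `φ(t)` costs a factor `e`; this converts the additive error into a
  -- multiplicative one.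
  have hPk : ∀ t, P ^ k ≤ Real.exp 1 * g t + Real.exp 1 * (k : ℝ) ^ k
      + {t : ℝ | √n / 224 < |t|}.indicator (fun _ => (3 * n : ℝ) ^ k) t := by
    intro t
    have he : 1 ≤ Real.exp 1 := Real.one_le_exp (by norm_num)
    have hmaxpow : ∀ x : ℝ, 0 ≤ x → max x k ^ k ≤ x ^ k + (k : ℝ) ^ k := by
      intro x hx
      rcases max_choice x k with h | h <;> rw [h]
      · exact le_add_of_nonneg_right (by positivity)
      · exact le_add_of_nonneg_left (by positivity)
    by_cases ht : √n / 224 < |t|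
    · rw [Set.indicator_of_mem (by exact ht)]
      have h1 := hmaxpow _ (norm_nonneg (φ 0))
      have h2 : ‖φ 0‖ ^ k ≤ (3 * n : ℝ) ^ k := by
        have := hφF 0
        rw [Complex.ofReal_zero] at this
        gcongr
      have h3 : (k : ℝ) ^ k ≤ Real.exp 1 * (k : ℝ) ^ k := le_mul_of_one_le_left (by positivity) he
      have h4 : 0 ≤ Real.exp 1 * g t := by positivity
      linarith
    · rw [Set.indicator_of_notMem (by exact ht), add_zero]
      push Not at ht
      have h1 : ‖((t / √n : ℝ) : ℂ)‖ < 1 / 56 := by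
        rw [Complex.norm_real, Real.norm_eq_abs, abs_div, abs_of_pos hs0, div_lt_iff₀ hs0]
        linarith
      have h2 := hφ1 _ h1
      have h3 : ‖φ 0‖ ≤ ‖φ ((t / √n : ℝ) : ℂ)‖ + 1 := by
        have := norm_sub_le (φ ((t / √n : ℝ) : ℂ)) (φ ((t / √n : ℝ) : ℂ) - φ 0)
        rw [sub_sub_cancel] at this
        linarith
      have h4 : P ≤ max ‖φ ((t / √n : ℝ) : ℂ)‖ k + 1 := by
        refine max_le (h3.trans ?_) ?_
        · gcongr; exact le_max_left _ _
        · linarith [le_max_right ‖φ ((t / √n : ℝ) : ℂ)‖ (k : ℝ)]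
      calc P ^ k ≤ (max ‖φ ((t / √n : ℝ) : ℂ)‖ k + 1) ^ k := by gcongr
        _ ≤ Real.exp 1 * max ‖φ ((t / √n : ℝ) : ℂ)‖ k ^ k :=
          add_one_pow_le hk (le_max_right _ _)
        _ ≤ Real.exp 1 * (‖φ ((t / √n : ℝ) : ℂ)‖ ^ k + (k : ℝ) ^ k) := by
          gcongr; exact hmaxpow _ (norm_nonneg _)
        _ = _ := by ring
  have hset : MeasurableSet {t : ℝ | √n / 224 < |t|} :=
    measurableSet_lt measurable_const measurable_norm
  have hgi : Integrable g ν' :=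
    Integrable.of_bound hgc.aestronglyMeasurable _ (.of_forall fun t => hgF t)
  have hPint : P ^ k ≤ Real.exp 1 * ∫ t, g t ∂ν' + Real.exp 1 * (k : ℝ) ^ k
      + (3 * n : ℝ) ^ k * δ := by
    have hind : Integrable ({t : ℝ | √n / 224 < |t|}.indicator (fun _ => (3 * n : ℝ) ^ k)) ν' :=
      (integrable_const _).indicator hset
    have h1 := integral_mono (μ := ν') (integrable_const (P ^ k))
      (((hgi.const_mul (Real.exp 1)).add (integrable_const (Real.exp 1 * (k : ℝ) ^ k))).add hind) hPk
    have h2 := integral_add ((hgi.const_mul (Real.exp 1)).add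
      (integrable_const (Real.exp 1 * (k : ℝ) ^ k))) hind
    have h3 := integral_add (hgi.const_mul (Real.exp 1))
      (integrable_const (Real.exp 1 * (k : ℝ) ^ k))
    simp only [Pi.add_apply] at h1 h2 h3
    rw [h2, h3, integral_const_mul,
      integral_indicator_const _ hset, integral_const, integral_const] at h1
    simp only [probReal_univ, smul_eq_mul, one_mul] at h1
    refine h1.trans ?_
    rw [mul_comm (ν'.real _)]
    gcongr
  have hΛ0 : 0 ≤ Λ := (integral_nonneg fun t => by positivity).trans hΛ
  have hmain := abs_integral_sub_le_of_moments hint hint' hmom hΛ hΛ' hδ hδ' hgc.measurable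
    (F := (3 * n : ℝ) ^ k) (D := C₃ * P ^ k / s) (by positivity) (by positivity) hgF _ happrox
  have hle := (abs_le.mp hmain).2
  have hI0 : 0 ≤ ∫ t, g t ∂ν' := integral_nonneg hg0
  have hδ0 : 0 ≤ δ := measureReal_nonneg.trans hδ
  change ∫ t, g t ∂ν ≤ (1 + swapConst m Λ * (n : ℝ) ^ (-((m : ℝ) + 1) / 2)) * ∫ t, g t ∂ν'
    + swapConst m Λ * (k : ℝ) ^ k + swapConst m Λ * (3 * n : ℝ) ^ k * δ
  rw [hsinv]
  set I := ∫ t, g t ∂ν'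
  set F := (3 * n : ℝ) ^ k
  have hF0 : 0 ≤ F := by positivity
  -- The gain `n ^ (-(m+1)/2)` matters only in front of `I`; next to `k ^ k` and `F * δ` it is
  -- replaced by `1`.
  have hsone : 1 / s ≤ 1 := by
    rw [div_le_one hs1, hs]
    exact one_le_pow₀ (Real.one_le_sqrt.mpr hn1)
  have hsn : 0 ≤ 1 / s := by positivity
  have hB : swapConst m Λ = 2 * Real.exp 1 * C₃ * Λ + 2 + 2 * C₃ * Λ := rfl
  have h1 : 2 * (C₃ * P ^ k / s * Λ)
      ≤ 2 * C₃ * Λ * (1 / s) * (Real.exp 1 * I + Real.exp 1 * (k : ℝ) ^ k + F * δ) := by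
    calc 2 * (C₃ * P ^ k / s * Λ) = 2 * C₃ * Λ * (1 / s) * P ^ k := by ring
      _ ≤ _ := by gcongr
  have hCL : 0 ≤ C₃ * Λ := by positivity
  have he0 := Real.exp_pos 1
  have hkk : 0 ≤ (k : ℝ) ^ k := by positivity
  have h2 : 2 * Real.exp 1 * C₃ * Λ * (1 / s) * I ≤ swapConst m Λ * (1 / s) * I := by
    rw [hB]; gcongr; linarith
  have h3 : 2 * Real.exp 1 * C₃ * Λ * (1 / s) * (k : ℝ) ^ k ≤ swapConst m Λ * (k : ℝ) ^ k := by
    rw [hB]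
    gcongr
    calc 2 * Real.exp 1 * C₃ * Λ * (1 / s) ≤ 2 * Real.exp 1 * C₃ * Λ * 1 := by gcongr
      _ ≤ _ := by linarith
  have h4 : 2 * (F * δ) + 2 * C₃ * Λ * (1 / s) * (F * δ) ≤ swapConst m Λ * F * δ := by
    rw [hB]
    have hFδ : 0 ≤ F * δ := by positivity
    have : 2 * C₃ * Λ * (1 / s) * (F * δ) ≤ 2 * C₃ * Λ * 1 * (F * δ) := by gcongr
    have : 0 ≤ 2 * Real.exp 1 * C₃ * Λ * (F * δ) := by positivity
    have e : (2 * Real.exp 1 * C₃ * Λ + 2 + 2 * C₃ * Λ) * F * δ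
      = 2 * Real.exp 1 * C₃ * Λ * (F * δ) + 2 * (F * δ) + 2 * C₃ * Λ * 1 * (F * δ) := by ring
    linarith
  have e1 : (1 + swapConst m Λ * (1 / s)) * I = I + swapConst m Λ * (1 / s) * I := by ring
  have e2 : 2 * C₃ * Λ * (1 / s) * (Real.exp 1 * I + Real.exp 1 * (k : ℝ) ^ k + F * δ)
      = 2 * Real.exp 1 * C₃ * Λ * (1 / s) * I + 2 * Real.exp 1 * C₃ * Λ * (1 / s) * (k : ℝ) ^ k
        + 2 * C₃ * Λ * (1 / s) * (F * δ) := by ring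
  have e3 : 2 * (F * δ + C₃ * P ^ k / s * Λ) = 2 * (F * δ) + 2 * (C₃ * P ^ k / s * Λ) := by ring
  rw [e1]
  linarith

end Swap

/-! ### Scalar inequalities behind the smoothness of `L ^ (2 p)`. -/

section Numeric

/-- A second order expansion of `‖y + x‖ ^ (2 p)` keeping the sign of the linear term. -/
lemma norm_add_pow_le_sub (y x : ℂ) (p : ℕ) :
    ‖y + x‖ ^ (2 * (p + 1)) ≤ (‖y‖ + ‖x‖) ^ (2 * (p + 1))
      - 2 * (p + 1) * (‖y‖ * ‖x‖ - (starRingEnd ℂ y * x).re) * ‖y‖ ^ (2 * p) := by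
  set S := ‖y‖ + ‖x‖ with hS
  set θ := ‖y‖ * ‖x‖ - (starRingEnd ℂ y * x).re with hθ
  have hN : ‖y + x‖ ^ 2 = S ^ 2 - 2 * θ := by
    have h1 : ‖y + x‖ ^ 2 = ‖y‖ ^ 2 + ‖x‖ ^ 2 + 2 * (starRingEnd ℂ y * x).re := by
      rw [← Complex.normSq_eq_norm_sq, ← Complex.normSq_eq_norm_sq, ← Complex.normSq_eq_norm_sq,
        Complex.normSq_add]
      congr 2
      rw [← Complex.conj_re]
      simp
    rw [h1, hS, hθ]; ring
  have hle : |(starRingEnd ℂ y * x).re| ≤ ‖y‖ * ‖x‖ := by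
    refine (Complex.abs_re_le_norm _).trans_eq ?_
    rw [norm_mul, RCLike.norm_conj]
  have hθ0 : 0 ≤ θ := by rw [hθ]; linarith [le_abs_self (starRingEnd ℂ y * x).re]
  have hθ1 : θ ≤ 2 * (‖y‖ * ‖x‖) := by rw [hθ]; linarith [neg_abs_le (starRingEnd ℂ y * x).re]
  induction p with
  | zero => simp [hN]
  | succ p ih =>
    have hy := norm_nonneg y
    have hx := norm_nonneg x
    have hN0 : 0 ≤ S ^ 2 - 2 * θ := hN ▸ sq_nonneg _
    have h1 : ‖y + x‖ ^ (2 * (p + 1 + 1)) = ‖y + x‖ ^ (2 * (p + 1)) * ‖y + x‖ ^ 2 := by ring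
    have hbern : ∀ q : ℕ, ‖y‖ ^ (q + 1) + (q + 1) * ‖y‖ ^ q * ‖x‖ ≤ S ^ (q + 1) := by
      intro q
      induction q with
      | zero => simp [hS]
      | succ q ihq =>
        calc _ ≤ (‖y‖ ^ (q + 1) + (q + 1) * ‖y‖ ^ q * ‖x‖) * S := by
              rw [hS]
              have : 0 ≤ (q + 1) * ‖y‖ ^ q * ‖x‖ * ‖x‖ := by positivity
              push_cast
              ring_nf at this ⊢
              linarith
          _ ≤ S ^ (q + 1) * S := by gcongr
          _ = _ := by ring
    have h2 := hbern (2 * p + 1)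
    rw [h1, hN]
    refine (mul_le_mul_of_nonneg_right ih hN0).trans ?_
    have h3 : 0 ≤ θ ^ 2 * ‖y‖ ^ (2 * p) := by positivity
    have h4 : (p + 1) * ‖y‖ ^ (2 * p) * (‖y‖ ^ 2 - 2 * (‖y‖ * ‖x‖) + ‖x‖ ^ 2)
        ≤ (p + 1) * ‖y‖ ^ (2 * p) * (S ^ 2 - 2 * θ) := by
      gcongr
      rw [hS]; nlinarith
    have h5 : 0 ≤ (p + 1) * ‖y‖ ^ (2 * p) * ‖x‖ ^ 2 := by positivity
    -- This is what the induction step reduces to. The cross terms `‖y‖ ^ (2 p + 1) * ‖x‖` of `h4`,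
    -- from `S² - 2θ ≥ (‖y‖ - ‖x‖)²`, and of the Bernoulli bound `h2` cancel exactly.
    have h6 : (p + 2) * ‖y‖ ^ (2 * (p + 1))
        ≤ (p + 1) * ‖y‖ ^ (2 * p) * (S ^ 2 - 2 * θ) + S ^ (2 * (p + 1)) := by
      push_cast at h2
      have e1 : S ^ (2 * p + 1 + 1) = S ^ (2 * (p + 1)) := by ring
      rw [e1] at h2
      refine le_trans (le_of_sub_nonneg ?_) (add_le_add h4 h2)
      ring_nf
      ring_nf at h5
      linarith
    have h7 := mul_le_mul_of_nonneg_left h6 (by positivity : 0 ≤ 2 * θ)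
    push_cast
    have e2 : (S ^ (2 * (p + 1)) - 2 * (p + 1) * θ * ‖y‖ ^ (2 * p)) * (S ^ 2 - 2 * θ)
      = S ^ (2 * (p + 1 + 1)) - 2 * θ * ((p + 1) * ‖y‖ ^ (2 * p) * (S ^ 2 - 2 * θ)
        + S ^ (2 * (p + 1))) := by ring
    rw [e2]
    linarith

lemma pow_mul_pow_le_weighted {x y : ℝ} (hx : 0 ≤ x) (hy : 0 ≤ y) {i j q : ℕ} (hq : i + j = q)
    (hq0 : 0 < q) : x ^ i * y ^ j ≤ (i / q : ℝ) * x ^ q + (j / q : ℝ) * y ^ q := by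
  have hq0' : (0 : ℝ) < q := by exact_mod_cast hq0
  have h := Real.geom_mean_le_arith_mean2_weighted (w₁ := i / q) (w₂ := j / q) (p₁ := x ^ q)
    (p₂ := y ^ q) (by positivity) (by positivity) (by positivity) (by positivity) (by
      rw [← add_div, div_eq_one_iff_eq hq0'.ne']; exact_mod_cast hq)
  refine le_of_eq_of_le ?_ h
  congr 1 <;> rw [← Real.rpow_natCast_mul (by assumption), mul_div_cancel₀ _ hq0'.ne', Real.rpow_natCast]

/-- Tangent plane bound for the mixed terms in the binomial expansion. -/
lemma exists_tangent {a d : ℝ} (ha : 0 < a) (hd : 0 < d) {q : ℕ} (hq : 0 < q) :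
    ∃ α β : ℝ, 0 ≤ α ∧ 0 ≤ β ∧ α * a ^ q + β * d ^ q = (a + d) ^ q - q * (a ^ (q - 1) * d) ∧
      ∀ u v : ℝ, 0 ≤ u → 0 ≤ v →
        (u + v) ^ q - q * (u ^ (q - 1) * v) ≤ α * u ^ q + β * v ^ q := by
  have hexp : ∀ u v : ℝ, (u + v) ^ q - q * (u ^ (q - 1) * v)
      = ∑ j ∈ (Finset.range (q + 1)).erase 1, v ^ j * u ^ (q - j) * (q.choose j : ℝ) := by
    intro u v
    rw [add_comm u v, add_pow, ← Finset.add_sum_erase _ _ (Finset.mem_range.mpr (by omega : 1 < q + 1))]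
    rw [Nat.choose_one_right]
    ring
  have hq0 : (0 : ℝ) < q := by exact_mod_cast hq
  -- Each monomial `v ^ j * u ^ (q - j)` is bounded by weighted AM–GM for `v / d` and `u / a`, an
  -- equality at `(a, d)`; summing gives the coefficients of `u ^ q` and `v ^ q`. Being linear in
  -- these powers, the bound can be integrated.
  refine ⟨∑ j ∈ (Finset.range (q + 1)).erase 1,
      d ^ j * a ^ (q - j) * (q.choose j : ℝ) * ((q - j : ℕ) / q / a ^ q),
    ∑ j ∈ (Finset.range (q + 1)).erase 1,
      d ^ j * a ^ (q - j) * (q.choose j : ℝ) * (j / q / d ^ q), ?_, ?_, ?_, ?_⟩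
  · exact Finset.sum_nonneg fun j _ => by positivity
  · exact Finset.sum_nonneg fun j _ => by positivity
  · rw [hexp, Finset.sum_mul, Finset.sum_mul, ← Finset.sum_add_distrib]
    refine Finset.sum_congr rfl fun j hj => ?_
    have hjq : j ≤ q := by
      have := Finset.mem_range.mp (Finset.mem_of_mem_erase hj); omega
    rw [Nat.cast_sub hjq]
    field_simp
    ring
  · intro u v hu hv
    rw [hexp, Finset.sum_mul, Finset.sum_mul, ← Finset.sum_add_distrib]
    refine Finset.sum_le_sum fun j hj => ?_
    have hjq : j ≤ q := by
      have := Finset.mem_range.mp (Finset.mem_of_mem_erase hj); omega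
    have h := pow_mul_pow_le_weighted (x := v / d) (y := u / a) (by positivity) (by positivity)
      (by omega : j + (q - j) = q) hq
    calc v ^ j * u ^ (q - j) * (q.choose j : ℝ)
        = d ^ j * a ^ (q - j) * (q.choose j : ℝ) * ((v / d) ^ j * (u / a) ^ (q - j)) := by
          rw [div_pow, div_pow]; field_simp
      _ ≤ d ^ j * a ^ (q - j) * (q.choose j : ℝ) *
          ((j / q : ℝ) * (v / d) ^ q + ((q - j : ℕ) / q : ℝ) * (u / a) ^ q) := by gcongr
      _ = _ := by rw [div_pow, div_pow]; ring

lemma pow_succ_sub_pow_succ_le {x y : ℝ} (hy : 0 ≤ y) (hxy : y ≤ x) (p : ℕ) :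
    x ^ (p + 1) - y ^ (p + 1) ≤ (p + 1) * (x - y) * x ^ p := by
  induction p with
  | zero => simp
  | succ p ih =>
    have hx := hy.trans hxy
    have h1 := mul_le_mul_of_nonneg_left ih hx
    have h2 : y ^ (p + 1) * (x - y) ≤ x ^ (p + 1) * (x - y) := by
      have : 0 ≤ x - y := by linarith
      gcongr
    push_cast
    ring_nf at h1 h2 ⊢
    linarith

/-- Two-point inequality behind the smoothness of `L ^ (2 p)`. -/
lemma add_pow_le_smooth {a d e : ℝ} (ha : 0 ≤ a) (hd : 0 ≤ d) (p : ℕ) (he : 6 * (p + 1) ≤ e) :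
    (a + d) ^ (2 * (p + 1)) - 2 * (p + 1) * (a ^ (2 * p + 1) * d)
      ≤ (a ^ 2 + e ^ 2 * d ^ 2) ^ (p + 1) := by
  induction p with
  | zero =>
    have : d ^ 2 ≤ e ^ 2 * d ^ 2 := le_mul_of_one_le_left (by positivity) (by
      norm_num at he; nlinarith)
    norm_num
    nlinarith
  | succ p ih =>
    push_cast at he ⊢
    have hp : (0 : ℝ) ≤ p := Nat.cast_nonneg p
    have ih' := ih (by linarith)
    set X := a ^ 2 + e ^ 2 * d ^ 2 with hX
    have hX0 : 0 ≤ X := by positivity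
    have haX : a ^ 2 ≤ X := by rw [hX]; nlinarith [sq_nonneg (e * d)]
    have hZ : (a ^ 2) ^ p ≤ X ^ p := by gcongr
    have hZ1 : (a ^ 2) ^ (p + 1) ≤ X ^ (p + 1) := by gcongr
    have hZ0 : 0 ≤ X ^ p := by positivity
    have hade : 2 * (a * d) * e ≤ X := by rw [hX]; nlinarith [sq_nonneg (a - e * d)]
    have hsub := pow_succ_sub_pow_succ_le (sq_nonneg a) haX p
    have hade' : 2 * (a * d) ≤ X := by
      have : 0 ≤ a * d := by positivity
      nlinarith
    have t1 : 2 * (a * d) * (X ^ (p + 1) - (a ^ 2) ^ (p + 1)) ≤ (p + 1) * e * d ^ 2 * X ^ (p + 1) := by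
      calc _ ≤ 2 * (a * d) * ((p + 1) * (X - a ^ 2) * X ^ p) := by gcongr
        _ = (p + 1) * e * d ^ 2 * (2 * (a * d) * e) * X ^ p := by rw [hX]; ring
        _ ≤ (p + 1) * e * d ^ 2 * X * X ^ p := by
          have : 0 ≤ e := by linarith
          gcongr
        _ = _ := by ring
    have t2 : 4 * (p + 1) * (a ^ 2) ^ (p + 1) * d ^ 2 ≤ 4 * (p + 1) * X ^ (p + 1) * d ^ 2 := by gcongr
    have t3 : (p + 1) * (2 * (a * d)) * (a ^ 2) ^ p * d ^ 2 ≤ (p + 1) * X ^ (p + 1) * d ^ 2 := by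
      calc _ ≤ (p + 1) * X * X ^ p * d ^ 2 := by gcongr
        _ = _ := by ring
    -- The errors collected in `t1`–`t3` have this total coefficient, and `e ≥ 6 (p + 2)` leaves
    -- room for it inside `e ^ 2`.
    have t4 : (1 + 5 * (p + 1) + (p + 1) * e) * (d ^ 2 * X ^ (p + 1)) ≤ e ^ 2 * (d ^ 2 * X ^ (p + 1)) := by
      gcongr
      nlinarith
    have e1 : (a + d) ^ (2 * (p + 1 + 1)) = (a + d) ^ 2 * (a + d) ^ (2 * (p + 1)) := by ring
    have h1 : (a + d) ^ 2 * (a + d) ^ (2 * (p + 1))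
        ≤ (a + d) ^ 2 * (2 * (p + 1) * (a ^ (2 * p + 1) * d) + X ^ (p + 1)) := by
      gcongr; linarith
    have e2 : X ^ (p + 1 + 1) = (a ^ 2 + e ^ 2 * d ^ 2) * X ^ (p + 1) := by rw [pow_succ' X (p + 1)]
    rw [e1, e2]
    have e3 : (a ^ 2) ^ (p + 1) = a ^ 2 * (a ^ 2) ^ p := pow_succ' _ _
    have e4 : a ^ (2 * p + 1) = a * (a ^ 2) ^ p := by ring
    have e5 : a ^ (2 * (p + 1) + 1) = a ^ 3 * (a ^ 2) ^ p := by ring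
    rw [e3] at t1 t2
    rw [e4] at h1
    rw [e5]
    linarith

end Numeric

/-! ### High moments after adding an orthogonal increment. -/

section Moments

variable {Ω : Type*} [MeasurableSpace Ω] {μ : Measure Ω}

lemma norm_add_pow_le_two_pow (x y : ℂ) (q : ℕ) :
    ‖x + y‖ ^ q ≤ 2 ^ (q - 1) * (‖x‖ ^ q + ‖y‖ ^ q) :=
  (pow_le_pow_left₀ (norm_nonneg _) (norm_add_le x y) q).trans
    (add_pow_le (norm_nonneg _) (norm_nonneg _) q)

lemma integrable_norm_add_pow {Y D : Ω → ℂ} (hYm : Measurable Y) (hDm : Measurable D) {q : ℕ}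
    (hY : Integrable (fun ω => ‖Y ω‖ ^ q) μ) (hD : Integrable (fun ω => ‖D ω‖ ^ q) μ) :
    Integrable (fun ω => ‖Y ω + D ω‖ ^ q) μ := by
  refine Integrable.mono' ((hY.add hD).const_mul (2 ^ (q - 1)))
    ((hYm.add hDm).norm.pow_const q).aestronglyMeasurable (.of_forall fun ω => ?_)
  rw [norm_pow, norm_norm]
  exact norm_add_pow_le_two_pow _ _ _

lemma norm_pow_mul_norm_le (x y : ℂ) (q : ℕ) :
    ‖x‖ ^ q * ‖y‖ ≤ ‖x‖ ^ (q + 1) + ‖y‖ ^ (q + 1) := by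
  have h := pow_mul_pow_le_weighted (norm_nonneg x) (norm_nonneg y) (i := q) (j := 1) rfl
    (Nat.succ_pos q)
  rw [pow_one] at h
  refine h.trans (add_le_add ?_ ?_)
  · refine mul_le_of_le_one_left (by positivity) ?_
    rw [div_le_one (by positivity)]
    push_cast; linarith
  · refine mul_le_of_le_one_left (by positivity) ?_
    rw [div_le_one (by positivity)]
    push_cast
    linarith [Nat.cast_nonneg (α := ℝ) q]

/-- `L ^ (2 p)` is 2-smooth: adding an orthogonal increment. -/
lemma integral_norm_add_pow_le {Y D : Ω → ℂ} (hYm : Measurable Y) (hDm : Measurable D) {p : ℕ}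
    (hY : Integrable (fun ω => ‖Y ω‖ ^ (2 * (p + 1))) μ)
    (hD : Integrable (fun ω => ‖D ω‖ ^ (2 * (p + 1))) μ)
    (horth : ∫ ω, ‖Y ω‖ ^ (2 * p) * (starRingEnd ℂ (Y ω) * D ω).re ∂μ = 0)
    {A B : ℝ} (hA : 0 ≤ A) (hB : 0 ≤ B) (hYA : ∫ ω, ‖Y ω‖ ^ (2 * (p + 1)) ∂μ ≤ A ^ (p + 1))
    (hDB : ∫ ω, ‖D ω‖ ^ (2 * (p + 1)) ∂μ ≤ B ^ (p + 1)) :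
    ∫ ω, ‖Y ω + D ω‖ ^ (2 * (p + 1)) ∂μ ≤ (A + 36 * (p + 1) ^ 2 * B) ^ (p + 1) := by
  have hYD := integrable_norm_add_pow hYm hDm hY hD
  have hmix : Integrable (fun ω => ‖Y ω‖ ^ (2 * p + 1) * ‖D ω‖) μ := by
    refine Integrable.mono' (hY.add hD)
      ((hYm.norm.pow_const _).mul hDm.norm).aestronglyMeasurable (.of_forall fun ω => ?_)
    rw [norm_mul, norm_pow, norm_norm, norm_norm]
    exact norm_pow_mul_norm_le _ _ (2 * p + 1)
  have horthI : Integrable (fun ω => ‖Y ω‖ ^ (2 * p) * (starRingEnd ℂ (Y ω) * D ω).re) μ := by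
    refine Integrable.mono' hmix ?_ (.of_forall fun ω => ?_)
    · refine Measurable.aestronglyMeasurable ?_
      have : Measurable fun ω => starRingEnd ℂ (Y ω) := Complex.continuous_conj.measurable.comp hYm
      exact (hYm.norm.pow_const _).mul (Complex.measurable_re.comp (this.mul hDm))
    · rw [norm_mul, norm_pow, norm_norm, Real.norm_eq_abs, pow_succ, mul_assoc]
      gcongr
      refine (Complex.abs_re_le_norm _).trans_eq ?_
      rw [norm_mul, RCLike.norm_conj]
  -- The tangent bound needs strictly positive base points, so `A` and `B` are shifted by `ε`, which
  -- tends to `0` at the end.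
  have key : ∀ ε : ℝ, 0 < ε → ∫ ω, ‖Y ω + D ω‖ ^ (2 * (p + 1)) ∂μ
      ≤ ((A + ε) + 36 * (p + 1) ^ 2 * (B + ε)) ^ (p + 1) := by
    intro ε hε
    set a := √(A + ε) with ha
    set d := √(B + ε) with hd
    have ha0 : 0 < a := Real.sqrt_pos.mpr (by linarith)
    have hd0 : 0 < d := Real.sqrt_pos.mpr (by linarith)
    have ha2 : a ^ 2 = A + ε := Real.sq_sqrt (by linarith)
    have hd2 : d ^ 2 = B + ε := Real.sq_sqrt (by linarith)
    obtain ⟨α, β, hα, hβ, hsum, htan⟩ := exists_tangent ha0 hd0 (q := 2 * (p + 1)) (by omega)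
    -- The only term of first order in `D` appears with its sign and integrates to zero by `horth`;
    -- the rest is linear in the two `2 (p + 1)`-th powers.
    have hpt : ∀ ω, ‖Y ω + D ω‖ ^ (2 * (p + 1)) ≤ (α * ‖Y ω‖ ^ (2 * (p + 1))
        + β * ‖D ω‖ ^ (2 * (p + 1)))
        + 2 * (p + 1) * (‖Y ω‖ ^ (2 * p) * (starRingEnd ℂ (Y ω) * D ω).re) := by
      intro ω
      refine (norm_add_pow_le_sub (Y ω) (D ω) p).trans ?_
      have h1 := htan _ _ (norm_nonneg (Y ω)) (norm_nonneg (D ω))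
      have e : 2 * (p + 1) - 1 = 2 * p + 1 := by omega
      rw [e] at h1
      push_cast at h1
      have e2 : ‖Y ω‖ ^ (2 * p + 1) = ‖Y ω‖ ^ (2 * p) * ‖Y ω‖ := pow_succ _ _
      rw [e2] at h1
      linarith
    have h1 := integral_mono hYD (((hY.const_mul α).add (hD.const_mul β)).add
      (horthI.const_mul (2 * (p + 1)))) hpt
    have h2 := integral_add ((hY.const_mul α).add (hD.const_mul β)) (horthI.const_mul (2 * (p + 1)))
    have h3 := integral_add (hY.const_mul α) (hD.const_mul β)
    simp only [Pi.add_apply] at h1 h2 h3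
    rw [h2, h3, integral_const_mul, integral_const_mul, integral_const_mul, horth, mul_zero,
      add_zero] at h1
    refine h1.trans ?_
    have h4 : ∫ ω, ‖Y ω‖ ^ (2 * (p + 1)) ∂μ ≤ a ^ (2 * (p + 1)) := by
      rw [pow_mul, ha2]
      exact hYA.trans (by gcongr; linarith)
    have h5 : ∫ ω, ‖D ω‖ ^ (2 * (p + 1)) ∂μ ≤ d ^ (2 * (p + 1)) := by
      rw [pow_mul, hd2]
      exact hDB.trans (by gcongr; linarith)
    have h6 := add_pow_le_smooth ha0.le hd0.le p (le_refl (6 * ((p : ℝ) + 1)))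
    calc _ ≤ α * a ^ (2 * (p + 1)) + β * d ^ (2 * (p + 1)) := by gcongr
      _ = _ := hsum
      _ ≤ (a ^ 2 + (6 * ((p : ℝ) + 1)) ^ 2 * d ^ 2) ^ (p + 1) := by
        have e : 2 * (p + 1) - 1 = 2 * p + 1 := by omega
        rw [e]; push_cast; exact h6
      _ = _ := by rw [ha2, hd2]; ring
  have hlim : Filter.Tendsto (fun ε : ℝ => ((A + ε) + 36 * (p + 1) ^ 2 * (B + ε)) ^ (p + 1))
      (nhdsWithin 0 (Set.Ioi 0)) (nhds ((A + 36 * (p + 1) ^ 2 * B) ^ (p + 1))) := by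
    have hc : Continuous fun ε : ℝ => ((A + ε) + 36 * (p + 1) ^ 2 * (B + ε)) ^ (p + 1) := by
      fun_prop
    have := (hc.tendsto 0).mono_left (nhdsWithin_le_nhds (s := Set.Ioi 0))
    simpa using this
  exact ge_of_tendsto hlim (Filter.eventually_of_mem self_mem_nhdsWithin fun ε hε => key ε hε)

/-- One step of the martingale argument: an increment which is linear in a centred variable
independent of the past. -/
lemma integral_norm_add_increment_pow_le {τ : Type*} [MeasurableSpace τ] {T : Ω → τ}
    (hT : Measurable T) {ξ : Ω → ℂ} (hξ : Measurable ξ) (hind : IndepFun T ξ μ) {p : ℕ}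
    (hξI : Integrable (fun ω => ‖ξ ω‖ ^ (2 * (p + 1))) μ) (hξ0 : ∫ ω, ξ ω ∂μ = 0)
    {f g h : τ → ℂ} (hf : Measurable f) (hg : Measurable g) (hh : Measurable h)
    (hfI : Integrable (fun ω => ‖f (T ω)‖ ^ (2 * (p + 1))) μ)
    (hgI : Integrable (fun ω => ‖g (T ω)‖ ^ (2 * (p + 1))) μ)
    (hhI : Integrable (fun ω => ‖h (T ω)‖ ^ (2 * (p + 1))) μ)
    {A B₁ B₂ L : ℝ} (hA : 0 ≤ A) (hB₁ : 0 ≤ B₁) (hB₂ : 0 ≤ B₂) (hL : 0 ≤ L)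
    (hfA : ∫ ω, ‖f (T ω)‖ ^ (2 * (p + 1)) ∂μ ≤ A ^ (p + 1))
    (hgB : ∫ ω, ‖g (T ω)‖ ^ (2 * (p + 1)) ∂μ ≤ B₁ ^ (p + 1))
    (hhB : ∫ ω, ‖h (T ω)‖ ^ (2 * (p + 1)) ∂μ ≤ B₂ ^ (p + 1))
    (hξL : ∫ ω, ‖ξ ω‖ ^ (2 * (p + 1)) ∂μ ≤ L ^ (p + 1)) :
    Integrable (fun ω => ‖f (T ω) + (g (T ω) * starRingEnd ℂ (ξ ω) + h (T ω) * ξ ω)‖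
      ^ (2 * (p + 1))) μ ∧
    ∫ ω, ‖f (T ω) + (g (T ω) * starRingEnd ℂ (ξ ω) + h (T ω) * ξ ω)‖ ^ (2 * (p + 1)) ∂μ
      ≤ (A + 144 * (p + 1) ^ 2 * L * (B₁ + B₂)) ^ (p + 1) := by
  have hconj : Measurable (starRingEnd ℂ) := Complex.continuous_conj.measurable
  have hcξ : Measurable fun ω => starRingEnd ℂ (ξ ω) := hconj.comp hξ
  have hfm : Measurable fun ω => f (T ω) := hf.comp hT
  have hgm : Measurable fun ω => g (T ω) := hg.comp hT
  have hhm : Measurable fun ω => h (T ω) := hh.comp hT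
  have hnp : Measurable fun x : ℂ => ‖x‖ ^ (2 * (p + 1)) := measurable_norm.pow_const _
  have prod : ∀ u : τ → ℂ, Measurable u → Integrable (fun ω => ‖u (T ω)‖ ^ (2 * (p + 1))) μ →
      Integrable (fun ω => ‖u (T ω) * ξ ω‖ ^ (2 * (p + 1))) μ ∧
      ∫ ω, ‖u (T ω) * ξ ω‖ ^ (2 * (p + 1)) ∂μ
        = (∫ ω, ‖u (T ω)‖ ^ (2 * (p + 1)) ∂μ) * ∫ ω, ‖ξ ω‖ ^ (2 * (p + 1)) ∂μ := by
    intro u hu huI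
    have hi : IndepFun (fun ω => ‖u (T ω)‖ ^ (2 * (p + 1))) (fun ω => ‖ξ ω‖ ^ (2 * (p + 1))) μ :=
      hind.comp (φ := fun t => ‖u t‖ ^ (2 * (p + 1))) (hnp.comp hu) hnp
    simp_rw [norm_mul, mul_pow]
    exact ⟨hi.integrable_mul huI hξI,
      hi.integral_fun_mul_eq_mul_integral huI.aestronglyMeasurable hξI.aestronglyMeasurable⟩
  obtain ⟨pg1, pg2⟩ := prod g hg hgI
  obtain ⟨ph1, ph2⟩ := prod h hh hhI
  have hnc : ∀ ω, ‖g (T ω) * starRingEnd ℂ (ξ ω)‖ = ‖g (T ω) * ξ ω‖ := fun ω => by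
    rw [norm_mul, norm_mul, RCLike.norm_conj]
  have hd1 : Integrable (fun ω => ‖g (T ω) * starRingEnd ℂ (ξ ω)‖ ^ (2 * (p + 1))) μ := by
    simpa only [hnc] using pg1
  have hDm1 : Measurable fun ω => g (T ω) * starRingEnd ℂ (ξ ω) := hgm.mul hcξ
  have hDm2 : Measurable fun ω => h (T ω) * ξ ω := hhm.mul hξ
  have hDI := integrable_norm_add_pow hDm1 hDm2 hd1 ph1
  have hDm : Measurable fun ω => g (T ω) * starRingEnd ℂ (ξ ω) + h (T ω) * ξ ω := hDm1.add hDm2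
  refine ⟨integrable_norm_add_pow hfm hDm hfI hDI, ?_⟩
  -- Splitting the increment into its two parts costs a factor `4` inside the power, so that `36`
  -- becomes `144`.
  have hDB : ∫ ω, ‖g (T ω) * starRingEnd ℂ (ξ ω) + h (T ω) * ξ ω‖ ^ (2 * (p + 1)) ∂μ
      ≤ (4 * L * (B₁ + B₂)) ^ (p + 1) := by
    have h1 := integral_mono hDI ((hd1.add ph1).const_mul (2 ^ (2 * (p + 1) - 1)))
      fun ω => norm_add_pow_le_two_pow _ _ _
    have h2 := integral_add hd1 ph1
    simp only [Pi.add_apply] at h1 h2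
    rw [integral_const_mul, h2] at h1
    simp only [hnc] at h1
    rw [pg2, ph2] at h1
    refine h1.trans ?_
    have hξ0' : 0 ≤ ∫ ω, ‖ξ ω‖ ^ (2 * (p + 1)) ∂μ := integral_nonneg fun ω => by positivity
    have t1 : (∫ ω, ‖g (T ω)‖ ^ (2 * (p + 1)) ∂μ) * ∫ ω, ‖ξ ω‖ ^ (2 * (p + 1)) ∂μ
        ≤ B₁ ^ (p + 1) * L ^ (p + 1) := by gcongr
    have t2 : (∫ ω, ‖h (T ω)‖ ^ (2 * (p + 1)) ∂μ) * ∫ ω, ‖ξ ω‖ ^ (2 * (p + 1)) ∂μ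
        ≤ B₂ ^ (p + 1) * L ^ (p + 1) := by gcongr
    have t3 : B₁ ^ (p + 1) + B₂ ^ (p + 1) ≤ (B₁ + B₂) ^ (p + 1) :=
      pow_add_pow_le hB₁ hB₂ (by omega)
    calc _ ≤ 2 ^ (2 * (p + 1) - 1) * (B₁ ^ (p + 1) * L ^ (p + 1) + B₂ ^ (p + 1) * L ^ (p + 1)) := by
          gcongr
      _ = 2 ^ (2 * (p + 1) - 1) * L ^ (p + 1) * (B₁ ^ (p + 1) + B₂ ^ (p + 1)) := by ring
      _ ≤ 2 ^ (2 * (p + 1)) * L ^ (p + 1) * (B₁ + B₂) ^ (p + 1) := by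
        gcongr
        · norm_num
        · omega
      _ = _ := by rw [pow_mul, ← mul_pow, ← mul_pow]; norm_num
  -- Only the vanishing mean is used: the increment is linear in `ξ` and its conjugate separately,
  -- so nothing is required of `𝔼 ξ²`.
  have horth : ∫ ω, ‖f (T ω)‖ ^ (2 * p) *
      (starRingEnd ℂ (f (T ω)) * (g (T ω) * starRingEnd ℂ (ξ ω) + h (T ω) * ξ ω)).re ∂μ = 0 := by
    have hWm : Measurable fun t => ((‖f t‖ ^ (2 * p) : ℝ) : ℂ) * starRingEnd ℂ (f t) :=
      (Complex.measurable_ofReal.comp (hf.norm.pow_const _)).mul (hconj.comp hf)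
    have hcov : ∀ (u : τ → ℂ) (ζ : Ω → ℂ), Measurable u → Measurable ζ → IndepFun T ζ μ →
        ∫ ω, ζ ω ∂μ = 0 → Integrable (fun ω => ‖u (T ω) * ζ ω‖ ^ (2 * (p + 1))) μ →
        Integrable (fun ω => ((‖f (T ω)‖ ^ (2 * p) : ℝ) : ℂ) * starRingEnd ℂ (f (T ω))
          * (u (T ω) * ζ ω)) μ ∧
        ∫ ω, ((‖f (T ω)‖ ^ (2 * p) : ℝ) : ℂ) * starRingEnd ℂ (f (T ω)) * (u (T ω) * ζ ω) ∂μ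
          = 0 := by
      intro u ζ hu hζ hi h0 hI
      constructor
      · refine Integrable.mono' (hfI.add hI)
          ((hWm.comp hT).mul ((hu.comp hT).mul hζ)).aestronglyMeasurable (.of_forall fun ω => ?_)
        refine le_trans (le_of_eq ?_) (norm_pow_mul_norm_le (f (T ω)) (u (T ω) * ζ ω) (2 * p + 1))
        rw [norm_mul, norm_mul, Complex.norm_real, RCLike.norm_conj, norm_pow, norm_norm, pow_succ]
      · have hi' : IndepFun (fun ω => ((‖f (T ω)‖ ^ (2 * p) : ℝ) : ℂ)
            * starRingEnd ℂ (f (T ω)) * u (T ω)) ζ μ :=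
          hi.comp (φ := fun t => ((‖f t‖ ^ (2 * p) : ℝ) : ℂ) * starRingEnd ℂ (f t) * u t)
            (hWm.mul hu) measurable_id
        simp_rw [← mul_assoc]
        rw [hi'.integral_fun_mul_eq_mul_integral
          ((hWm.mul hu).comp hT).aestronglyMeasurable hζ.aestronglyMeasurable, h0, mul_zero]
    have hindc : IndepFun T (fun ω => starRingEnd ℂ (ξ ω)) μ := hind.comp measurable_id hconj
    have hξc : ∫ ω, starRingEnd ℂ (ξ ω) ∂μ = 0 := by rw [integral_conj, hξ0, map_zero]
    obtain ⟨i1, z1⟩ := hcov g _ hg hcξ hindc hξc hd1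
    obtain ⟨i2, z2⟩ := hcov h _ hh hξ hind hξ0 ph1
    have e : ∀ ω, ‖f (T ω)‖ ^ (2 * p) *
        (starRingEnd ℂ (f (T ω)) * (g (T ω) * starRingEnd ℂ (ξ ω) + h (T ω) * ξ ω)).re
        = RCLike.re (((‖f (T ω)‖ ^ (2 * p) : ℝ) : ℂ) * starRingEnd ℂ (f (T ω))
          * (g (T ω) * starRingEnd ℂ (ξ ω))
          + ((‖f (T ω)‖ ^ (2 * p) : ℝ) : ℂ) * starRingEnd ℂ (f (T ω)) * (h (T ω) * ξ ω)) := by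
      intro ω
      rw [← Complex.re_ofReal_mul, ← mul_add, mul_assoc]
      rfl
    simp_rw [e]
    have h1 := integral_re (i1.add i2)
    have h2 := integral_add i1 i2
    simp only [Pi.add_apply] at h1 h2
    rw [h1, h2, z1, z2]
    simp
  refine (integral_norm_add_pow_le hfm hDm hfI hDI horth hA (by positivity) hfA hDB).trans_eq ?_
  ring

end Moments

/-! ### Moments and concentration of linear and quadratic forms. -/

section Forms

variable {Ω : Type*} [MeasurableSpace Ω] {μ : Measure Ω}

lemma indepFun_restrict_of_notMem {κ : Type*} {X : κ → Ω → ℂ}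
    (hX : iIndepFun X μ) (hXm : ∀ k, Measurable (X k)) {s : Finset κ} {k : κ} (hk : k ∉ s) :
    IndepFun (fun ω (i : s) => X i ω) (X k) μ := by
  have h := hX.indepFun_finset s {k} (Finset.disjoint_singleton_right.mpr hk) hXm
  exact h.comp (ψ := fun x : ({k} : Finset κ) → ℂ => x ⟨k, Finset.mem_singleton_self k⟩)
    measurable_id (measurable_pi_apply _)

/-- Moments of linear forms in independent centred variables. -/
lemma integral_norm_linearForm_pow_le [IsProbabilityMeasure μ] {κ : Type*} {X : κ → Ω → ℂ}
    (hX : iIndepFun X μ) (hXm : ∀ k, Measurable (X k)) (hX0 : ∀ k, ∫ ω, X k ω ∂μ = 0) {p : ℕ}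
    (hXI : ∀ k, Integrable (fun ω => ‖X k ω‖ ^ (2 * (p + 1))) μ) {L : ℝ} (hL : 0 ≤ L)
    (hXL : ∀ k, ∫ ω, ‖X k ω‖ ^ (2 * (p + 1)) ∂μ ≤ L ^ (p + 1)) (b : κ → ℂ) (s : Finset κ) :
    Integrable (fun ω => ‖∑ j ∈ s, b j * X j ω‖ ^ (2 * (p + 1))) μ ∧
    ∫ ω, ‖∑ j ∈ s, b j * X j ω‖ ^ (2 * (p + 1)) ∂μ
      ≤ (144 * (p + 1) ^ 2 * L * ∑ j ∈ s, ‖b j‖ ^ 2) ^ (p + 1) := by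
  classical
  induction s using Finset.induction_on with
  | empty => simp
  | insert k s hk ih =>
    have s1 : ∀ ω, ∑ j : s, b j * X j ω = ∑ j ∈ s, b j * X j ω := fun ω =>
      Finset.sum_coe_sort s (fun j => b j * X j ω)
    have h := integral_norm_add_increment_pow_le (T := fun ω (i : s) => X i ω)
      (measurable_pi_lambda _ fun i => hXm i) (hXm k) (indepFun_restrict_of_notMem hX hXm hk)
      (hXI k) (hX0 k) (f := fun x => ∑ j : s, b j * x j) (g := fun _ => 0) (h := fun _ => b k)
      (by fun_prop) measurable_const measurable_const
      (A := 144 * (p + 1) ^ 2 * L * ∑ j ∈ s, ‖b j‖ ^ 2) (B₁ := 0) (B₂ := ‖b k‖ ^ 2) (L := L)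
      (by simpa only [s1] using ih.1)
      (by simp) (integrable_const _) (by positivity) le_rfl (by positivity) hL
      (by simpa only [s1] using ih.2)
      (by simp) (by simp [pow_mul]) (hXL k)
    simp only [s1, zero_mul, zero_add] at h
    have e : ∀ ω, ∑ j ∈ insert k s, b j * X j ω = ∑ j ∈ s, b j * X j ω + b k * X k ω := fun ω => by
      rw [Finset.sum_insert hk, add_comm]
    simp_rw [e]
    refine ⟨h.1, h.2.trans_eq ?_⟩
    rw [Finset.sum_insert hk]
    ring

/-- Moments of quadratic forms without diagonal in independent centred variables. -/
lemma integral_norm_offDiagForm_pow_le [IsProbabilityMeasure μ] {κ : Type*} [DecidableEq κ]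
    {X : κ → Ω → ℂ}
    (hX : iIndepFun X μ) (hXm : ∀ k, Measurable (X k)) (hX0 : ∀ k, ∫ ω, X k ω ∂μ = 0) {p : ℕ}
    (hXI : ∀ k, Integrable (fun ω => ‖X k ω‖ ^ (2 * (p + 1))) μ) {L : ℝ} (hL : 0 ≤ L)
    (hXL : ∀ k, ∫ ω, ‖X k ω‖ ^ (2 * (p + 1)) ∂μ ≤ L ^ (p + 1)) (D : κ → κ → ℂ) (s : Finset κ) :
    Integrable (fun ω => ‖∑ i ∈ s, ∑ j ∈ s,
      if i = j then 0 else D i j * starRingEnd ℂ (X i ω) * X j ω‖ ^ (2 * (p + 1))) μ ∧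
    ∫ ω, ‖∑ i ∈ s, ∑ j ∈ s,
      if i = j then 0 else D i j * starRingEnd ℂ (X i ω) * X j ω‖ ^ (2 * (p + 1)) ∂μ
      ≤ ((144 * (p + 1) ^ 2 * L) ^ 2 * ∑ i ∈ s, ∑ j ∈ s, ‖D i j‖ ^ 2) ^ (p + 1) := by
  set K : ℝ := 144 * (p + 1) ^ 2 * L with hK
  have hK0 : 0 ≤ K := by positivity
  induction s using Finset.induction_on with
  | empty => simp
  | insert k s hk ih =>
    have hconj : Measurable (starRingEnd ℂ) := Complex.continuous_conj.measurable
    have l1 := integral_norm_linearForm_pow_le hX hXm hX0 hXI hL hXL (fun j => D k j) s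
    have l2 := integral_norm_linearForm_pow_le hX hXm hX0 hXI hL hXL
      (fun j => starRingEnd ℂ (D j k)) s
    have en : ∀ ω, ‖∑ j ∈ s, starRingEnd ℂ (D j k) * X j ω‖
        = ‖∑ j ∈ s, D j k * starRingEnd ℂ (X j ω)‖ := fun ω => by
      rw [← RCLike.norm_conj, map_sum]
      simp
    simp only [en, RCLike.norm_conj] at l2
    have s1 : ∀ ω, ∑ j : s, D k j * X j ω = ∑ j ∈ s, D k j * X j ω := fun ω =>
      Finset.sum_coe_sort s (fun j => D k j * X j ω)
    have s2 : ∀ ω, ∑ j : s, D j k * starRingEnd ℂ (X j ω)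
        = ∑ j ∈ s, D j k * starRingEnd ℂ (X j ω) := fun ω =>
      Finset.sum_coe_sort s (fun j => D j k * starRingEnd ℂ (X j ω))
    have s3 : ∀ ω, (∑ i : s, ∑ j : s,
          if (i : κ) = j then 0 else D i j * starRingEnd ℂ (X i ω) * X j ω)
        = ∑ i ∈ s, ∑ j ∈ s, if i = j then 0 else D i j * starRingEnd ℂ (X i ω) * X j ω := by
      intro ω
      rw [← Finset.sum_coe_sort s]
      exact Finset.sum_congr rfl fun i _ => Finset.sum_coe_sort s
        (fun j => if (i : κ) = j then 0 else D i j * starRingEnd ℂ (X i ω) * X j ω)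
    -- A new index `k` contributes terms linear in `X k` and its conjugate, with coefficients that
    -- are linear forms in the earlier variables; their moments supply the second factor `K`.
    have h := integral_norm_add_increment_pow_le (T := fun ω (i : s) => X i ω)
      (measurable_pi_lambda _ fun i => hXm i) (hXm k) (indepFun_restrict_of_notMem hX hXm hk)
      (hXI k) (hX0 k)
      (f := fun x => ∑ i : s, ∑ j : s,
        if (i : κ) = j then 0 else D i j * starRingEnd ℂ (x i) * x j)
      (g := fun x => ∑ j : s, D k j * x j) (h := fun x => ∑ j : s, D j k * starRingEnd ℂ (x j))
      (by
        refine Finset.measurable_sum _ fun i _ => Finset.measurable_sum _ fun j _ => ?_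
        split_ifs
        · exact measurable_const
        · exact ((hconj.comp (measurable_pi_apply i)).const_mul _).mul (measurable_pi_apply j))
      (by fun_prop)
      (Finset.measurable_sum _ fun j _ => (hconj.comp (measurable_pi_apply j)).const_mul _)
      (A := K ^ 2 * ∑ i ∈ s, ∑ j ∈ s, ‖D i j‖ ^ 2) (B₁ := K * ∑ j ∈ s, ‖D k j‖ ^ 2)
      (B₂ := K * ∑ j ∈ s, ‖D j k‖ ^ 2) (L := L)
      (by simpa only [s3] using ih.1) (by simpa only [s1] using l1.1)
      (by simpa only [s2] using l2.1) (by positivity) (by positivity) (by positivity) hL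
      (by simpa only [s3] using ih.2) (by simpa only [s1] using l1.2)
      (by simpa only [s2] using l2.2) (hXL k)
    simp only [s1, s2, s3] at h
    have e : ∀ ω, (∑ i ∈ insert k s, ∑ j ∈ insert k s,
          if i = j then 0 else D i j * starRingEnd ℂ (X i ω) * X j ω)
        = (∑ i ∈ s, ∑ j ∈ s, if i = j then 0 else D i j * starRingEnd ℂ (X i ω) * X j ω)
          + ((∑ j ∈ s, D k j * X j ω) * starRingEnd ℂ (X k ω)
            + (∑ j ∈ s, D j k * starRingEnd ℂ (X j ω)) * X k ω) := by
      intro ω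
      simp_rw [Finset.sum_insert hk]
      rw [if_pos trivial, zero_add, Finset.sum_add_distrib, Finset.sum_mul, Finset.sum_mul]
      have t1 : ∑ x ∈ s, (if k = x then 0 else D k x * starRingEnd ℂ (X k ω) * X x ω)
          = ∑ x ∈ s, D k x * X x ω * starRingEnd ℂ (X k ω) :=
        Finset.sum_congr rfl fun x hx => by
          rw [if_neg (by rintro rfl; exact hk hx)]; ring
      have t2 : ∑ x ∈ s, (if x = k then 0 else D x k * starRingEnd ℂ (X x ω) * X k ω)
          = ∑ x ∈ s, D x k * starRingEnd ℂ (X x ω) * X k ω :=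
        Finset.sum_congr rfl fun x hx => by
          rw [if_neg (by rintro rfl; exact hk hx)]
      rw [t1, t2]
      ring
    simp_rw [e]
    refine ⟨h.1, h.2.trans ?_⟩
    rw [← hK]
    have e2 : K ^ 2 * (∑ i ∈ s, ∑ j ∈ s, ‖D i j‖ ^ 2)
        + K * (K * ∑ j ∈ s, ‖D k j‖ ^ 2 + K * ∑ j ∈ s, ‖D j k‖ ^ 2)
        = K ^ 2 * ((∑ i ∈ s, ∑ j ∈ s, ‖D i j‖ ^ 2) + ((∑ j ∈ s, ‖D k j‖ ^ 2)
          + ∑ j ∈ s, ‖D j k‖ ^ 2)) := by ring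
    rw [e2]
    gcongr
    simp_rw [Finset.sum_insert hk]
    rw [Finset.sum_add_distrib]
    have : 0 ≤ ‖D k k‖ ^ 2 := by positivity
    linarith

/-- Moments of quadratic forms in independent centred variables of unit variance. -/
lemma integral_norm_quadForm_sub_pow_le [IsProbabilityMeasure μ] {κ : Type*} [Fintype κ]
    [DecidableEq κ] {X : κ → Ω → ℂ}
    (hX : iIndepFun X μ) (hXm : ∀ k, Measurable (X k)) (hX0 : ∀ k, ∫ ω, X k ω ∂μ = 0) {p : ℕ}
    (hXI : ∀ k, Integrable (fun ω => ‖X k ω‖ ^ (2 * (p + 1))) μ) {L : ℝ} (hL : 1 ≤ L)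
    (hXL : ∀ k, ∫ ω, ‖X k ω‖ ^ (2 * (p + 1)) ∂μ ≤ L ^ (p + 1))
    (hX2I : ∀ k, Integrable (fun ω => ‖X k ω‖ ^ 2) μ) (hX2 : ∀ k, ∫ ω, ‖X k ω‖ ^ 2 ∂μ = 1)
    (hX4I : ∀ k, Integrable (fun ω => ‖X k ω‖ ^ (4 * (p + 1))) μ)
    (hX4 : ∀ k, ∫ ω, ‖X k ω‖ ^ (4 * (p + 1)) ∂μ ≤ L ^ (2 * (p + 1))) (D : κ → κ → ℂ) :
    Integrable (fun ω => ‖∑ i, ∑ j, D i j * starRingEnd ℂ (X i ω) * X j ω - ∑ i, D i i‖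
      ^ (2 * (p + 1))) μ ∧
    ∫ ω, ‖∑ i, ∑ j, D i j * starRingEnd ℂ (X i ω) * X j ω - ∑ i, D i i‖ ^ (2 * (p + 1)) ∂μ
      ≤ ((288 * (p + 1) ^ 2 * L) ^ 2 * ∑ i, ∑ j, ‖D i j‖ ^ 2) ^ (p + 1) := by
  have hL0 : 0 ≤ L := zero_le_one.trans hL
  have hconj : Measurable (starRingEnd ℂ) := Complex.continuous_conj.measurable
  obtain ⟨o1, o2⟩ := integral_norm_offDiagForm_pow_le hX hXm hX0 hXI hL0 hXL D Finset.univ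
  -- The diagonal part, centred by the unit variance, is a linear form in the independent variables
  -- `|X k|² - 1`, whose moments are controlled by the `4 (p + 1)`-th moments of `X k`.
  set Z : κ → Ω → ℂ := fun k ω => ((‖X k ω‖ ^ 2 - 1 : ℝ) : ℂ) with hZ
  have hsqm : Measurable fun x : ℂ => ((‖x‖ ^ 2 - 1 : ℝ) : ℂ) := by fun_prop
  have hZi : iIndepFun Z μ := hX.comp (fun _ x => ((‖x‖ ^ 2 - 1 : ℝ) : ℂ)) fun _ => hsqm
  have hZm : ∀ k, Measurable (Z k) := fun k => hsqm.comp (hXm k)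
  have hZ0 : ∀ k, ∫ ω, Z k ω ∂μ = 0 := by
    intro k
    rw [hZ]
    simp only
    rw [integral_complex_ofReal, integral_sub (hX2I k) (integrable_const _), hX2]
    simp
  have hZpt : ∀ k ω, ‖Z k ω‖ ^ (2 * (p + 1))
      ≤ 2 ^ (2 * (p + 1) - 1) * (‖X k ω‖ ^ (4 * (p + 1)) + 1) := by
    intro k ω
    have h := norm_add_pow_le_two_pow ((‖X k ω‖ ^ 2 : ℝ) : ℂ) (-1) (2 * (p + 1))
    rw [norm_neg, norm_one, one_pow, Complex.norm_real, norm_pow, norm_norm, ← pow_mul] at h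
    have e1 : Z k ω = ((‖X k ω‖ ^ 2 : ℝ) : ℂ) + -1 := by rw [hZ]; push_cast; ring
    have e2 : 2 * (2 * (p + 1)) = 4 * (p + 1) := by ring
    rw [e1, ← e2]
    exact h
  have hZdom : ∀ k, Integrable (fun ω => 2 ^ (2 * (p + 1) - 1) * (‖X k ω‖ ^ (4 * (p + 1)) + 1)) μ :=
    fun k => ((hX4I k).add (integrable_const 1)).const_mul _
  have hZI : ∀ k, Integrable (fun ω => ‖Z k ω‖ ^ (2 * (p + 1))) μ := fun k =>
    Integrable.mono' (hZdom k) ((hZm k).norm.pow_const _).aestronglyMeasurable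
      (.of_forall fun ω => by rw [norm_pow, norm_norm]; exact hZpt k ω)
  have hZL : ∀ k, ∫ ω, ‖Z k ω‖ ^ (2 * (p + 1)) ∂μ ≤ (4 * L ^ 2) ^ (p + 1) := by
    intro k
    have h1 := integral_mono (hZI k) (hZdom k) (hZpt k)
    have h2 := integral_add (hX4I k) (integrable_const (1 : ℝ))
    rw [integral_const_mul, h2] at h1
    simp only [integral_const, probReal_univ, smul_eq_mul, mul_one] at h1
    refine h1.trans ?_
    have h3 : 1 ≤ L ^ (2 * (p + 1)) := one_le_pow₀ hL
    calc _ ≤ 2 ^ (2 * (p + 1) - 1) * (L ^ (2 * (p + 1)) + L ^ (2 * (p + 1))) := by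
          gcongr
          exact hX4 k
      _ = 2 ^ (2 * (p + 1) - 1 + 1) * L ^ (2 * (p + 1)) := by rw [pow_succ]; ring
      _ = _ := by
        have : 2 * (p + 1) - 1 + 1 = 2 * (p + 1) := by omega
        rw [this, pow_mul, pow_mul, mul_pow]; norm_num
  obtain ⟨d1, d2⟩ := integral_norm_linearForm_pow_le hZi hZm hZ0 hZI (L := 4 * L ^ 2)
    (by positivity) hZL (fun i => D i i) Finset.univ
  have hdec : ∀ ω, ∑ i, ∑ j, D i j * starRingEnd ℂ (X i ω) * X j ω - ∑ i, D i i
      = (∑ i, ∑ j, if i = j then 0 else D i j * starRingEnd ℂ (X i ω) * X j ω)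
        + ∑ i, D i i * Z i ω := by
    intro ω
    rw [← Finset.sum_sub_distrib, ← Finset.sum_add_distrib]
    refine Finset.sum_congr rfl fun i _ => ?_
    have h1 : ∑ j, D i j * starRingEnd ℂ (X i ω) * X j ω
        = (∑ j, if i = j then 0 else D i j * starRingEnd ℂ (X i ω) * X j ω)
          + D i i * starRingEnd ℂ (X i ω) * X i ω := by
      rw [← Finset.add_sum_erase _ _ (Finset.mem_univ i),
        ← Finset.add_sum_erase (a := i) (f := fun j => if i = j then 0 else D i j * starRingEnd ℂ (X i ω) * X j ω) _ (Finset.mem_univ i), if_pos rfl, zero_add, add_comm]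
      congr 1
      exact Finset.sum_congr rfl fun j hj => (if_neg (Finset.ne_of_mem_erase hj).symm).symm
    have h2 : starRingEnd ℂ (X i ω) * X i ω = (‖X i ω‖ ^ 2 : ℂ) := Complex.conj_mul' _
    rw [h1, mul_assoc, h2, hZ]
    push_cast
    ring
  simp_rw [hdec]
  have m1 : Measurable fun ω => ∑ i, ∑ j, if i = j then 0 else D i j * starRingEnd ℂ (X i ω) * X j ω := by
    refine Finset.measurable_sum _ fun i _ => Finset.measurable_sum _ fun j _ => ?_
    split_ifs
    · exact measurable_const
    · exact ((hconj.comp (hXm i)).const_mul _).mul (hXm j)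
  have m2 : Measurable fun ω => ∑ i, D i i * Z i ω :=
    Finset.measurable_sum _ fun i _ => (hZm i).const_mul _
  have hI := integrable_norm_add_pow m1 m2 o1 d1
  refine ⟨hI, ?_⟩
  have h1 := integral_mono hI ((o1.add d1).const_mul (2 ^ (2 * (p + 1) - 1)))
    fun ω => norm_add_pow_le_two_pow _ _ _
  have h2 := integral_add o1 d1
  simp only [Pi.add_apply] at h1 h2
  rw [integral_const_mul, h2] at h1
  refine h1.trans ?_
  set S := ∑ i, ∑ j, ‖D i j‖ ^ 2 with hS
  have hS0 : 0 ≤ S := Finset.sum_nonneg fun i _ => Finset.sum_nonneg fun j _ => by positivity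
  have hdiag : ∑ i, ‖D i i‖ ^ 2 ≤ S := Finset.sum_le_sum fun i _ =>
    Finset.single_le_sum (f := fun j => ‖D i j‖ ^ 2) (fun j _ => by positivity) (Finset.mem_univ i)
  -- The diagonal part obeys the same bound as the off-diagonal one; adding the two doubles the
  -- constant `144` to `288`.
  have d3 : (144 * ((p : ℝ) + 1) ^ 2 * (4 * L ^ 2) * ∑ i, ‖D i i‖ ^ 2) ^ (p + 1)
      ≤ ((144 * (p + 1) ^ 2 * L) ^ 2 * S) ^ (p + 1) := by
    gcongr
    have hp1 : (1 : ℝ) ≤ (p + 1) ^ 2 := one_le_pow₀ (by linarith [Nat.cast_nonneg (α := ℝ) p])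
    have : 0 ≤ ((p : ℝ) + 1) ^ 2 * L ^ 2 := by positivity
    nlinarith
  calc _ ≤ 2 ^ (2 * (p + 1) - 1) * (((144 * (p + 1) ^ 2 * L) ^ 2 * S) ^ (p + 1)
        + ((144 * (p + 1) ^ 2 * L) ^ 2 * S) ^ (p + 1)) := by
        gcongr
        exact d2.trans d3
    _ = 2 ^ (2 * (p + 1) - 1 + 1) * ((144 * (p + 1) ^ 2 * L) ^ 2 * S) ^ (p + 1) := by
      rw [pow_succ (2 : ℝ)]; ring
    _ = _ := by
      have : 2 * (p + 1) - 1 + 1 = 2 * (p + 1) := by omega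
      rw [this, pow_mul, ← mul_pow]; congr 1; ring

/-- Concentration of quadratic forms. -/
lemma measureReal_quadForm_gt_le [IsProbabilityMeasure μ] {κ : Type*} [Fintype κ]
    [DecidableEq κ] {X : κ → Ω → ℂ}
    (hX : iIndepFun X μ) (hXm : ∀ k, Measurable (X k)) (hX0 : ∀ k, ∫ ω, X k ω ∂μ = 0) {p : ℕ}
    (hXI : ∀ k, Integrable (fun ω => ‖X k ω‖ ^ (2 * (p + 1))) μ) {L : ℝ} (hL : 1 ≤ L)
    (hXL : ∀ k, ∫ ω, ‖X k ω‖ ^ (2 * (p + 1)) ∂μ ≤ L ^ (p + 1))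
    (hX2I : ∀ k, Integrable (fun ω => ‖X k ω‖ ^ 2) μ) (hX2 : ∀ k, ∫ ω, ‖X k ω‖ ^ 2 ∂μ = 1)
    (hX4I : ∀ k, Integrable (fun ω => ‖X k ω‖ ^ (4 * (p + 1))) μ)
    (hX4 : ∀ k, ∫ ω, ‖X k ω‖ ^ (4 * (p + 1)) ∂μ ≤ L ^ (2 * (p + 1))) (D : κ → κ → ℂ)
    {l : ℝ} (hl : 0 < l) :
    μ.real {ω | l * √(∑ i, ∑ j, ‖D i j‖ ^ 2)
      < ‖∑ i, ∑ j, D i j * starRingEnd ℂ (X i ω) * X j ω - ∑ i, D i i‖}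
      ≤ (288 * (p + 1) ^ 2 * L / l) ^ (2 * (p + 1)) := by
  obtain ⟨h1, h2⟩ := integral_norm_quadForm_sub_pow_le hX hXm hX0 hXI hL hXL hX2I hX2 hX4I hX4 D
  set S := ∑ i, ∑ j, ‖D i j‖ ^ 2 with hS
  have hS0 : 0 ≤ S := Finset.sum_nonneg fun i _ => Finset.sum_nonneg fun j _ => by positivity
  set Q : Ω → ℂ := fun ω => ∑ i, ∑ j, D i j * starRingEnd ℂ (X i ω) * X j ω - ∑ i, D i i with hQ
  rcases hS0.eq_or_lt with h0 | hpos
  · have hD : ∀ i j, D i j = 0 := by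
      intro i j
      have h3 := (Finset.sum_eq_zero_iff_of_nonneg (fun i _ => Finset.sum_nonneg
        fun j _ => by positivity)).mp h0.symm i (Finset.mem_univ i)
      have h4 := (Finset.sum_eq_zero_iff_of_nonneg (fun j _ => by positivity)).mp h3 j
        (Finset.mem_univ j)
      simpa using h4
    have : {ω | l * √S < ‖Q ω‖} = ∅ := by
      ext ω
      simp [hQ, hD, ← h0]
    rw [this, measureReal_empty]
    positivity
  · have hsq : 0 < √S := Real.sqrt_pos.mpr hpos
    have hε : 0 < (l * √S) ^ (2 * (p + 1)) := by positivity
    have hm := mul_meas_ge_le_integral_of_nonneg (μ := μ) (.of_forall fun ω => by positivity) h1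
      ((l * √S) ^ (2 * (p + 1)))
    have hsub : μ.real {ω | l * √S < ‖Q ω‖}
        ≤ μ.real {ω | (l * √S) ^ (2 * (p + 1)) ≤ ‖Q ω‖ ^ (2 * (p + 1))} := by
      refine measureReal_mono fun ω hω => ?_
      have h' : l * √S < ‖Q ω‖ := hω
      exact pow_le_pow_left₀ (by positivity) h'.le _
    rw [div_pow, le_div_iff₀ (by positivity)]
    have h3 := (mul_le_mul_of_nonneg_left hsub hε.le).trans (hm.trans h2)
    have e : ((288 * ((p : ℝ) + 1) ^ 2 * L) ^ 2 * S) ^ (p + 1)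
        = (288 * (p + 1) ^ 2 * L) ^ (2 * (p + 1)) * √S ^ (2 * (p + 1)) := by
      rw [mul_pow, ← pow_mul, pow_mul √S, Real.sq_sqrt hS0]
    rw [e] at h3
    have h5 : 0 < √S ^ (2 * (p + 1)) := by positivity
    refine le_of_mul_le_mul_right ?_ h5
    refine le_trans (le_of_eq ?_) h3
    rw [mul_pow]
    ring

/-- A bound on a random set for every value of an independent variable. -/
lemma measureReal_le_of_indepFun [IsProbabilityMeasure μ] {α β : Type*} [MeasurableSpace α]
    [MeasurableSpace β] {X : Ω → α} {Y : Ω → β} (hX : Measurable X) (hY : Measurable Y)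
    (hind : IndepFun X Y μ) {s : Set (α × β)} (hs : MeasurableSet s) {δ : ℝ} (hδ : 0 ≤ δ)
    (h : ∀ y, μ.real {ω | (X ω, y) ∈ s} ≤ δ) : μ.real {ω | (X ω, Y ω) ∈ s} ≤ δ := by
  have h1 : μ {ω | (X ω, Y ω) ∈ s} ≤ ENNReal.ofReal δ := by
    have h2 : μ {ω | (X ω, Y ω) ∈ s} = (μ.map fun ω => (X ω, Y ω)) s :=
      (Measure.map_apply (hX.prodMk hY) hs).symm
    have := Measure.isProbabilityMeasure_map (μ := μ) hX.aemeasurable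
    have := Measure.isProbabilityMeasure_map (μ := μ) hY.aemeasurable
    rw [h2, (indepFun_iff_map_prod_eq_prod_map_map hX.aemeasurable hY.aemeasurable).mp hind,
      Measure.prod_apply_symm hs]
    calc _ ≤ ∫⁻ _, ENNReal.ofReal δ ∂(μ.map Y) := by
          refine lintegral_mono fun y => ?_
          rw [Measure.map_apply hX (measurable_prodMk_right hs)]
          have := h y
          rwa [Measure.real, ← ENNReal.le_ofReal_iff_toReal_le (measure_ne_top _ _) hδ] at this
      _ = _ := by simp
  rw [Measure.real]
  exact ENNReal.toReal_le_of_le_ofReal hδ h1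

end Forms

/-! ### Moments from stretched exponential tails. -/

section Tails

variable {Ω : Type*} [MeasurableSpace Ω] {μ : Measure Ω}

/-- The bound on the exponential moment produced by the tail condition with threshold `C'`. -/
noncomputable def expMomentConst (C' : ℝ) : ℝ :=
  Real.exp (1 / 2 + C') * (1 - Real.exp (-(1 / 2)))⁻¹

lemma one_le_expMomentConst {C' : ℝ} (hC' : 0 ≤ C') : 1 ≤ expMomentConst C' := by
  have h1 : 1 ≤ Real.exp (1 / 2 + C') := Real.one_le_exp (by linarith)
  have h2 : Real.exp (-(1 / 2)) < 1 := Real.exp_lt_one_iff.mpr (by norm_num)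
  have h3 : 1 ≤ (1 - Real.exp (-(1 / 2)))⁻¹ :=
    (one_le_inv₀ (by linarith)).mpr (by linarith [Real.exp_pos (-(1 / 2))])
  exact one_le_mul_of_one_le_of_one_le h1 h3

/-- Slice `u = ‖ξ‖ ^ (1/C)` at integers: `exp (u/2)` is at most the sum over `j ≤ u` of `exp
((j+1)/2)`, and `u ≥ j` has probability at most `exp (C' - j)`, trivially so for `j < C'`. The
result is a geometric series. -/
lemma lintegral_exp_half_rpow_le [IsProbabilityMeasure μ] {ξ : Ω → ℂ} (hξ : Measurable ξ)
    {C C' : ℝ} (hC : 0 < C) (hC' : 0 ≤ C')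
    (htail : ∀ t : ℝ, C' ≤ t → μ.real {ω | t ^ C ≤ ‖ξ ω‖} ≤ Real.exp (-t)) :
    ∫⁻ ω, ENNReal.ofReal (Real.exp (‖ξ ω‖ ^ C⁻¹ / 2)) ∂μ ≤ ENNReal.ofReal (expMomentConst C') := by
  have hum : Measurable fun ω => ‖ξ ω‖ ^ C⁻¹ := hξ.norm.pow_const _
  have hset : ∀ j : ℕ, MeasurableSet {ω | (j : ℝ) ≤ ‖ξ ω‖ ^ C⁻¹} := fun j =>
    measurableSet_le measurable_const hum
  have hprob : ∀ j : ℕ, μ {ω | (j : ℝ) ≤ ‖ξ ω‖ ^ C⁻¹} ≤ ENNReal.ofReal (Real.exp (C' - j)) := by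
    intro j
    by_cases hj : C' ≤ j
    · have h1 : {ω | (j : ℝ) ≤ ‖ξ ω‖ ^ C⁻¹} ⊆ {ω | (j : ℝ) ^ C ≤ ‖ξ ω‖} := by
        intro ω hω
        have hω' : (j : ℝ) ≤ ‖ξ ω‖ ^ C⁻¹ := hω
        have := Real.rpow_le_rpow (Nat.cast_nonneg j) hω' hC.le
        rwa [← Real.rpow_mul (norm_nonneg _), inv_mul_cancel₀ hC.ne', Real.rpow_one] at this
      refine (measure_mono h1).trans ?_
      rw [ENNReal.le_ofReal_iff_toReal_le (measure_ne_top _ _) (Real.exp_pos _).le]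
      refine (htail j hj).trans (Real.exp_le_exp.mpr ?_)
      linarith
    · refine prob_le_one.trans ?_
      rw [← ENNReal.ofReal_one]
      refine ENNReal.ofReal_le_ofReal (Real.one_le_exp ?_)
      push Not at hj
      linarith
  have hpt : ∀ ω, ENNReal.ofReal (Real.exp (‖ξ ω‖ ^ C⁻¹ / 2)) ≤
      ∑' j : ℕ, {ω | (j : ℝ) ≤ ‖ξ ω‖ ^ C⁻¹}.indicator
        (fun _ => ENNReal.ofReal (Real.exp ((j + 1) / 2))) ω := by
    intro ω
    refine le_trans ?_ (ENNReal.le_tsum ⌊‖ξ ω‖ ^ C⁻¹⌋₊)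
    have h0 : 0 ≤ ‖ξ ω‖ ^ C⁻¹ := by positivity
    rw [Set.indicator_of_mem (by exact Nat.floor_le h0)]
    refine ENNReal.ofReal_le_ofReal (Real.exp_le_exp.mpr ?_)
    have := (Nat.lt_floor_add_one (‖ξ ω‖ ^ C⁻¹)).le
    linarith
  have hr0 : 0 ≤ Real.exp (-(1 / 2)) := (Real.exp_pos _).le
  have hr1 : Real.exp (-(1 / 2)) < 1 := Real.exp_lt_one_iff.mpr (by norm_num)
  have hgeo := (hasSum_geometric_of_lt_one hr0 hr1).mul_left (Real.exp (1 / 2 + C'))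
  calc _ ≤ ∫⁻ ω, ∑' j : ℕ, {ω | (j : ℝ) ≤ ‖ξ ω‖ ^ C⁻¹}.indicator
        (fun _ => ENNReal.ofReal (Real.exp ((j + 1) / 2))) ω ∂μ := lintegral_mono hpt
    _ = ∑' j : ℕ, ENNReal.ofReal (Real.exp ((j + 1) / 2)) * μ {ω | (j : ℝ) ≤ ‖ξ ω‖ ^ C⁻¹} := by
      rw [lintegral_tsum fun j => (measurable_const.indicator (hset j)).aemeasurable]
      simp_rw [lintegral_indicator_const (hset _)]
    _ ≤ ∑' j : ℕ, ENNReal.ofReal (Real.exp (1 / 2 + C') * Real.exp (-(1 / 2)) ^ j) := by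
      refine ENNReal.tsum_le_tsum fun j => ?_
      calc _ ≤ ENNReal.ofReal (Real.exp ((j + 1) / 2)) * ENNReal.ofReal (Real.exp (C' - j)) := by
            gcongr; exact hprob j
        _ = _ := by
          rw [← ENNReal.ofReal_mul (Real.exp_pos _).le, ← Real.exp_add, ← Real.exp_nat_mul,
            ← Real.exp_add]
          congr 2; ring
    _ = ENNReal.ofReal (expMomentConst C') := by
      rw [← ENNReal.ofReal_tsum_of_nonneg (fun j => by positivity) hgeo.summable, hgeo.tsum_eq]
      rfl

/-- Moments of variables with stretched exponential tails. -/
lemma integral_norm_pow_le_of_tail [IsProbabilityMeasure μ] {ξ : Ω → ℂ} (hξ : Measurable ξ)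
    {C C' : ℝ} (hC : 0 < C) (hC' : 0 ≤ C')
    (htail : ∀ t : ℝ, C' ≤ t → μ.real {ω | t ^ C ≤ ‖ξ ω‖} ≤ Real.exp (-t)) {q : ℕ} (hq : 0 < q) :
    Integrable (fun ω => ‖ξ ω‖ ^ q) μ ∧
      ∫ ω, ‖ξ ω‖ ^ q ∂μ ≤ expMomentConst C' * (2 * C * q) ^ (C * q) := by
  have hq0 : (0 : ℝ) < q := by exact_mod_cast hq
  have hexp := lintegral_exp_half_rpow_le hξ hC hC' htail
  have hum : Measurable fun ω => Real.exp (‖ξ ω‖ ^ C⁻¹ / 2) :=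
    ((hξ.norm.pow_const _).div_const 2).exp
  have hei : Integrable (fun ω => Real.exp (‖ξ ω‖ ^ C⁻¹ / 2)) μ := by
    refine ⟨hum.aestronglyMeasurable, ?_⟩
    rw [hasFiniteIntegral_iff_ofReal (.of_forall fun ω => (Real.exp_pos _).le)]
    exact hexp.trans_lt ENNReal.ofReal_lt_top
  have hei2 : ∫ ω, Real.exp (‖ξ ω‖ ^ C⁻¹ / 2) ∂μ ≤ expMomentConst C' := by
    rw [integral_eq_lintegral_of_nonneg_ae (.of_forall fun ω => (Real.exp_pos _).le)
      hum.aestronglyMeasurable]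
    refine ENNReal.toReal_le_of_le_ofReal ?_ hexp
    have : Real.exp (-(1 / 2)) < 1 := Real.exp_lt_one_iff.mpr (by norm_num)
    have : 0 < 1 - Real.exp (-(1 / 2)) := by linarith
    rw [expMomentConst]
    positivity
  -- From `x ≤ exp x` at `x = u / (2 C q)`, raised to the power `C q`.
  have hpt : ∀ ω, ‖ξ ω‖ ^ q ≤ (2 * C * q) ^ (C * q) * Real.exp (‖ξ ω‖ ^ C⁻¹ / 2) := by
    intro ω
    set u := ‖ξ ω‖ ^ C⁻¹ with hu
    have hu0 : 0 ≤ u := by positivity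
    have h1 : ‖ξ ω‖ ^ q = u ^ (C * q) := by
      rw [hu, ← Real.rpow_mul (norm_nonneg _), inv_mul_cancel_left₀ hC.ne', Real.rpow_natCast]
    have h2 : u = (2 * C * q) * (u / (2 * C * q)) := by field_simp
    have h3 : u / (2 * C * q) ≤ Real.exp (u / (2 * C * q)) := by
      linarith [Real.add_one_le_exp (u / (2 * C * q))]
    rw [h1]
    nth_rewrite 1 [h2]
    rw [Real.mul_rpow (by positivity) (by positivity)]
    gcongr
    calc (u / (2 * C * q)) ^ (C * q) ≤ (Real.exp (u / (2 * C * q))) ^ (C * q) := by gcongr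
      _ = Real.exp (u / 2) := by
        rw [← Real.exp_mul]; congr 1; field_simp
  have hdom := hei.const_mul ((2 * C * q) ^ (C * q))
  have hint : Integrable (fun ω => ‖ξ ω‖ ^ q) μ :=
    Integrable.mono' hdom (hξ.norm.pow_const _).aestronglyMeasurable
      (.of_forall fun ω => by rw [norm_pow, norm_norm]; exact hpt ω)
  refine ⟨hint, (integral_mono hint hdom hpt).trans ?_⟩
  rw [integral_const_mul, mul_comm]
  gcongr

/-- A constant `D` such that `2 P`-th moments are at most `(D * P ^ (2 * C)) ^ P`. -/
noncomputable def momentConst (C C' : ℝ) : ℝ := expMomentConst C' * (1 + 8 * C) ^ (2 * C)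

/-- The quadratic form estimate needs moments of orders `2 P` and `4 P` with one common parameter
`L`; these are `c = 1` and `c = 2`. -/
lemma integral_norm_pow_le_momentConst [IsProbabilityMeasure μ] {ξ : Ω → ℂ} (hξ : Measurable ξ)
    {C C' : ℝ} (hC : 0 < C) (hC' : 0 ≤ C')
    (htail : ∀ t : ℝ, C' ≤ t → μ.real {ω | t ^ C ≤ ‖ξ ω‖} ≤ Real.exp (-t)) {P : ℕ} (hP : 1 ≤ P)
    {c : ℕ} (hc : c = 1 ∨ c = 2) :
    ∫ ω, ‖ξ ω‖ ^ (2 * c * P) ∂μ ≤ (momentConst C C' * (P : ℝ) ^ (2 * C)) ^ (c * P) := by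
  have hP0 : (1 : ℝ) ≤ P := by exact_mod_cast hP
  have hc1 : 1 ≤ c := by omega
  have hc2 : (c : ℝ) ≤ 2 := by exact_mod_cast (by omega : c ≤ 2)
  have hcP : 1 ≤ c * P := Nat.mul_pos hc1 hP
  refine (integral_norm_pow_le_of_tail hξ hC hC' htail (q := 2 * c * P) (by
    rw [mul_assoc]; omega)).2.trans ?_
  have hD := one_le_expMomentConst hC'
  have h1 : (2 * C * (2 * c * P : ℕ)) ^ (C * (2 * c * P : ℕ))
      ≤ ((1 + 8 * C) ^ (2 * C) * (P : ℝ) ^ (2 * C)) ^ (c * P) := by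
    rw [← Real.mul_rpow (by positivity) (by positivity), ← Real.rpow_natCast,
      ← Real.rpow_mul (by positivity)]
    push_cast
    have e : C * (2 * c * P) = 2 * C * (c * P) := by ring
    rw [e]
    refine Real.rpow_le_rpow (by positivity) ?_ (by positivity)
    have : C * c * P ≤ C * 2 * P := by gcongr
    nlinarith
  calc _ ≤ expMomentConst C' ^ (c * P) * ((1 + 8 * C) ^ (2 * C) * (P : ℝ) ^ (2 * C)) ^ (c * P) := by
        gcongr
        exact le_self_pow₀ hD (by omega)
    _ = _ := by rw [← mul_pow, momentConst, mul_assoc]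

lemma one_le_momentConst_mul {C C' : ℝ} (hC : 0 < C) (hC' : 0 ≤ C') {P : ℕ} (hP : 1 ≤ P) :
    1 ≤ momentConst C C' * (P : ℝ) ^ (2 * C) := by
  have hP0 : (1 : ℝ) ≤ P := by exact_mod_cast hP
  refine one_le_mul_of_one_le_of_one_le (one_le_mul_of_one_le_of_one_le
    (one_le_expMomentConst hC') ?_) ?_
  · exact Real.one_le_rpow (by linarith) (by positivity)
  · exact Real.one_le_rpow hP0 (by positivity)

end Tails

/-! ### Measurability of resolvent entries through determinants and adjugates. -/

section Measurability

variable {α ι : Type*} [MeasurableSpace α] [Fintype ι] [DecidableEq ι]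

lemma measurable_det {f : α → Matrix ι ι ℂ} (hf : ∀ i j, Measurable fun x => f x i j) :
    Measurable fun x => (f x).det := by
  simp only [Matrix.det_apply]
  exact Finset.measurable_sum _ fun σ _ =>
    (Finset.measurable_prod _ fun i _ => hf _ _).const_smul _

lemma measurable_green {f : α → Matrix ι ι ℂ} (hf : ∀ i j, Measurable fun x => f x i j) (z : ℂ)
    (i j : ι) : Measurable fun x => green (f x) z i j := by
  have hg : ∀ i j, Measurable fun x => (f x - z • (1 : Matrix ι ι ℂ)) i j := fun i j =>
    (hf i j).sub_const _
  simp only [green, Matrix.inv_def, Ring.inverse_eq_inv', Matrix.smul_apply, smul_eq_mul]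
  refine (measurable_det hg).inv.mul ?_
  simp only [Matrix.adjugate_apply]
  refine measurable_det fun k l => ?_
  by_cases hk : k = j
  · simp only [hk, Matrix.updateRow_self]
    exact measurable_const
  · simp only [Matrix.updateRow_ne hk]
    exact hg k l

end Measurability

/-! ### Schur forms of Wigner matrices concentrate at all dyadic scales. -/

section Concentration

variable {Ω : Type*} [MeasurableSpace Ω] {μ : Measure Ω} {n : ℕ}

lemma normalize_apply (M : Matrix (Fin n) (Fin n) ℂ) (i j : Fin n) :
    normalize M i j = ((1 / √n : ℝ) : ℂ) * M i j := rfl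

lemma isHermitian_normalize {M : Matrix (Fin n) (Fin n) ℂ} (hM : M.IsHermitian) :
    (normalize M).IsHermitian := by
  rw [Matrix.IsHermitian, normalize, Matrix.conjTranspose_smul, hM.eq]
  simp

lemma zeroOut_normalize (S : Finset (Fin n)) (M : Matrix (Fin n) (Fin n) ℂ) :
    zeroOut S (normalize M) = normalize (zeroOut S M) := by
  ext i j
  simp only [zeroOut_apply, normalize_apply]
  split_ifs <;> simp

/-- The index of the entry above the diagonal that determines the entries `(i, j)`, `(j, i)`. -/
def upperIndex (i j : Fin n) : {p : Fin n × Fin n // p.1 ≤ p.2} :=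
  if h : i ≤ j then ⟨(i, j), h⟩ else ⟨(j, i), (not_le.mp h).le⟩

lemma upperIndex_of_le {i j : Fin n} (h : i ≤ j) : upperIndex i j = ⟨(i, j), h⟩ := dif_pos h

lemma upperIndex_of_not_le {i j : Fin n} (h : ¬i ≤ j) :
    upperIndex i j = ⟨(j, i), (not_le.mp h).le⟩ := dif_neg h

lemma apply_eq_upperIndex {M : Matrix (Fin n) (Fin n) ℂ} (hM : M.IsHermitian) (i j : Fin n) :
    M i j = if i ≤ j then M (upperIndex i j).1.1 (upperIndex i j).1.2
      else starRingEnd ℂ (M (upperIndex i j).1.1 (upperIndex i j).1.2) := by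
  by_cases h : i ≤ j
  · rw [if_pos h, upperIndex_of_le h]
  · rw [if_neg h, upperIndex_of_not_le h]
    exact (hM.apply i j).symm

/-- The rows of `M` in `S`, outside of `S`. -/
def rowFamily (S : Finset (Fin n)) (M : Ω → Matrix (Fin n) (Fin n) ℂ) (q : S × (Sᶜ : Finset (Fin n)))
    (ω : Ω) : ℂ := M ω q.2 q.1

variable {M : Ω → Matrix (Fin n) (Fin n) ℂ}

lemma rowFamily_eq (S : Finset (Fin n)) (hM : IsWigner M μ) (q : S × (Sᶜ : Finset (Fin n))) :
    rowFamily S M q = fun ω => (if (q.2 : Fin n) ≤ q.1 then id else starRingEnd ℂ)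
      (M ω (upperIndex q.2 q.1).1.1 (upperIndex q.2 q.1).1.2) := by
  funext ω
  rw [rowFamily, apply_eq_upperIndex (hM.hermitian ω)]
  split_ifs <;> rfl

lemma measurable_ite_id_conj (c : Prop) [Decidable c] :
    Measurable (if c then id else starRingEnd ℂ : ℂ → ℂ) := by
  split_ifs
  · exact measurable_id
  · exact Complex.continuous_conj.measurable

/-- One index lies in `S` and the other outside, so no position occurs together with its transpose:
distinct row entries come from distinct independent variables. -/
lemma upperIndex_injective (S : Finset (Fin n)) :
    Function.Injective fun q : S × (Sᶜ : Finset (Fin n)) => upperIndex (q.2 : Fin n) q.1 := by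
  rintro ⟨⟨x, hx⟩, ⟨i, hi⟩⟩ ⟨⟨y, hy⟩, ⟨j, hj⟩⟩ h
  rw [Finset.mem_compl] at hi hj
  simp only [Prod.mk.injEq, Subtype.mk.injEq]
  simp only at h
  by_cases h1 : i ≤ x <;> by_cases h2 : j ≤ y
  · rw [upperIndex_of_le h1, upperIndex_of_le h2] at h
    simp only [Subtype.mk.injEq, Prod.mk.injEq] at h
    exact h.symm
  · rw [upperIndex_of_le h1, upperIndex_of_not_le h2] at h
    simp only [Subtype.mk.injEq, Prod.mk.injEq] at h
    exact absurd hy (h.1 ▸ hi)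
  · rw [upperIndex_of_not_le h1, upperIndex_of_le h2] at h
    simp only [Subtype.mk.injEq, Prod.mk.injEq] at h
    exact absurd hx (h.1 ▸ hj)
  · rw [upperIndex_of_not_le h1, upperIndex_of_not_le h2] at h
    simp only [Subtype.mk.injEq, Prod.mk.injEq] at h
    exact h

lemma iIndepFun_rowFamily (S : Finset (Fin n)) (hM : IsWigner M μ) :
    iIndepFun (rowFamily S M) μ := by
  have h := (hM.indep.precomp (upperIndex_injective S)).comp
    (fun q => (if (q.2 : Fin n) ≤ q.1 then id else starRingEnd ℂ : ℂ → ℂ))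
    fun q => measurable_ite_id_conj _
  have e : rowFamily S M = fun q : S × (Sᶜ : Finset (Fin n)) =>
      (if (q.2 : Fin n) ≤ q.1 then id else starRingEnd ℂ : ℂ → ℂ) ∘
      (fun ω => M ω (upperIndex (q.2 : Fin n) q.1).1.1 (upperIndex (q.2 : Fin n) q.1).1.2) := by
    funext q
    rw [rowFamily_eq S hM q]
    rfl
  rw [e]
  exact h

/-- The rows in `S` are independent of the rest of the matrix. -/
lemma indepFun_rowFamily_zeroOut (S : Finset (Fin n)) (hM : IsWigner M μ) :
    IndepFun (fun ω q => rowFamily S M q ω) (fun ω i j => zeroOut S (M ω) i j) μ := by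
  classical
  -- The upper triangular positions meeting `S` determine the rows, the remaining ones the minor;
  -- the two blocks are independent.
  set T : Finset {p : Fin n × Fin n // p.1 ≤ p.2} :=
    Finset.univ.filter fun p => p.1.1 ∈ S ∨ p.1.2 ∈ S with hT
  have h := hM.indep.indepFun_finset T Tᶜ disjoint_compl_right fun p => hM.measurable _ _
  have hmemT : ∀ q : S × (Sᶜ : Finset (Fin n)), upperIndex (q.2 : Fin n) q.1 ∈ T := by
    intro q
    rw [hT, Finset.mem_filter]
    refine ⟨Finset.mem_univ _, ?_⟩
    by_cases h1 : (q.2 : Fin n) ≤ q.1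
    · rw [upperIndex_of_le h1]; exact Or.inr q.1.2
    · rw [upperIndex_of_not_le h1]; exact Or.inl q.1.2
  have hmemTc : ∀ i j : Fin n, ¬(i ∈ S ∨ j ∈ S) → upperIndex i j ∈ Tᶜ := by
    intro i j hij
    rw [Finset.mem_compl, hT, Finset.mem_filter]
    rintro ⟨-, h2⟩
    by_cases h1 : i ≤ j
    · rw [upperIndex_of_le h1] at h2; exact hij h2
    · rw [upperIndex_of_not_le h1] at h2; exact hij h2.symm
  have h2 := h.comp
    (φ := fun (x : T → ℂ) (q : S × (Sᶜ : Finset (Fin n))) =>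
      (if (q.2 : Fin n) ≤ q.1 then id else starRingEnd ℂ : ℂ → ℂ) (x ⟨_, hmemT q⟩))
    (ψ := fun (y : (Tᶜ : Finset _) → ℂ) (i j : Fin n) => if hij : i ∈ S ∨ j ∈ S then 0 else
      (if i ≤ j then id else starRingEnd ℂ : ℂ → ℂ) (y ⟨_, hmemTc i j hij⟩))
    (measurable_pi_lambda _ fun q => (measurable_ite_id_conj _).comp (measurable_pi_apply _))
    (measurable_pi_lambda _ fun i => measurable_pi_lambda _ fun j => by
      by_cases hij : i ∈ S ∨ j ∈ S
      · simp only [hij, dif_pos]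
        exact measurable_const
      · simp only [hij, dif_neg, not_false_eq_true]
        exact (measurable_ite_id_conj _).comp (measurable_pi_apply _))
  have e1 : (fun ω q => rowFamily S M q ω) = (fun (x : T → ℂ) (q : S × (Sᶜ : Finset (Fin n))) =>
      (if (q.2 : Fin n) ≤ q.1 then id else starRingEnd ℂ : ℂ → ℂ) (x ⟨_, hmemT q⟩)) ∘
      (fun ω (p : T) => M ω p.1.1.1 p.1.1.2) := by
    funext ω q
    rw [rowFamily_eq S hM q]
    rfl
  have e2 : (fun ω i j => zeroOut S (M ω) i j) =
      (fun (y : (Tᶜ : Finset _) → ℂ) (i j : Fin n) => if hij : i ∈ S ∨ j ∈ S then 0 else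
      (if i ≤ j then id else starRingEnd ℂ : ℂ → ℂ) (y ⟨_, hmemTc i j hij⟩)) ∘
      (fun ω (p : (Tᶜ : Finset _)) => M ω p.1.1.1 p.1.1.2) := by
    funext ω i j
    rw [zeroOut_apply, Function.comp_apply]
    by_cases hij : i ∈ S ∨ j ∈ S
    · rw [if_pos hij, dif_pos hij]
    · rw [if_neg hij, dif_neg hij, apply_eq_upperIndex (hM.hermitian ω)]
      split_ifs <;> rfl
  rw [e1, e2]
  exact h2

/-- The coefficients of the Schur complement form in the rows `x`, `w`. -/
def schurCoeff (S : Finset (Fin n)) (G : Fin n → Fin n → ℂ) (x w : Fin n)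
    (q q' : S × (Sᶜ : Finset (Fin n))) : ℂ :=
  if (q.1 : Fin n) = x ∧ (q'.1 : Fin n) = w then G q.2 q'.2 else 0

lemma sum_row_ite {S : Finset (Fin n)} {x : Fin n} (hx : x ∈ S) (f : Fin n → Fin n → ℂ) :
    ∑ q : S × (Sᶜ : Finset (Fin n)), (if (q.1 : Fin n) = x then f q.1 q.2 else 0)
      = ∑ i ∈ Sᶜ, f x i := by
  rw [Fintype.sum_prod_type]
  rw [Finset.sum_coe_sort S (fun a => ∑ i : (Sᶜ : Finset (Fin n)), if a = x then f a i else 0),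
    Finset.sum_eq_single x]
  · simp only [if_true]
    exact Finset.sum_coe_sort Sᶜ (fun i => f x i)
  · intro b _ hb
    simp [hb]
  · exact fun h => absurd hx h

/-- A general `F` vanishing at zero lets one computation serve both the quadratic form and the
Hilbert–Schmidt norm. -/
lemma sum_schurCoeff {S : Finset (Fin n)} {x w : Fin n} (hx : x ∈ S) (hw : w ∈ S)
    (G : Fin n → Fin n → ℂ) (F : Fin n → Fin n → Fin n → Fin n → ℂ → ℂ)
    (hF : ∀ a i b j, F a i b j 0 = 0) :
    ∑ q : S × (Sᶜ : Finset (Fin n)), ∑ q' : S × (Sᶜ : Finset (Fin n)),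
      F q.1 q.2 q'.1 q'.2 (schurCoeff S G x w q q') = ∑ i ∈ Sᶜ, ∑ j ∈ Sᶜ, F x i w j (G i j) := by
  have h : ∀ q : S × (Sᶜ : Finset (Fin n)), ∑ q' : S × (Sᶜ : Finset (Fin n)),
      F q.1 q.2 q'.1 q'.2 (schurCoeff S G x w q q')
      = if (q.1 : Fin n) = x then ∑ j ∈ Sᶜ, F q.1 q.2 w j (G q.2 j) else 0 := by
    intro q
    by_cases hq : (q.1 : Fin n) = x
    · rw [if_pos hq, ← sum_row_ite hw (fun b j => F q.1 q.2 b j (G q.2 j))]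
      refine Finset.sum_congr rfl fun q' _ => ?_
      by_cases hq' : (q'.1 : Fin n) = w
      · rw [schurCoeff, if_pos ⟨hq, hq'⟩, if_pos hq']
      · rw [schurCoeff, if_neg (fun h => hq' h.2), if_neg hq', hF]
    · rw [if_neg hq]
      exact Finset.sum_eq_zero fun q' _ => by
        rw [schurCoeff, if_neg (fun h => hq h.1), hF]
  simp_rw [h]
  rw [sum_row_ite hx (fun a i => ∑ j ∈ Sᶜ, F a i w j (G i j))]

lemma sum_schurCoeff_diag {S : Finset (Fin n)} {x w : Fin n} (hx : x ∈ S)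
    (G : Fin n → Fin n → ℂ) :
    ∑ q : S × (Sᶜ : Finset (Fin n)), schurCoeff S G x w q q
      = if x = w then ∑ i ∈ Sᶜ, G i i else 0 := by
  by_cases h : x = w
  · subst h
    rw [if_pos rfl, ← sum_row_ite hx (fun _ i => G i i)]
    exact Finset.sum_congr rfl fun q _ => by simp [schurCoeff]
  · rw [if_neg h]
    exact Finset.sum_eq_zero fun q _ => if_neg fun h' => h (h'.1.symm.trans h'.2)

/-- Hermitian symmetry writes row `x` as the conjugate of column `x`, which gives the shape `D i j *
conj (X i) * X j` of the quadratic form estimates. -/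
lemma schurForm_normalize (S : Finset (Fin n)) {N : Matrix (Fin n) (Fin n) ℂ} (hN : N.IsHermitian)
    (z : ℂ) (x w : Fin n) :
    schurForm S (normalize N) z x w = (1 / n : ℂ) * ∑ i ∈ Sᶜ, ∑ j ∈ Sᶜ,
      green (normalize (zeroOut S N)) z i j * starRingEnd ℂ (N i x) * N j w := by
  have hs : ((1 / √n : ℝ) : ℂ) * ((1 / √n : ℝ) : ℂ) = 1 / n := by
    rw [← Complex.ofReal_mul, ← sq, div_pow, one_pow, Real.sq_sqrt (Nat.cast_nonneg n)]
    push_cast; rfl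
  rw [schurForm, Finset.mul_sum]
  refine Finset.sum_congr rfl fun i _ => ?_
  rw [Finset.mul_sum]
  refine Finset.sum_congr rfl fun j _ => ?_
  rw [normalize_apply, normalize_apply, zeroOut_normalize, ← hs, ← hN.apply x i, ← starRingEnd_apply]
  ring

/-- The Schur complement forms concentrate. -/
lemma measureReal_schurForm_gt_le [IsProbabilityMeasure μ] (hn : 1 ≤ n) (hM : IsWigner M μ)
    {C C' : ℝ} (hC : 0 < C) (hC' : 0 ≤ C') (hexp : ExpDecay M μ C C') {P : ℕ} (hP : 1 ≤ P)
    {l : ℝ} (hl : 0 < l) (z : ℂ) {S : Finset (Fin n)} {x w : Fin n} (hx : x ∈ S) (hw : w ∈ S) :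
    μ.real {ω | l / n * √(∑ i, ∑ j, ‖green (zeroOut S (normalize (M ω))) z i j‖ ^ 2)
      < ‖schurForm S (normalize (M ω)) z x w - if x = w then
        (1 / n : ℂ) * ∑ i ∈ Sᶜ, green (zeroOut S (normalize (M ω))) z i i else 0‖}
      ≤ (288 * (P : ℝ) ^ 2 * (momentConst C C' * (P : ℝ) ^ (2 * C)) / l) ^ (2 * P) := by
  obtain ⟨p, rfl⟩ : ∃ p, P = p + 1 := ⟨P - 1, by omega⟩
  have hn0 : (0 : ℝ) < n := by exact_mod_cast hn
  set L := momentConst C C' * ((p + 1 : ℕ) : ℝ) ^ (2 * C) with hL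
  have hL1 : 1 ≤ L := one_le_momentConst_mul hC hC' hP
  set X := rowFamily S M with hX
  have hXm : ∀ q, Measurable (X q) := fun q => hM.measurable _ _
  have hXi : iIndepFun X μ := iIndepFun_rowFamily S hM
  have hne : ∀ q : S × (Sᶜ : Finset (Fin n)), (q.2 : Fin n) ≠ q.1 := fun q h =>
    Finset.mem_compl.mp q.2.2 (h ▸ q.1.2)
  have hX2 : ∀ q, ∫ ω, ‖X q ω‖ ^ 2 ∂μ = 1 := by
    intro q
    rcases lt_or_gt_of_ne (hne q) with h | h
    · exact hM.variance_offDiag _ _ h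
    · rw [← hM.variance_offDiag _ _ h]
      refine integral_congr_ae (.of_forall fun ω => ?_)
      simp only [hX, rowFamily]
      rw [← (hM.hermitian ω).apply, norm_star]
  have hXI : ∀ q (r : ℕ), 0 < r → Integrable (fun ω => ‖X q ω‖ ^ r) μ := fun q r hr =>
    (integral_norm_pow_le_of_tail (hXm q) hC hC' (hexp _ _) hr).1
  have hXL : ∀ q, ∫ ω, ‖X q ω‖ ^ (2 * (p + 1)) ∂μ ≤ L ^ (p + 1) := fun q => by
    simpa [hL] using integral_norm_pow_le_momentConst (hXm q) hC hC' (hexp _ _) hP (c := 1) (Or.inl rfl)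
  have hXL4 : ∀ q, ∫ ω, ‖X q ω‖ ^ (4 * (p + 1)) ∂μ ≤ L ^ (2 * (p + 1)) := fun q =>
    integral_norm_pow_le_momentConst (hXm q) hC hC' (hexp _ _) hP (c := 2) (Or.inr rfl)
  -- The minor's resolvent as a function of a frozen minor: the quadratic form bound holds for every
  -- deterministic `N`, and independence then permits substituting the random minor.
  set G : (Fin n → Fin n → ℂ) → Fin n → Fin n → ℂ := fun N => green (normalize (Matrix.of N)) z
    with hG
  have hGm : ∀ i j, Measurable fun N => G N i j := fun i j => by
    refine measurable_green (fun i j => ?_) z i j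
    simp only [normalize_apply, Matrix.of_apply]
    fun_prop
  have hDm : ∀ q q', Measurable fun N => schurCoeff S (G N) x w q q' := by
    intro q q'
    simp only [schurCoeff]
    split_ifs
    · exact hGm _ _
    · exact measurable_const
  set s : Set ((S × (Sᶜ : Finset (Fin n)) → ℂ) × (Fin n → Fin n → ℂ)) :=
    {y | l * √(∑ q, ∑ q', ‖schurCoeff S (G y.2) x w q q'‖ ^ 2)
      < ‖∑ q, ∑ q', schurCoeff S (G y.2) x w q q' * starRingEnd ℂ (y.1 q) * y.1 q'
        - ∑ q, schurCoeff S (G y.2) x w q q‖} with hs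
  have hsm : MeasurableSet s := by
    have h1 : ∀ q q', Measurable fun y : (S × (Sᶜ : Finset (Fin n)) → ℂ) × (Fin n → Fin n → ℂ) =>
        schurCoeff S (G y.2) x w q q' := fun q q' => (hDm q q').comp measurable_snd
    have h2 : ∀ q, Measurable fun y : (S × (Sᶜ : Finset (Fin n)) → ℂ) × (Fin n → Fin n → ℂ) =>
        y.1 q := fun q => (measurable_pi_apply q).comp measurable_fst
    refine measurableSet_lt ?_ ?_
    · exact (Measurable.sqrt (Finset.measurable_sum _ fun q _ => Finset.measurable_sum _ fun q' _ =>
        (h1 q q').norm.pow_const 2)).const_mul l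
    · refine Measurable.norm (Measurable.sub (Finset.measurable_sum _ fun q _ =>
        Finset.measurable_sum _ fun q' _ => ?_) (Finset.measurable_sum _ fun q _ => h1 q q))
      exact ((h1 q q').mul (Complex.continuous_conj.measurable.comp (h2 q))).mul (h2 q')
  have hmain := measureReal_le_of_indepFun (μ := μ) (X := fun ω q => X q ω)
    (Y := fun ω i j => zeroOut S (M ω) i j) (measurable_pi_lambda _ hXm)
    (measurable_pi_lambda _ fun i => measurable_pi_lambda _ fun j => by
      simp only [zeroOut_apply]
      split_ifs
      · exact measurable_const
      · exact hM.measurable i j) (indepFun_rowFamily_zeroOut S hM) hsm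
    (δ := (288 * ((p + 1 : ℕ) : ℝ) ^ 2 * L / l) ^ (2 * (p + 1))) (by positivity)
    (fun N => by
      have h := measureReal_quadForm_gt_le hXi hXm (fun q => hM.mean_zero _ _)
        (fun q => hXI q (2 * (p + 1)) (by omega)) hL1 hXL (fun q => hXI q 2 (by omega)) hX2
        (fun q => hXI q (4 * (p + 1)) (by omega)) hXL4 (schurCoeff S (G N) x w) hl
      push_cast
      exact h)
  refine le_trans (measureReal_mono fun ω hω => ?_) hmain
  have hω' : l / n * √(∑ i, ∑ j, ‖green (zeroOut S (normalize (M ω))) z i j‖ ^ 2)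
      < ‖schurForm S (normalize (M ω)) z x w - if x = w then
        (1 / n : ℂ) * ∑ i ∈ Sᶜ, green (zeroOut S (normalize (M ω))) z i i else 0‖ := hω
  set N : Fin n → Fin n → ℂ := fun i j => zeroOut S (M ω) i j with hN
  have hGN : ∀ i j, green (zeroOut S (normalize (M ω))) z i j = G N i j := fun i j => by
    rw [zeroOut_normalize]; rfl
  change l * √(∑ q, ∑ q', ‖schurCoeff S (G N) x w q q'‖ ^ 2)
      < ‖∑ q, ∑ q', schurCoeff S (G N) x w q q' * starRingEnd ℂ (X q ω) * X q' ω
        - ∑ q, schurCoeff S (G N) x w q q‖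
  have e1 : ∑ q, ∑ q', schurCoeff S (G N) x w q q' * starRingEnd ℂ (X q ω) * X q' ω
      = ∑ i ∈ Sᶜ, ∑ j ∈ Sᶜ, G N i j * starRingEnd ℂ (M ω i x) * M ω j w :=
    sum_schurCoeff hx hw (G N) (fun a i b j c => c * starRingEnd ℂ (M ω i a) * M ω j b)
      (fun _ _ _ _ => by simp)
  have e2 : ∑ q, ∑ q', ‖schurCoeff S (G N) x w q q'‖ ^ 2 ≤ ∑ i, ∑ j, ‖G N i j‖ ^ 2 := by
    have h := sum_schurCoeff hx hw (G N) (fun _ _ _ _ c => ((‖c‖ ^ 2 : ℝ) : ℂ)) (by simp)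
    have h' : ∑ q, ∑ q', ‖schurCoeff S (G N) x w q q'‖ ^ 2
        = ∑ i ∈ Sᶜ, ∑ j ∈ Sᶜ, ‖G N i j‖ ^ 2 := by exact_mod_cast h
    rw [h']
    refine (Finset.sum_le_sum_of_subset_of_nonneg (Finset.subset_univ _) fun i _ _ =>
      Finset.sum_nonneg fun j _ => by positivity).trans ?_
    exact Finset.sum_le_sum fun i _ => Finset.sum_le_sum_of_subset_of_nonneg
      (Finset.subset_univ _) fun j _ _ => by positivity
  rw [e1, sum_schurCoeff_diag hx]
  rw [schurForm_normalize S (hM.hermitian ω), ← zeroOut_normalize] at hω'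
  simp only [hGN] at hω'
  have e3 : (1 / n : ℂ) * ∑ i ∈ Sᶜ, ∑ j ∈ Sᶜ, G N i j * starRingEnd ℂ (M ω i x) * M ω j w
      - (if x = w then (1 / n : ℂ) * ∑ i ∈ Sᶜ, G N i i else 0)
      = (1 / n : ℂ) * (∑ i ∈ Sᶜ, ∑ j ∈ Sᶜ, G N i j * starRingEnd ℂ (M ω i x) * M ω j w
        - (if x = w then ∑ i ∈ Sᶜ, G N i i else 0)) := by
    split_ifs <;> ring
  rw [e3, norm_mul] at hω'
  have h8 : ‖(1 / n : ℂ)‖ = 1 / n := by simp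
  rw [h8, one_div_mul_eq_div, div_mul_eq_mul_div, div_lt_div_iff_of_pos_right hn0] at hω'
  refine lt_of_le_of_lt ?_ hω'
  gcongr

/-- With overwhelming probability a normalized Wigner matrix is concentrated at all dyadic scales. -/
lemma measureReal_not_concentrated_le [IsProbabilityMeasure μ] (hn : 1 ≤ n) (hM : IsWigner M μ)
    {C C' : ℝ} (hC : 0 < C) (hC' : 0 ≤ C') (hexp : ExpDecay M μ C C') {P : ℕ} (hP : 1 ≤ P)
    {l r δ : ℝ} (hl : 0 < l) (hr : ∀ i j, μ.real {ω | r < ‖normalize (M ω) i j‖} ≤ δ) (E η : ℝ) :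
    μ.real {ω | ¬∀ k < n, Concentrated (normalize (M ω)) ⟨E, 2 ^ k * η⟩ l r}
      ≤ (n : ℝ) ^ 5 * (δ +
        (288 * (P : ℝ) ^ 2 * (momentConst C C' * (P : ℝ) ^ (2 * C)) / l) ^ (2 * P)) := by
  set δ' := (288 * (P : ℝ) ^ 2 * (momentConst C C' * (P : ℝ) ^ (2 * C)) / l) ^ (2 * P) with hδ'
  have hδ0' : 0 ≤ δ' := by
    have := one_le_momentConst_mul hC hC' hP
    positivity
  -- Indexed by the scale and by `a, b, x, w`: the union bound costs `n ^ 5`, and tuples with `x` or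
  -- `w` outside `{a, b}` give the empty event.
  set bad : Fin n × Fin n × Fin n × Fin n × Fin n → Set Ω := fun t =>
    {ω | t.2.2.2.1 ∈ ({t.2.1, t.2.2.1} : Finset (Fin n)) ∧
      t.2.2.2.2 ∈ ({t.2.1, t.2.2.1} : Finset (Fin n)) ∧
      ¬(‖normalize (M ω) t.2.2.2.1 t.2.2.2.2‖ ≤ r ∧
      ‖schurForm {t.2.1, t.2.2.1} (normalize (M ω)) ⟨E, 2 ^ (t.1 : ℕ) * η⟩ t.2.2.2.1 t.2.2.2.2
        - if t.2.2.2.1 = t.2.2.2.2 then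
        (1 / n : ℂ) * ∑ i ∈ ({t.2.1, t.2.2.1} : Finset (Fin n))ᶜ,
          green (zeroOut {t.2.1, t.2.2.1} (normalize (M ω))) ⟨E, 2 ^ (t.1 : ℕ) * η⟩ i i else 0‖
      ≤ l / n * √(∑ i, ∑ j, ‖green (zeroOut {t.2.1, t.2.2.1} (normalize (M ω)))
        ⟨E, 2 ^ (t.1 : ℕ) * η⟩ i j‖ ^ 2))} with hbad
  have hsub : {ω | ¬∀ k < n, Concentrated (normalize (M ω)) ⟨E, 2 ^ k * η⟩ l r} ⊆ ⋃ t, bad t := by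
    intro ω hω
    rw [Set.mem_ofPred_eq] at hω
    simp only [Concentrated] at hω
    push Not at hω
    obtain ⟨k, hk, a, b, x, w, hx, hw, h⟩ := hω
    refine Set.mem_iUnion.mpr ⟨(⟨k, hk⟩, a, b, x, w), hx, hw, fun h' => ?_⟩
    exact absurd h'.2 (not_le.mpr (h h'.1))
  have hbound : ∀ t, μ.real (bad t) ≤ δ + δ' := by
    rintro ⟨k, a, b, x, w⟩
    by_cases hx : x ∈ ({a, b} : Finset (Fin n))
    swap
    · have : bad (k, a, b, x, w) = ∅ := by
        ext ω; simp only [hbad, Set.mem_ofPred_eq, hx, false_and, Set.mem_empty_iff_false]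
      rw [this, measureReal_empty]
      exact add_nonneg (measureReal_nonneg.trans (hr x x)) hδ0'
    by_cases hw : w ∈ ({a, b} : Finset (Fin n))
    swap
    · have : bad (k, a, b, x, w) = ∅ := by
        ext ω; simp only [hbad, Set.mem_ofPred_eq, hw, false_and, and_false, Set.mem_empty_iff_false]
      rw [this, measureReal_empty]
      exact add_nonneg (measureReal_nonneg.trans (hr x x)) hδ0'
    have h1 := hr x w
    have h2 := measureReal_schurForm_gt_le hn hM hC hC' hexp hP hl ⟨E, 2 ^ (k : ℕ) * η⟩ hx hw
    refine le_trans (measureReal_mono ?_) ((measureReal_union_le _ _).trans (add_le_add h1 h2))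
    rintro ω ⟨-, -, h⟩
    rcases not_and_or.mp h with h | h
    · exact Or.inl (not_le.mp h)
    · exact Or.inr (not_le.mp h)
  calc _ ≤ μ.real (⋃ t, bad t) := measureReal_mono hsub
    _ ≤ ∑ t, μ.real (bad t) := measureReal_iUnion_fintype_le _
    _ ≤ ∑ _t : Fin n × Fin n × Fin n × Fin n × Fin n, (δ + δ') :=
      Finset.sum_le_sum fun t _ => hbound t
    _ = _ := by
      simp only [Finset.sum_const, Finset.card_univ, Fintype.card_prod, Fintype.card_fin, nsmul_eq_mul]
      push_cast
      ring

end Concentration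

/-! ### Crude bounds for the semicircle transform and the deviation. -/

section Deviation

/-- The density is at most `1 / π` on an interval of length `4`, and `4 / π ≤ 2`. Nothing finer
about the semicircle law enters the proof. -/
lemma norm_stieltjesSC_le {z : ℂ} (hz : 0 < z.im) : ‖stieltjesSC z‖ ≤ 2 / z.im := by
  have hpi := Real.pi_gt_three
  have hpt : ∀ x : ℝ, ‖1 / ((x : ℂ) - z) * (rhoSC x : ℂ)‖
      ≤ (Set.Icc (-2 : ℝ) 2).indicator (fun _ => 1 / z.im * (1 / Real.pi)) x := by
    intro x
    have h1 : ‖1 / ((x : ℂ) - z)‖ ≤ 1 / z.im := by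
      rw [norm_div, norm_one]
      refine one_div_le_one_div_of_le hz ?_
      have := Complex.abs_im_le_norm ((x : ℂ) - z)
      simp only [Complex.sub_im, Complex.ofReal_im, zero_sub, abs_neg, abs_of_pos hz] at this
      exact this
    by_cases hx : x ∈ Set.Icc (-2 : ℝ) 2
    · rw [Set.indicator_of_mem hx, norm_mul]
      gcongr
      rw [Complex.norm_real, Real.norm_eq_abs, rhoSC, abs_of_nonneg (by positivity)]
      have h2 : √(max (4 - x ^ 2) 0) ≤ 2 := by
        rw [Real.sqrt_le_left (by norm_num)]
        refine max_le ?_ ?_ <;> nlinarith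
      calc _ ≤ 1 / (2 * Real.pi) * 2 := by gcongr
        _ = _ := by field_simp
    · rw [Set.indicator_of_notMem hx]
      have h3 : max (4 - x ^ 2) 0 = 0 := by
        refine max_eq_right ?_
        by_contra! h
        exact hx (Set.mem_Icc.mpr (abs_le.mp (abs_le_of_sq_le_sq (by linarith) (by norm_num))))
      simp [rhoSC, h3]
  have hint : Integrable ((Set.Icc (-2 : ℝ) 2).indicator
      (fun _ : ℝ => 1 / z.im * (1 / Real.pi))) volume :=
    (integrable_indicator_iff measurableSet_Icc).mpr (integrableOn_const (by simp))
  refine (norm_integral_le_of_norm_le hint (.of_forall hpt)).trans ?_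
  rw [integral_indicator_const _ measurableSet_Icc, Real.volume_real_Icc_of_le (by norm_num),
    smul_eq_mul, div_eq_mul_one_div 2, mul_comm 2 (1 / z.im), mul_left_comm]
  gcongr
  rw [mul_one_div, div_le_iff₀ (by positivity)]
  linarith

variable {n : ℕ}

lemma deviation_eq (hn : 1 ≤ n) (W : Matrix (Fin n) (Fin n) ℂ) (z : ℂ) :
    deviation W z = (z.im : ℂ) * (green W z).trace - n * z.im * stieltjesSC z := by
  have : (n : ℂ) ≠ 0 := by exact_mod_cast (by omega : n ≠ 0)
  rw [deviation, stieltjes, green]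
  field_simp

lemma norm_shift_le {z : ℂ} (hz : 0 < z.im) : ‖(n : ℂ) * z.im * stieltjesSC z‖ ≤ 2 * n := by
  rw [norm_mul, norm_mul, Complex.norm_natCast, Complex.norm_real, Real.norm_eq_abs, abs_of_pos hz]
  calc _ ≤ n * z.im * (2 / z.im) := by gcongr; exact norm_stieltjesSC_le hz
    _ = _ := by field_simp

lemma norm_deviation_le (hn : 1 ≤ n) {W : Matrix (Fin n) (Fin n) ℂ} (hW : W.IsHermitian) {z : ℂ}
    (hz : 0 < z.im) : ‖deviation W z‖ ≤ 3 * n := by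
  rw [deviation_eq hn]
  exact norm_im_mul_trace_green_sub_le hW hz (norm_shift_le hz)

lemma normalize_add_smul (Y V : Matrix (Fin n) (Fin n) ℂ) (t : ℝ) :
    normalize (Y + (t : ℂ) • V) = normalize Y + ((t / √n : ℝ) : ℂ) • V := by
  rw [normalize, normalize, smul_add, smul_smul, ← Complex.ofReal_mul]
  congr 3
  ring

end Deviation

/-! ### Comparison of moments conditionally on the common part. -/

section Compare

variable {Ω : Type*} [MeasurableSpace Ω] {μ : Measure Ω} {n : ℕ}

lemma integral_indepFun_eq [IsProbabilityMeasure μ] {α β : Type*} [MeasurableSpace α]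
    [MeasurableSpace β] {Y : Ω → α} {ξ : Ω → β} (hY : Measurable Y) (hξ : Measurable ξ)
    (hind : IndepFun Y ξ μ) {f : α × β → ℝ} (hf : Measurable f) {F : ℝ} (hF : ∀ x, ‖f x‖ ≤ F) :
    Integrable (fun ω => ∫ t, f (Y ω, t) ∂(μ.map ξ)) μ ∧
    ∫ ω, f (Y ω, ξ ω) ∂μ = ∫ ω, ∫ t, f (Y ω, t) ∂(μ.map ξ) ∂μ := by
  have := Measure.isProbabilityMeasure_map (μ := μ) hY.aemeasurable
  have := Measure.isProbabilityMeasure_map (μ := μ) hξ.aemeasurable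
  have hint : Integrable f ((μ.map Y).prod (μ.map ξ)) :=
    Integrable.of_bound hf.aestronglyMeasurable F (.of_forall hF)
  have hm : StronglyMeasurable fun y => ∫ t, f (y, t) ∂(μ.map ξ) :=
    hf.stronglyMeasurable.integral_prod_right'
  refine ⟨hint.integral_prod_left.comp_measurable hY, ?_⟩
  have h1 : ∫ ω, f (Y ω, ξ ω) ∂μ = ∫ x, f x ∂(μ.map fun ω => (Y ω, ξ ω)) :=
    (integral_map (hY.prodMk hξ).aemeasurable hf.aestronglyMeasurable).symm
  rw [h1, (indepFun_iff_map_prod_eq_prod_map_map hY.aemeasurable hξ.aemeasurable).mp hind,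
    integral_prod _ hint, integral_map hY.aemeasurable hm.aestronglyMeasurable]

/-- Comparison of the moments of the deviation for two random matrices which differ by the law of
one real parameter. -/
lemma integral_norm_deviation_pow_le [IsProbabilityMeasure μ] (hn : 1 ≤ n)
    {M M' Y Y' : Ω → Matrix (Fin n) (Fin n) ℂ} {ξ ξ' : Ω → ℝ} {V : Matrix (Fin n) (Fin n) ℂ}
    (hV : V.IsHermitian) {a b : Fin n} (hVab : PairSupported V a b)
    (hY : ∀ ω, (Y ω).IsHermitian) (hY' : ∀ ω, (Y' ω).IsHermitian)
    (hYm : ∀ i j, Measurable fun ω => Y ω i j) (hYm' : ∀ i j, Measurable fun ω => Y' ω i j)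
    (hYY' : ∀ᵐ ω ∂μ, Y ω = Y' ω) (hξ : Measurable ξ) (hξ' : Measurable ξ')
    (hM : ∀ ω, M ω = Y ω + (ξ ω : ℂ) • V) (hM' : ∀ ω, M' ω = Y' ω + (ξ' ω : ℂ) • V)
    (hind : IndepFun (fun ω i j => Y ω i j) ξ μ) (hind' : IndepFun (fun ω i j => Y' ω i j) ξ' μ)
    {m : ℕ} (hint : Integrable (fun ω => |ξ ω| ^ (m + 1)) μ)
    (hint' : Integrable (fun ω => |ξ' ω| ^ (m + 1)) μ)
    (hmom : ∀ j ≤ m, ∫ ω, ξ ω ^ j ∂μ = ∫ ω, ξ' ω ^ j ∂μ) {Λ δ β : ℝ}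
    (hΛ : ∫ ω, |ξ ω| ^ (m + 1) ∂μ ≤ Λ) (hΛ' : ∫ ω, |ξ' ω| ^ (m + 1) ∂μ ≤ Λ)
    (hδ : μ.real {ω | √n / 224 < |ξ ω|} ≤ δ) (hδ' : μ.real {ω | √n / 224 < |ξ' ω|} ≤ δ)
    {z : ℂ} (hz : 0 < z.im)
    (hβ : μ.real {ω | ¬BlockBounded (normalize (M ω)) z a b 7} ≤ β)
    {k : ℕ} (hk : 1 ≤ k) (hk2 : Even k) :
    ∫ ω, ‖deviation (normalize (M ω)) z‖ ^ k ∂μ ≤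
      (1 + swapConst m Λ * (n : ℝ) ^ (-((m : ℝ) + 1) / 2)) *
        ∫ ω, ‖deviation (normalize (M' ω)) z‖ ^ k ∂μ
        + swapConst m Λ * (k : ℝ) ^ k + swapConst m Λ * (3 * n : ℝ) ^ k * δ
        + (3 * n : ℝ) ^ k * (β + δ) := by
  have hn0 : (0 : ℝ) < n := by exact_mod_cast hn
  have hs0 : 0 < √(n : ℝ) := Real.sqrt_pos.mpr hn0
  set w : ℂ := n * z.im * stieltjesSC z with hw_def
  have hw : ‖w‖ ≤ 2 * n := norm_shift_le hz
  set F : ℝ := (3 * n : ℝ) ^ k with hF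
  have hF0 : 0 ≤ F := by positivity
  have hΛ0 : 0 ≤ Λ := (integral_nonneg fun ω => by positivity).trans hΛ
  have hB0 : 0 ≤ swapConst m Λ := by rw [swapConst]; positivity
  set g : Matrix (Fin n) (Fin n) ℂ → ℝ → ℝ := fun N t =>
    ‖(z.im : ℂ) * (green (normalize N + ((t / √n : ℝ) : ℂ) • V) z).trace - w‖ ^ k with hg
  have hgF : ∀ N : Matrix (Fin n) (Fin n) ℂ, N.IsHermitian → ∀ t, g N t ≤ F := fun N hN t =>
    pow_le_pow_left₀ (norm_nonneg _) (norm_im_mul_trace_green_sub_le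
      (isHermitian_add_smul (isHermitian_normalize hN) hV _) hz hw) k
  -- The bound `F` holds only for Hermitian `N`, while Fubini is applied on all matrices; the
  -- truncation is inactive at the values taken by `Y` and `Y'`.
  set f : (Fin n → Fin n → ℂ) × ℝ → ℝ := fun x => min (g (Matrix.of x.1) x.2) F with hf
  have hfm : Measurable f := by
    refine Measurable.min ?_ measurable_const
    simp only [hg, Matrix.trace, Matrix.diag_apply]
    refine ((Measurable.const_mul (Finset.measurable_sum _ fun i _ =>
      measurable_green (fun i j => ?_) z i i) _).sub_const _).norm.pow_const _
    simp only [Matrix.add_apply, normalize_apply, Matrix.of_apply, Matrix.smul_apply, smul_eq_mul]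
    fun_prop
  have hfF : ∀ x, ‖f x‖ ≤ F := fun x => by
    rw [Real.norm_eq_abs, abs_of_nonneg (le_min (by positivity) hF0)]
    exact min_le_right _ _
  have hfg : ∀ N : Matrix (Fin n) (Fin n) ℂ, N.IsHermitian → ∀ t, f (fun i j => N i j, t) = g N t :=
    fun N hN t => min_eq_left (hgF N hN t)
  have hYm2 : Measurable fun ω i j => Y ω i j :=
    measurable_pi_lambda _ fun i => measurable_pi_lambda _ fun j => hYm i j
  have hYm2' : Measurable fun ω i j => Y' ω i j :=
    measurable_pi_lambda _ fun i => measurable_pi_lambda _ fun j => hYm' i j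
  obtain ⟨i1, e1⟩ := integral_indepFun_eq hYm2 hξ hind hfm hfF
  obtain ⟨i2, e2⟩ := integral_indepFun_eq hYm2' hξ' hind' hfm hfF
  simp only [hfg _ (hY _)] at i1 e1
  simp only [hfg _ (hY' _)] at i2 e2
  have hdev : ∀ ω, ‖deviation (normalize (M ω)) z‖ ^ k = g (Y ω) (ξ ω) := fun ω => by
    rw [deviation_eq hn, hM, normalize_add_smul]
  have hdev' : ∀ ω, ‖deviation (normalize (M' ω)) z‖ ^ k = g (Y' ω) (ξ' ω) := fun ω => by
    rw [deviation_eq hn, hM', normalize_add_smul]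
  simp_rw [hdev, hdev']
  rw [e1, e2]
  have hν : IsProbabilityMeasure (μ.map ξ) := Measure.isProbabilityMeasure_map hξ.aemeasurable
  have hν' : IsProbabilityMeasure (μ.map ξ') := Measure.isProbabilityMeasure_map hξ'.aemeasurable
  have hpm : ∀ (ρ : Measure ℝ) (q : ℕ), AEStronglyMeasurable (fun t : ℝ => |t| ^ q) ρ :=
    fun ρ q => (measurable_norm.pow_const q).aestronglyMeasurable
  have hset : MeasurableSet {t : ℝ | √n / 224 < |t|} :=
    measurableSet_lt measurable_const measurable_norm
  have hswap : ∀ ω, BlockBounded (normalize (Y ω)) z a b 14 →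
      ∫ t, g (Y ω) t ∂(μ.map ξ) ≤ (1 + swapConst m Λ * (n : ℝ) ^ (-((m : ℝ) + 1) / 2)) *
        ∫ t, g (Y ω) t ∂(μ.map ξ') + swapConst m Λ * (k : ℝ) ^ k + swapConst m Λ * F * δ := by
    intro ω hb
    refine integral_norm_pow_swap_le hn (isHermitian_normalize (hY ω)) hV hz hVab hb hw hk hk2
      ?_ ?_ ?_ ?_ ?_ ?_ ?_
    · exact (integrable_map_measure (hpm _ _) hξ.aemeasurable).mpr hint
    · exact (integrable_map_measure (hpm _ _) hξ'.aemeasurable).mpr hint'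
    · intro j hj
      rw [integral_map hξ.aemeasurable (by fun_prop), integral_map hξ'.aemeasurable (by fun_prop)]
      exact hmom j hj
    · rwa [integral_map hξ.aemeasurable (hpm _ _)]
    · rwa [integral_map hξ'.aemeasurable (hpm _ _)]
    · rwa [map_measureReal_apply hξ hset]
    · rwa [map_measureReal_apply hξ' hset]
  set bad : Set Ω := {ω | ¬BlockBounded (normalize (Y ω)) z a b 14} with hbad
  have hbadm : MeasurableSet bad := by
    have hgm : ∀ i j, Measurable fun ω => ‖green (normalize (Y ω)) z i j‖ := fun i j => by
      refine (measurable_green (fun i j => ?_) z i j).norm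
      simp only [normalize_apply]
      exact (hYm i j).const_mul _
    have hle : ∀ i j, MeasurableSet {ω | ‖green (normalize (Y ω)) z i j‖ ≤ 14} := fun i j =>
      measurableSet_le (hgm i j) measurable_const
    exact (((hle a a).inter ((hle a b).inter ((hle b a).inter (hle b b))))).compl
  -- The resolvent bound is known for `M`, but the exchange needs it for `Y`. Subtracting `ξ V` is a
  -- perturbation of size at most `1/224` when `|ξ| ≤ √n / 224`, and doubles the bound `7` to `14`.
  have hbadle : μ.real bad ≤ β + δ := by
    refine le_trans (measureReal_mono ?_) ((measureReal_union_le _ _).trans (add_le_add hβ hδ))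
    intro ω hω
    by_contra h
    rw [Set.mem_union, not_or] at h
    obtain ⟨h1, h2⟩ := h
    have h1' : BlockBounded (normalize (M ω)) z a b 7 := not_not.mp h1
    have h2' : |ξ ω| ≤ √n / 224 := not_lt.mp h2
    apply hω
    have hMH : (M ω).IsHermitian := by
      rw [hM]; exact isHermitian_add_smul (hY ω) hV _
    have e : normalize (Y ω) = normalize (M ω) + ((-ξ ω / √n : ℝ) : ℂ) • V := by
      rw [← normalize_add_smul, hM]
      congr 1
      rw [Complex.ofReal_neg, neg_smul, add_neg_cancel_right]
    have h3 := h1'.add_smul (det_sub_smul_ne_zero (isHermitian_normalize hMH) hz.ne') hVab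
      (τ := ((-ξ ω / √n : ℝ) : ℂ)) (by
        rw [Complex.norm_real, Real.norm_eq_abs, abs_div, abs_neg, abs_of_pos hs0]
        have : |ξ ω| / √n ≤ 1 / 224 := by
          rw [div_le_iff₀ hs0]; linarith
        linarith)
    rw [← e] at h3
    norm_num at h3
    exact h3
  have hpt : ∀ᵐ ω ∂μ, ∫ t, g (Y ω) t ∂(μ.map ξ) ≤
      ((1 + swapConst m Λ * (n : ℝ) ^ (-((m : ℝ) + 1) / 2)) * ∫ t, g (Y' ω) t ∂(μ.map ξ')
        + (swapConst m Λ * (k : ℝ) ^ k + swapConst m Λ * F * δ))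
        + bad.indicator (fun _ => F) ω := by
    filter_upwards [hYY'] with ω hω
    have hδ0 : 0 ≤ δ := measureReal_nonneg.trans hδ
    rw [← hω]
    by_cases hb : ω ∈ bad
    · rw [Set.indicator_of_mem hb]
      have h1 : ∫ t, g (Y ω) t ∂(μ.map ξ) ≤ F := by
        have := norm_integral_le_of_norm_le_const (μ := μ.map ξ) (f := fun t => g (Y ω) t) (C := F)
          (.of_forall fun t => by
            rw [Real.norm_eq_abs, abs_of_nonneg (by positivity)]; exact hgF _ (hY ω) t)
        rw [probReal_univ, mul_one] at this
        exact (le_abs_self _).trans this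
      have h2 : 0 ≤ ∫ t, g (Y ω) t ∂(μ.map ξ') := integral_nonneg fun t => by positivity
      have h3 : 0 ≤ (1 + swapConst m Λ * (n : ℝ) ^ (-((m : ℝ) + 1) / 2)) *
          ∫ t, g (Y ω) t ∂(μ.map ξ') := by positivity
      have h4 : 0 ≤ swapConst m Λ * (k : ℝ) ^ k + swapConst m Λ * F * δ := by positivity
      linarith
    · rw [Set.indicator_of_notMem hb, add_zero, ← add_assoc]
      exact hswap ω (not_not.mp hb)
  have hind3 : Integrable (bad.indicator fun _ => F) μ := (integrable_const F).indicator hbadm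
  have i4 := i2.const_mul (1 + swapConst m Λ * (n : ℝ) ^ (-((m : ℝ) + 1) / 2))
  have i5 := i4.add (integrable_const (μ := μ)
    (swapConst m Λ * (k : ℝ) ^ k + swapConst m Λ * F * δ))
  have h1 := integral_mono_ae i1 (i5.add hind3) hpt
  have h2 := integral_add i5 hind3
  have h3 := integral_add i4 (integrable_const (μ := μ)
    (swapConst m Λ * (k : ℝ) ^ k + swapConst m Λ * F * δ))
  simp only [Pi.add_apply] at h1 h2 h3
  rw [h2, h3, integral_const_mul, integral_indicator_const _ hbadm, integral_const] at h1
  simp only [probReal_univ, smul_eq_mul, one_mul] at h1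
  refine h1.trans ?_
  have h4 : μ.real bad * F ≤ F * (β + δ) := by
    rw [mul_comm]; gcongr
  linarith

end Compare

/-! ### Isolating the real coordinate in which adjacent matrices differ. -/

section Splitting

variable {Ω : Type*} {n : ℕ}

/-- Joint independence of the three variables, read with the other bracketing through associativity
of product measures. -/
lemma indepFun_prodMk_left [MeasurableSpace Ω] {μ : Measure Ω} [IsProbabilityMeasure μ] {α β γ : Type*} [MeasurableSpace α]
    [MeasurableSpace β] [MeasurableSpace γ] {A : Ω → α} {ζ : Ω → β} {ξ : Ω → γ}
    (hA : Measurable A) (hζ : Measurable ζ) (hξ : Measurable ξ)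
    (h : IndepFun A (fun ω => (ζ ω, ξ ω)) μ) (h' : IndepFun ζ ξ μ) :
    IndepFun (fun ω => (A ω, ζ ω)) ξ μ := by
  have := Measure.isProbabilityMeasure_map (μ := μ) hA.aemeasurable
  have := Measure.isProbabilityMeasure_map (μ := μ) hζ.aemeasurable
  have := Measure.isProbabilityMeasure_map (μ := μ) hξ.aemeasurable
  have hAζ : IndepFun A ζ μ := h.comp measurable_id measurable_fst
  rw [indepFun_iff_map_prod_eq_prod_map_map (hA.prodMk hζ).aemeasurable hξ.aemeasurable,
    (indepFun_iff_map_prod_eq_prod_map_map hA.aemeasurable hζ.aemeasurable).mp hAζ]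
  have h1 := (indepFun_iff_map_prod_eq_prod_map_map hA.aemeasurable
    (hζ.prodMk hξ).aemeasurable).mp h
  rw [(indepFun_iff_map_prod_eq_prod_map_map hζ.aemeasurable hξ.aemeasurable).mp h',
    ← Measure.prodAssoc_prod] at h1
  have h2 := congrArg (Measure.map MeasurableEquiv.prodAssoc.symm) h1
  rw [Measure.map_map (MeasurableEquiv.measurable _) (MeasurableEquiv.measurable _),
    Measure.map_map (MeasurableEquiv.measurable _) (hA.prodMk (hζ.prodMk hξ)),
    MeasurableEquiv.symm_comp_self, Measure.map_id] at h2
  exact h2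

/-- The Hermitian matrix with entry `u` at `(a, b)`, supported on `(a, b)` and `(b, a)`. -/
def pairMatrix (a b : Fin n) (u : ℂ) : Matrix (Fin n) (Fin n) ℂ := fun i j =>
  if i = a ∧ j = b then u else if i = b ∧ j = a then starRingEnd ℂ u else 0

lemma pairSupported_pairMatrix (a b : Fin n) {u : ℂ} (hu : ‖u‖ = 1) :
    PairSupported (pairMatrix a b u) a b := by
  intro i j
  refine ⟨?_, fun h => ?_⟩
  · rw [pairMatrix]
    split_ifs <;> simp [hu]
  · rw [not_or] at h
    rw [pairMatrix, if_neg h.1, if_neg h.2]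

/-- On the diagonal the two positions coincide and the entry must be real, whence the condition for
`a = b`. -/
lemma isHermitian_pairMatrix {a b : Fin n} {u : ℂ} (hu : a = b → u = 1) :
    (pairMatrix a b u).IsHermitian := by
  ext i j
  rw [Matrix.conjTranspose_apply, pairMatrix, pairMatrix, ← starRingEnd_apply]
  by_cases h : a = b
  · rw [hu h]
    subst h
    by_cases h1 : i = a <;> by_cases h2 : j = a <;> simp [h1, h2]
  · by_cases h1 : i = a ∧ j = b
    · obtain ⟨rfl, rfl⟩ := h1
      simp [Ne.symm h]
    · by_cases h2 : i = b ∧ j = a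
      · obtain ⟨rfl, rfl⟩ := h2
        simp [Ne.symm h]
      · rw [if_neg h1, if_neg h2, if_neg (by tauto), if_neg (by tauto), map_zero]

/-- The part of the `(a, b)` entry in the direction `u`. -/
def coordAt (M : Ω → Matrix (Fin n) (Fin n) ℂ) (a b : Fin n) (u : ℂ) (ω : Ω) : ℝ :=
  (starRingEnd ℂ u * M ω a b).re

/-- The part of `M` which does not depend on `coordAt M a b u`. -/
noncomputable def remainderAt (M : Ω → Matrix (Fin n) (Fin n) ℂ) (a b : Fin n) (u : ℂ) (ω : Ω) :
    Matrix (Fin n) (Fin n) ℂ :=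
  M ω - (coordAt M a b u ω : ℂ) • pairMatrix a b u

variable {M M' : Ω → Matrix (Fin n) (Fin n) ℂ} {a b : Fin n} {u : ℂ}

lemma eq_remainderAt_add (M : Ω → Matrix (Fin n) (Fin n) ℂ) (a b : Fin n) (u : ℂ) (ω : Ω) :
    M ω = remainderAt M a b u ω + (coordAt M a b u ω : ℂ) • pairMatrix a b u :=
  (sub_add_cancel _ _).symm

lemma abs_coordAt_le (hu : ‖u‖ = 1) (ω : Ω) : |coordAt M a b u ω| ≤ ‖M ω a b‖ := by
  refine (Complex.abs_re_le_norm _).trans ?_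
  rw [norm_mul, RCLike.norm_conj, hu, one_mul]

/-- Rotating by `conj u` turns the direction `u` into the real axis; removing the real part leaves
the orthogonal coordinate. -/
lemma remainderAt_apply_self (hu : ‖u‖ = 1) (ω : Ω) :
    remainderAt M a b u ω a b = u * (((starRingEnd ℂ u * M ω a b).im : ℂ) * Complex.I) := by
  have h1 : u * starRingEnd ℂ u = 1 := by
    rw [Complex.mul_conj, Complex.normSq_eq_norm_sq, hu]; norm_num
  have h2 := Complex.re_add_im (starRingEnd ℂ u * M ω a b)
  have h3 : M ω a b = u * (starRingEnd ℂ u * M ω a b) := by rw [← mul_assoc, h1, one_mul]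
  simp only [remainderAt, Matrix.sub_apply, Matrix.smul_apply, pairMatrix, and_self, if_true,
    smul_eq_mul, coordAt]
  nth_rewrite 1 [h3]
  nth_rewrite 1 [← h2]
  ring

lemma remainderAt_apply_of_ne {i j : Fin n} (h1 : ¬(i = a ∧ j = b)) (h2 : ¬(i = b ∧ j = a))
    (ω : Ω) : remainderAt M a b u ω i j = M ω i j := by
  simp [remainderAt, pairMatrix, h1, h2]

variable [MeasurableSpace Ω] {μ : Measure Ω}

lemma isHermitian_remainderAt (hM : IsWigner M μ) (hu : a = b → u = 1) (ω : Ω) :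
    (remainderAt M a b u ω).IsHermitian := by
  have h := isHermitian_add_smul (hM.hermitian ω) (isHermitian_pairMatrix hu)
    (-coordAt M a b u ω)
  rw [Complex.ofReal_neg, neg_smul, ← sub_eq_add_neg] at h
  exact h

lemma measurable_coordAt (hM : IsWigner M μ) : Measurable (coordAt M a b u) :=
  Complex.measurable_re.comp ((hM.measurable a b).const_mul _)

lemma measurable_remainderAt (hM : IsWigner M μ) (i j : Fin n) :
    Measurable fun ω => remainderAt M a b u ω i j :=
  (hM.measurable i j).sub
    ((Complex.measurable_ofReal.comp (measurable_coordAt hM)).mul_const _)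

lemma im_conj_mul_apply_self (hM : IsWigner M μ) (hu : a = b → u = 1) (hab : a = b) (ω : Ω) :
    (starRingEnd ℂ u * M ω a b).im = 0 := by
  rw [hu hab, ← hab, map_one, one_mul]
  have := (hM.hermitian ω).apply a a
  exact Complex.conj_eq_iff_im.mp this

/-- The remainder is independent of the coordinate taken out. -/
lemma indepFun_remainderAt [IsProbabilityMeasure μ] (hM : IsWigner M μ) (hab : a ≤ b)
    (hu1 : ‖u‖ = 1) (hu : a = b → u = 1)
    (hind : a < b → IndepFun (fun ω => (starRingEnd ℂ u * M ω a b).im) (coordAt M a b u) μ) :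
    IndepFun (fun ω i j => remainderAt M a b u ω i j) (coordAt M a b u) μ := by
  classical
  set ζ : Ω → ℝ := fun ω => (starRingEnd ℂ u * M ω a b).im with hζ
  have hζm : Measurable ζ := Complex.measurable_im.comp ((hM.measurable a b).const_mul _)
  -- For a diagonal entry the orthogonal coordinate is identically zero, so only the off-diagonal
  -- case needs the independence of real and imaginary parts.
  have hind' : IndepFun ζ (coordAt M a b u) μ := by
    rcases hab.lt_or_eq with h | h
    · exact hind h
    · have : ζ = fun _ => 0 := funext fun ω => im_conj_mul_apply_self hM hu h ω
      rw [this]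
      exact indepFun_const_left 0 _
  set p₀ : {p : Fin n × Fin n // p.1 ≤ p.2} := ⟨(a, b), hab⟩ with hp₀
  have h := hM.indep.indepFun_finset ({p₀}ᶜ : Finset _) {p₀} disjoint_compl_left
    fun p => hM.measurable _ _
  have h1 := h.comp (φ := id) (ψ := fun y : ({p₀} : Finset _) → ℂ =>
    ((starRingEnd ℂ u * y ⟨p₀, Finset.mem_singleton_self _⟩).im,
      (starRingEnd ℂ u * y ⟨p₀, Finset.mem_singleton_self _⟩).re)) measurable_id
    ((Complex.measurable_im.comp ((measurable_pi_apply _).const_mul _)).prodMk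
      (Complex.measurable_re.comp ((measurable_pi_apply _).const_mul _)))
  have h2 := indepFun_prodMk_left
    (A := fun ω (p : (({p₀}ᶜ : Finset {p : Fin n × Fin n // p.1 ≤ p.2}))) => M ω p.1.1.1 p.1.1.2)
    (measurable_pi_lambda _ fun p => hM.measurable _ _) hζm (measurable_coordAt hM) h1 hind'
  have hmem : ∀ i j : Fin n, ¬((i = a ∧ j = b) ∨ (i = b ∧ j = a)) →
      upperIndex i j ∈ ({p₀}ᶜ : Finset _) := by
    intro i j hij
    rw [Finset.mem_compl, Finset.mem_singleton]
    intro h3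
    by_cases h4 : i ≤ j
    · rw [upperIndex_of_le h4, hp₀] at h3
      simp only [Subtype.mk.injEq, Prod.mk.injEq] at h3
      exact hij (Or.inl h3)
    · rw [upperIndex_of_not_le h4, hp₀] at h3
      simp only [Subtype.mk.injEq, Prod.mk.injEq] at h3
      exact hij (Or.inr ⟨h3.2, h3.1⟩)
  -- Rebuilds the remainder from the other upper triangular entries and the orthogonal coordinate
  -- alone.
  set Φ : ((({p₀}ᶜ : Finset {p : Fin n × Fin n // p.1 ≤ p.2}) → ℂ) × ℝ) → Fin n → Fin n → ℂ :=
    fun x i j => if hij : (i = a ∧ j = b) ∨ (i = b ∧ j = a) then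
      (if i = a ∧ j = b then id else starRingEnd ℂ : ℂ → ℂ) (u * ((x.2 : ℂ) * Complex.I))
      else (if i ≤ j then id else starRingEnd ℂ : ℂ → ℂ) (x.1 ⟨_, hmem i j hij⟩) with hΦ
  have hΦm : Measurable Φ := by
    refine measurable_pi_lambda _ fun i => measurable_pi_lambda _ fun j => ?_
    by_cases hij : (i = a ∧ j = b) ∨ (i = b ∧ j = a)
    · simp only [hΦ, hij, dif_pos]
      exact (measurable_ite_id_conj _).comp (((Complex.measurable_ofReal.comp
        measurable_snd).mul_const _).const_mul _)
    · simp only [hΦ, hij, dif_neg, not_false_eq_true]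
      exact (measurable_ite_id_conj _).comp ((measurable_pi_apply _).comp measurable_fst)
  have h3 := h2.comp hΦm measurable_id
  refine h3.congr (.of_forall fun ω => ?_) (.of_forall fun ω => rfl)
  funext i j
  symm
  simp only [Function.comp_apply, hΦ]
  by_cases hij : (i = a ∧ j = b) ∨ (i = b ∧ j = a)
  · rw [dif_pos hij]
    by_cases h4 : i = a ∧ j = b
    · rw [if_pos h4, h4.1, h4.2, remainderAt_apply_self hu1]
      rfl
    · obtain ⟨rfl, rfl⟩ := hij.resolve_left h4
      rw [if_neg h4, ← (isHermitian_remainderAt hM hu ω).apply, remainderAt_apply_self hu1]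
      rfl
  · rw [dif_neg hij]
    rw [not_or] at hij
    rw [remainderAt_apply_of_ne hij.1 hij.2, apply_eq_upperIndex (hM.hermitian ω)]
    split_ifs <;> rfl

lemma remainderAt_ae_eq (hM : IsWigner M μ) (hM' : IsWigner M' μ) (hu1 : ‖u‖ = 1)
    (hu : a = b → u = 1)
    (hne : ∀ i j, (i, j) ≠ (a, b) → (i, j) ≠ (b, a) → ∀ᵐ ω ∂μ, M ω i j = M' ω i j)
    (him : ∀ᵐ ω ∂μ, (starRingEnd ℂ u * M ω a b).im = (starRingEnd ℂ u * M' ω a b).im) :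
    ∀ᵐ ω ∂μ, remainderAt M a b u ω = remainderAt M' a b u ω := by
  have h : ∀ᵐ ω ∂μ, ∀ i j, (i, j) ≠ (a, b) → (i, j) ≠ (b, a) → M ω i j = M' ω i j := by
    simp only [ae_all_iff, Filter.eventually_imp_distrib_left]
    exact hne
  filter_upwards [h, him] with ω h1 h2
  have h3 : remainderAt M a b u ω a b = remainderAt M' a b u ω a b := by
    rw [remainderAt_apply_self hu1, remainderAt_apply_self hu1, h2]
  ext i j
  by_cases h4 : i = a ∧ j = b
  · rw [h4.1, h4.2, h3]
  · by_cases h5 : i = b ∧ j = a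
    · rw [h5.1, h5.2, ← (isHermitian_remainderAt hM hu ω).apply, h3,
        (isHermitian_remainderAt hM' hu ω).apply]
    · rw [remainderAt_apply_of_ne h4 h5, remainderAt_apply_of_ne h4 h5]
      exact h1 i j (by simpa using h4) (by simpa using h5)

/-- Adjacent Wigner matrices differ in one real coordinate. -/
lemma Adjacent.exists_direction (hM : IsWigner M μ) (hM' : IsWigner M' μ)
    (hadj : Adjacent M M' μ) :
    ∃ a b : Fin n, a ≤ b ∧ ∃ u : ℂ, (u = 1 ∨ (u = Complex.I ∧ a < b)) ∧
      ∀ᵐ ω ∂μ, remainderAt M a b u ω = remainderAt M' a b u ω := by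
  obtain ⟨a, b, hab, hne, hor⟩ : ∃ a b : Fin n, a ≤ b ∧
      (∀ i j, (i, j) ≠ (a, b) → (i, j) ≠ (b, a) → ∀ᵐ ω ∂μ, M ω i j = M' ω i j) ∧
      ((∀ᵐ ω ∂μ, (M ω a b).re = (M' ω a b).re) ∨
        (∀ᵐ ω ∂μ, (M ω a b).im = (M' ω a b).im)) := by
    obtain ⟨a, b, h1, h2⟩ := hadj
    rcases le_total a b with h | h
    · exact ⟨a, b, h, h1, h2⟩
    · refine ⟨b, a, h, fun i j h3 h4 => h1 i j h4 h3, h2.imp (fun h3 => ?_) fun h3 => ?_⟩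
      all_goals
        filter_upwards [h3] with ω h4
        rw [← (hM.hermitian ω).apply, ← (hM'.hermitian ω).apply]
        simpa using h4
  refine ⟨a, b, hab, ?_⟩
  have him : (∀ᵐ ω ∂μ, (M ω a b).im = (M' ω a b).im) →
      ∃ u : ℂ, (u = 1 ∨ (u = Complex.I ∧ a < b)) ∧
      ∀ᵐ ω ∂μ, remainderAt M a b u ω = remainderAt M' a b u ω := fun h =>
    ⟨1, Or.inl rfl, remainderAt_ae_eq hM hM' (by simp) (fun _ => rfl) hne (by simpa using h)⟩
  rcases hor with h | h
  -- Equal real parts leave the imaginary part to exchange, hence `u = I`. On the diagonal the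
  -- imaginary parts vanish, so `u = 1` serves there as well.
  · rcases hab.lt_or_eq with hlt | heq
    · refine ⟨Complex.I, Or.inr ⟨rfl, hlt⟩, remainderAt_ae_eq hM hM' (by simp)
        (fun h' => absurd h' hlt.ne) hne ?_⟩
      simpa using h
    · refine him (.of_forall fun ω => ?_)
      have h1 := im_conj_mul_apply_self (u := 1) hM (fun _ => rfl) heq ω
      have h2 := im_conj_mul_apply_self (u := 1) hM' (fun _ => rfl) heq ω
      rw [map_one, one_mul] at h1 h2
      rw [h1, h2]
  · exact him h

/-- The moment comparison for adjacent Wigner matrices, in terms of the probabilities of two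
exceptional events. -/
lemma integral_norm_deviation_pow_le_of_adjacent [IsProbabilityMeasure μ] (hn : 1 ≤ n)
    (hM : IsWigner M μ) (hM' : IsWigner M' μ) {C C' : ℝ} (hC : 0 < C) (hC' : 0 ≤ C')
    (hexp : ExpDecay M μ C C') (hexp' : ExpDecay M' μ C C') (hadj : Adjacent M M' μ)
    {m : ℕ} (hmom : MatchMoments M M' μ m) {δ β : ℝ}
    (hδ : ∀ i j, μ.real {ω | √n / 224 < ‖M ω i j‖} ≤ δ)
    (hδ' : ∀ i j, μ.real {ω | √n / 224 < ‖M' ω i j‖} ≤ δ)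
    {z : ℂ} (hz : 0 < z.im)
    (hβ : μ.real {ω | ¬∀ i j, ‖green (normalize (M ω)) z i j‖ ≤ 7} ≤ β)
    {k : ℕ} (hk : 1 ≤ k) (hk2 : Even k) {B : ℝ}
    (hB : B = swapConst m (expMomentConst C' * (2 * C * (m + 1 : ℕ)) ^ (C * (m + 1 : ℕ)))) :
    ∫ ω, ‖deviation (normalize (M ω)) z‖ ^ k ∂μ ≤
      (1 + B * (n : ℝ) ^ (-((m : ℝ) + 1) / 2)) *
        ∫ ω, ‖deviation (normalize (M' ω)) z‖ ^ k ∂μ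
        + B * (k : ℝ) ^ k + B * (3 * n : ℝ) ^ k * δ + (3 * n : ℝ) ^ k * (β + δ) := by
  obtain ⟨a, b, hab, u, hu, hY⟩ := hadj.exists_direction hM hM'
  have hu1 : ‖u‖ = 1 := by
    rcases hu with rfl | ⟨rfl, -⟩ <;> simp
  have hu2 : a = b → u = 1 := fun h => hu.resolve_right fun h' => h'.2.ne h
  have hind : ∀ {N : Ω → Matrix (Fin n) (Fin n) ℂ}, IsWigner N μ →
      IndepFun (fun ω i j => remainderAt N a b u ω i j) (coordAt N a b u) μ := by
    intro N hN
    refine indepFun_remainderAt hN hab hu1 hu2 fun hlt => ?_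
    have h := hN.indep_re_im a b hlt
    rcases hu with rfl | ⟨rfl, -⟩
    · have e : coordAt N a b 1 = fun ω => (N ω a b).re := by
        funext ω; simp [coordAt]
      rw [e]
      simpa using h.symm
    -- For `u = I` the orthogonal coordinate is minus the real part of the entry.
    · have h' := h.comp measurable_neg measurable_id
      have e : coordAt N a b Complex.I = fun ω => (N ω a b).im := by
        funext ω; simp [coordAt]
      rw [e]
      simpa [Function.comp_def] using h'
  have hpow : ∀ {N : Ω → Matrix (Fin n) (Fin n) ℂ}, IsWigner N μ → ExpDecay N μ C C' →
      Integrable (fun ω => |coordAt N a b u ω| ^ (m + 1)) μ ∧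
      ∫ ω, |coordAt N a b u ω| ^ (m + 1) ∂μ
        ≤ expMomentConst C' * (2 * C * (m + 1 : ℕ)) ^ (C * (m + 1 : ℕ)) := by
    intro N hN hNe
    obtain ⟨h1, h2⟩ := integral_norm_pow_le_of_tail (hN.measurable a b) hC hC' (hNe a b)
      (q := m + 1) (by omega)
    have h3 : ∀ ω, |coordAt N a b u ω| ^ (m + 1) ≤ ‖N ω a b‖ ^ (m + 1) := fun ω =>
      pow_le_pow_left₀ (abs_nonneg _) (abs_coordAt_le hu1 ω) _
    have h4 : Integrable (fun ω => |coordAt N a b u ω| ^ (m + 1)) μ :=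
      h1.mono' ((measurable_coordAt hN).norm.pow_const _).aestronglyMeasurable
        (.of_forall fun ω => by
          rw [Real.norm_eq_abs, abs_of_nonneg (by positivity)]; exact h3 ω)
    exact ⟨h4, (integral_mono h4 h1 h3).trans h2⟩
  have htail : ∀ {N : Ω → Matrix (Fin n) (Fin n) ℂ},
      (∀ i j, μ.real {ω | √n / 224 < ‖N ω i j‖} ≤ δ) →
      μ.real {ω | √n / 224 < |coordAt N a b u ω|} ≤ δ := fun h =>
    (measureReal_mono fun ω hω => lt_of_lt_of_le hω (abs_coordAt_le hu1 ω)).trans (h a b)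
  rw [hB]
  refine integral_norm_deviation_pow_le hn (isHermitian_pairMatrix hu2)
    (pairSupported_pairMatrix a b hu1) (isHermitian_remainderAt hM hu2)
    (isHermitian_remainderAt hM' hu2) (measurable_remainderAt hM) (measurable_remainderAt hM') hY
    (measurable_coordAt hM) (measurable_coordAt hM') (eq_remainderAt_add M a b u)
    (eq_remainderAt_add M' a b u) (hind hM) (hind hM') (hpow hM hexp).1 (hpow hM' hexp').1 ?_
    (hpow hM hexp).2 (hpow hM' hexp').2 (htail hδ) (htail hδ') hz ?_ hk hk2
  · intro j hj
    rcases hu with rfl | ⟨rfl, -⟩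
    · simpa [coordAt] using hmom a b j 0 (by omega)
    · simpa [coordAt] using hmom a b 0 j (by omega)
  · refine le_trans (measureReal_mono fun ω hω => ?_) hβ
    exact fun h => hω ⟨h a a, h a b, h b a, h b b⟩

end Splitting

/-! ### Choice of parameters and overwhelming probability. -/

section Numerics

variable {Ω : Type*} [MeasurableSpace Ω] {μ : Measure Ω} {n : ℕ}
  {M : Ω → Matrix (Fin n) (Fin n) ℂ}

/-- The tail condition at `t = n ^ (1 / (4 C))`, for which `t ^ C = n ^ (1/4)`: large enough for a
small tail, yet well below `√n`. -/
lemma measureReal_rpow_quarter_le {C C' : ℝ} (hC : 0 < C) (hexp : ExpDecay M μ C C')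
    (hn : C' ≤ (n : ℝ) ^ (1 / (4 * C))) (i j : Fin n) :
    μ.real {ω | (n : ℝ) ^ (1 / 4 : ℝ) ≤ ‖M ω i j‖} ≤ Real.exp (-(n : ℝ) ^ (1 / (4 * C))) := by
  have h := hexp i j _ hn
  have e : ((n : ℝ) ^ (1 / (4 * C))) ^ C = (n : ℝ) ^ (1 / 4 : ℝ) := by
    rw [← Real.rpow_mul (Nat.cast_nonneg n)]
    congr 1
    field_simp
  rwa [e] at h

lemma rpow_quarter_pow_four {x : ℝ} (hx : 0 ≤ x) : (x ^ (1 / 4 : ℝ)) ^ 4 = x := by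
  rw [← Real.rpow_natCast, ← Real.rpow_mul hx]
  norm_num

lemma sqrt_eq_rpow_quarter_sq {x : ℝ} (hx : 0 ≤ x) : √x = (x ^ (1 / 4 : ℝ)) ^ 2 := by
  rw [Real.sqrt_eq_rpow, ← Real.rpow_natCast, ← Real.rpow_mul hx]
  norm_num

/-- The choice of the order of the moments in the concentration estimate. -/
lemma exists_moment_order {C D X : ℝ} (hC : 0 < C) (hD : 1 ≤ D)
    (hX : (288 * Real.exp 1 * D) ^ 8 ≤ X) :
    ∃ P : ℕ, 1 ≤ P ∧
      (288 * (P : ℝ) ^ 2 * (D * (P : ℝ) ^ (2 * C)) / X ^ (1 / 4 : ℝ)) ^ (2 * P)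
        ≤ Real.exp (-X ^ (1 / (8 * (2 + 2 * C)))) := by
  set A := 288 * Real.exp 1 * D with hA
  have he : 1 ≤ Real.exp 1 := Real.one_le_exp (by norm_num)
  have hA1 : 1 ≤ A := by
    rw [hA]; nlinarith [mul_le_mul he hD (by norm_num) (by positivity)]
  have hX0 : 0 < X := lt_of_lt_of_le (by positivity) hX
  set l := X ^ (1 / 4 : ℝ) with hl
  have hl0 : 0 < l := by positivity
  have hl4 : l ^ 4 = X := rpow_quarter_pow_four hX0.le
  -- The assumption `X ≥ A ^ 8` is there so that dividing `l` by `A` still leaves `√l`, and `y`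
  -- below is at least a power of `X` free of constants.
  have hAl : A ^ 2 ≤ l := by
    refine le_of_pow_le_pow_left₀ (n := 4) (by norm_num) hl0.le ?_
    rw [hl4, ← pow_mul]; exact hX
  have hAs : A ≤ √l := Real.le_sqrt_of_sq_le hAl
  have hsl : √l ≤ l / A := by
    rw [le_div_iff₀ (by positivity)]
    calc √l * A ≤ √l * √l := by gcongr
      _ = l := Real.mul_self_sqrt hl0.le
  -- For `P` at most this value `288 D P ^ (2 + 2 C) ≤ l / e`; the base is then at most `1 / e`, and
  -- the probability at most `exp (-2 P) ≤ exp (-y)` for `P = ⌊y⌋₊`.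
  set y := (l / A) ^ (1 / (2 + 2 * C)) with hy
  have hy1 : 1 ≤ y := Real.one_le_rpow (hA1.trans (hAs.trans hsl)) (by positivity)
  have hyX : X ^ (1 / (8 * (2 + 2 * C))) ≤ y := by
    have e : X ^ (1 / (8 * (2 + 2 * C))) = (√l) ^ (1 / (2 + 2 * C)) := by
      rw [Real.sqrt_eq_rpow, hl, ← Real.rpow_mul hX0.le, ← Real.rpow_mul hX0.le]
      congr 1
      field_simp
      norm_num
    rw [e]
    exact Real.rpow_le_rpow (by positivity) hsl (by positivity)
  have hP1 : 1 ≤ ⌊y⌋₊ := Nat.le_floor (by exact_mod_cast hy1)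
  refine ⟨⌊y⌋₊, hP1, ?_⟩
  set P := ⌊y⌋₊
  have hP1' : (1 : ℝ) ≤ P := by exact_mod_cast hP1
  have hPy : (P : ℝ) ≤ y := Nat.floor_le (by positivity)
  have hyP : y ≤ 2 * P := by linarith [Nat.lt_floor_add_one y]
  have hPl : (P : ℝ) ^ (2 + 2 * C) ≤ l / A := by
    calc (P : ℝ) ^ (2 + 2 * C) ≤ y ^ (2 + 2 * C) := by gcongr
      _ = l / A := by
        rw [hy, ← Real.rpow_mul (by positivity), one_div_mul_cancel (by positivity), Real.rpow_one]
  have hbase : 288 * (P : ℝ) ^ 2 * (D * (P : ℝ) ^ (2 * C)) / l ≤ Real.exp (-1) := by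
    have e : 288 * (P : ℝ) ^ 2 * (D * (P : ℝ) ^ (2 * C)) = 288 * D * (P : ℝ) ^ (2 + 2 * C) := by
      rw [Real.rpow_add (by positivity), Real.rpow_two]; ring
    rw [e, div_le_iff₀ hl0, Real.exp_neg]
    calc 288 * D * (P : ℝ) ^ (2 + 2 * C) ≤ 288 * D * (l / A) := by gcongr
      _ = _ := by rw [hA]; field_simp
  calc _ ≤ Real.exp (-1) ^ (2 * P) := pow_le_pow_left₀ (by positivity) hbase _
    _ = Real.exp (-(2 * P)) := by
      rw [← Real.exp_nat_mul]; congr 1; push_cast; ring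
    _ ≤ _ := Real.exp_le_exp.mpr (by linarith)

/-- With overwhelming probability the resolvent entries of a normalized Wigner matrix are
bounded. -/
lemma measureReal_not_norm_green_le [IsProbabilityMeasure μ] (hn : 1 ≤ n) (hM : IsWigner M μ)
    {C C' : ℝ} (hC : 0 < C) (hC' : 0 ≤ C') (hexp : ExpDecay M μ C C')
    (hnC : C' ≤ (n : ℝ) ^ (1 / (4 * C))) {z : ℂ} (hE : |z.re| ≤ 3) (hz : 0 < z.im)
    (hX : 12000 ^ 4 ≤ n * z.im) (hX' : (288 * Real.exp 1 * momentConst C C') ^ 8 ≤ n * z.im) :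
    μ.real {ω | ¬∀ i j, ‖green (normalize (M ω)) z i j‖ ≤ 7}
      ≤ (n : ℝ) ^ 5 * (Real.exp (-(n : ℝ) ^ (1 / (4 * C)))
        + Real.exp (-(n * z.im) ^ (1 / (8 * (2 + 2 * C))))) := by
  rcases le_or_gt z.im 1 with hz1 | hz1
  swap
  · have h : {ω | ¬∀ i j, ‖green (normalize (M ω)) z i j‖ ≤ 7} = ∅ := by
      refine Set.eq_empty_of_forall_notMem fun ω hω => hω fun i j => ?_
      refine (norm_green_le (isHermitian_normalize (hM.hermitian ω)) hz i j).trans ?_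
      rw [div_le_iff₀ hz]
      linarith
    rw [h, measureReal_empty]
    positivity
  have hn0 : (0 : ℝ) < n := by exact_mod_cast hn
  have hD : 1 ≤ momentConst C C' := by
    simpa using one_le_momentConst_mul hC hC' le_rfl
  obtain ⟨P, hP, hPX⟩ := exists_moment_order hC hD hX'
  set X := (n : ℝ) * z.im with hXdef
  have hX0 : 0 < X := by positivity
  set l := X ^ (1 / 4 : ℝ) with hl
  have hl0 : 0 < l := by positivity
  have hl4 : l ^ 4 = X := rpow_quarter_pow_four hX0.le
  have hl1 : 12000 ≤ l := by
    refine le_of_pow_le_pow_left₀ (n := 4) (by norm_num) hl0.le ?_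
    rw [hl4]; exact hX
  set q := (n : ℝ) ^ (1 / 4 : ℝ) with hq
  have hq0 : 0 < q := by positivity
  have hlq : l ≤ q := by
    refine Real.rpow_le_rpow hX0.le ?_ (by norm_num)
    rw [hXdef]; nlinarith
  have hr : ∀ i j, μ.real {ω | 1 / q < ‖normalize (M ω) i j‖}
      ≤ Real.exp (-(n : ℝ) ^ (1 / (4 * C))) := by
    intro i j
    refine le_trans (measureReal_mono fun ω hω => ?_) (measureReal_rpow_quarter_le hC hexp hnC i j)
    have hω' : 1 / q < ‖normalize (M ω) i j‖ := hω
    rw [normalize_apply, norm_mul, Complex.norm_real, Real.norm_eq_abs,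
      abs_of_nonneg (by positivity), sqrt_eq_rpow_quarter_sq hn0.le, ← hq, one_div_mul_eq_div,
      div_lt_div_iff₀ hq0 (by positivity), one_mul, sq] at hω'
    exact (lt_of_mul_lt_mul_right hω' hq0.le).le
  have hmain := measureReal_not_concentrated_le hn hM hC hC' hexp hP hl0 hr z.re z.im
  -- With `l = X ^ (1/4)` the three terms are at most `1 / l`, `5 / l` and `6 / l`; the sum `12 / l`
  -- explains the requirement `l ≥ 12000`.
  have hε : 1 / q + l * √(18 / X) + 6 / X ≤ 1 / 1000 := by
    have h1 : 1 / q ≤ 1 / l := one_div_le_one_div_of_le hl0 hlq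
    have h2 : √(18 / X) ≤ 5 / l ^ 2 := by
      rw [Real.sqrt_le_left (by positivity), div_pow, ← pow_mul, hl4]
      gcongr
      norm_num
    have h3 : l * √(18 / X) ≤ 5 / l := by
      calc _ ≤ l * (5 / l ^ 2) := by gcongr
        _ = _ := by field_simp
    have h4 : 6 / X ≤ 6 / l := by
      rw [← hl4]
      gcongr
      exact le_self_pow₀ (by linarith) (by norm_num)
    have h5 : 1 / l + 5 / l + 6 / l ≤ 1 / 1000 := by
      rw [← add_div, ← add_div, div_le_div_iff₀ hl0 (by norm_num)]
      linarith
    linarith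
  refine le_trans (measureReal_mono fun ω hω => ?_) (hmain.trans (by gcongr))
  refine fun h => hω fun i j => ?_
  exact norm_green_le_of_concentrated (isHermitian_normalize (hM.hermitian ω)) hl0.le hE hz hz1
    (le_trans (by norm_num) hX) hε h i j

/-- Here the polynomial upper bound on `η` enters. Since `808 = 101 * 8`, `X ^ c ≤ K ^ c * s` with
`s = n ^ (1 / (8 C))`, and `K ^ c * s ≤ (K ^ c) ^ 2 + s ^ 2`. -/
lemma exp_neg_rpow_le {C K c X : ℝ} (hC : 0 < C) (hK : 0 < K) (hc : 0 < c)
    (hcC : c ≤ 1 / (808 * C)) (hn : 1 ≤ n) (hX0 : 0 ≤ X) (hX : X ≤ K * (n : ℝ) ^ 101) :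
    Real.exp (-(n : ℝ) ^ (1 / (4 * C))) ≤ Real.exp ((K ^ c) ^ 2) * Real.exp (-X ^ c) := by
  have hn1 : (1 : ℝ) ≤ n := by exact_mod_cast hn
  rw [← Real.exp_add, Real.exp_le_exp]
  set s := (n : ℝ) ^ (1 / (8 * C)) with hs
  have hs2 : s ^ 2 = (n : ℝ) ^ (1 / (4 * C)) := by
    rw [hs, ← Real.rpow_natCast, ← Real.rpow_mul (by positivity)]
    congr 1
    field_simp
    norm_num
  have h1 : X ^ c ≤ K ^ c * s := by
    calc X ^ c ≤ (K * (n : ℝ) ^ 101) ^ c := by gcongr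
      _ = K ^ c * (n : ℝ) ^ (101 * c) := by
        rw [Real.mul_rpow hK.le (by positivity), ← Real.rpow_natCast, ← Real.rpow_mul (by positivity)]
        norm_num
      _ ≤ K ^ c * s := by
        refine mul_le_mul_of_nonneg_left (Real.rpow_le_rpow_of_exponent_le hn1 ?_) (by positivity)
        calc 101 * c ≤ 101 * (1 / (808 * C)) := by gcongr
          _ = _ := by field_simp; norm_num
  rw [← hs2]
  nlinarith [sq_nonneg (K ^ c - s), sq_nonneg (K ^ c), sq_nonneg s]

lemma integral_norm_deviation_pow_le_trivial [IsProbabilityMeasure μ] (hn : 1 ≤ n)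
    (hM : IsWigner M μ) {z : ℂ} (hz : 0 < z.im) (k : ℕ) :
    ∫ ω, ‖deviation (normalize (M ω)) z‖ ^ k ∂μ ≤ (3 * n : ℝ) ^ k := by
  have h := norm_integral_le_of_norm_le_const (μ := μ)
    (f := fun ω => ‖deviation (normalize (M ω)) z‖ ^ k) (C := (3 * n : ℝ) ^ k)
    (.of_forall fun ω => by
      rw [norm_pow, norm_norm]
      exact pow_le_pow_left₀ (norm_nonneg _)
        (norm_deviation_le hn (isHermitian_normalize (hM.hermitian ω)) hz) k)
  rw [probReal_univ, mul_one] at h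
  exact (le_abs_self _).trans h

/-- Absorbs the deterministic bound and the union bound loss `n ^ 5`: `3 n ≤ n ^ 2`, and `2 + 5 =
7`. -/
lemma three_mul_pow_mul_le {B : ℝ} (hB : 7 ≤ B) (hn : 3 ≤ n) {k : ℕ} (hk : 1 ≤ k) :
    (3 * n : ℝ) ^ k * (n : ℝ) ^ 5 ≤ (n : ℝ) ^ (B * k) := by
  have hn3 : (3 : ℝ) ≤ n := by exact_mod_cast hn
  calc (3 * n : ℝ) ^ k * (n : ℝ) ^ 5 ≤ ((n : ℝ) ^ 2) ^ k * ((n : ℝ) ^ 5) ^ k := by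
        gcongr
        · nlinarith
        · exact le_self_pow₀ (one_le_pow₀ (by linarith)) (by omega)
    _ = (n : ℝ) ^ (7 * (k : ℝ)) := by
      rw [← mul_pow, ← pow_add, ← pow_mul, ← Real.rpow_natCast]
      push_cast
      norm_num
    _ ≤ _ := by
      gcongr
      linarith

lemma mul_natCast_pow_self_le {b B : ℝ} (hbB : b ≤ B) (hB : 1 ≤ B) {k : ℕ} (hk : 1 ≤ k) :
    b * (k : ℝ) ^ k ≤ (B * k) ^ k := by
  rw [mul_pow]
  gcongr
  exact hbB.trans (le_self_pow₀ hB (by omega))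

end Numerics

end Wigner

/-! ### Constants, degenerate ranges and conclusion. -/

theorem proposition3p1 (m : ℕ) (C C' K : ℝ) (hC : 0 < C) (hC' : 0 < C') (hK : 0 < K) :
    ∃ c B : ℝ, 0 < c ∧ 0 < B ∧
      ∀ (n : ℕ), 1 ≤ n →
      ∀ (Ω : Type*) [MeasurableSpace Ω] (μ : Measure Ω) [IsProbabilityMeasure μ]
        (M M' : Ω → Matrix (Fin n) (Fin n) ℂ),
        Wigner.IsWigner M μ → Wigner.IsWigner M' μ →
        Wigner.ExpDecay M μ C C' → Wigner.ExpDecay M' μ C C' →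
        Wigner.Adjacent M M' μ → Wigner.MatchMoments M M' μ m →
        ∀ z : ℂ, z.re ∈ Set.Icc (-3 : ℝ) 3 → 0 < z.im → z.im ≤ K * (n : ℝ) ^ 100 →
        ∀ k : ℕ, Even k → Real.log n ≤ k →
          ∫ ω, ‖Wigner.deviation (Wigner.normalize (M ω)) z‖ ^ k ∂μ ≤
            (1 + B * (n : ℝ) ^ (-((m : ℝ) + 1) / 2)) *
                ∫ ω, ‖Wigner.deviation (Wigner.normalize (M' ω)) z‖ ^ k ∂μ
              + (B * k) ^ k
              + B * (n : ℝ) ^ (B * k) * Real.exp (-((n : ℝ) * z.im) ^ c) := by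
  set Bs : ℝ := Wigner.swapConst m
    (Wigner.expMomentConst C' * (2 * C * (m + 1 : ℕ)) ^ (C * (m + 1 : ℕ))) with hBs
  -- `N₀` is the size of `n η` needed for the resolvent bound. Below, `n₀` ensures both `n ^ (1/4) ≤
  -- √n / 224` and `C' ≤ n ^ (1 / (4 C))`.
  set N₀ : ℝ := 12000 ^ 4 + (288 * Real.exp 1 * Wigner.momentConst C C') ^ 8 with hN₀
  set n₀ : ℝ := 224 ^ 4 + C' ^ (4 * C) with hn₀
  set c : ℝ := min (1 / (8 * (2 + 2 * C))) (1 / (808 * C)) with hc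
  set D : ℝ := Real.exp ((K ^ c) ^ 2) with hD
  have hc0 : 0 < c := lt_min (by positivity) (by positivity)
  have hBs0 : 0 ≤ Bs := by
    have := Wigner.one_le_expMomentConst hC'.le
    rw [hBs, Wigner.swapConst]
    positivity
  have hD0 : 0 < D := Real.exp_pos _
  have hN0 : 0 < N₀ := by positivity
  have hn0 : 0 < n₀ := by positivity
  -- `3 n₀` covers small `n`, `exp (N₀ ^ c)` covers small `n η`, `7` the powers of `n`, and `Bs * D
  -- + 2 * D + 1` the exceptional probabilities in the main range.
  refine ⟨c, Bs + Bs * D + 2 * D + 7 + 3 * n₀ + Real.exp (N₀ ^ c), hc0, by positivity, ?_⟩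
  intro n hn Ω _ μ _ M M' hM hM' hexp hexp' hadj hmom z hE hz hzK k hk2 _
  have hE' : |z.re| ≤ 3 := abs_le.mpr hE
  set B := Bs + Bs * D + 2 * D + 7 + 3 * n₀ + Real.exp (N₀ ^ c) with hB
  have hexpN : 0 < Real.exp (N₀ ^ c) := Real.exp_pos _
  have hBD : 0 ≤ Bs * D := by positivity
  have hB7 : 7 ≤ B := by linarith
  have hBBs : Bs ≤ B := by linarith
  have hn1 : (1 : ℝ) ≤ n := by exact_mod_cast hn
  set X := (n : ℝ) * z.im with hX
  have hX0 : 0 < X := by positivity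
  set I := ∫ ω, ‖Wigner.deviation (Wigner.normalize (M' ω)) z‖ ^ k ∂μ with hI
  have hI0 : 0 ≤ I := integral_nonneg fun ω => by positivity
  have hJ : 0 ≤ (1 + B * (n : ℝ) ^ (-((m : ℝ) + 1) / 2)) * I := by positivity
  have hBk : 0 ≤ (B * k) ^ k := by positivity
  have hlast : 0 ≤ B * (n : ℝ) ^ (B * k) * Real.exp (-X ^ c) := by positivity
  have htriv := Wigner.integral_norm_deviation_pow_le_trivial hn hM hz k
  -- For `k = 0` the term `(B * k) ^ k` is `0 ^ 0 = 1` and dominates the left side.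
  rcases Nat.eq_zero_or_pos k with rfl | hk
  · refine le_add_of_le_of_nonneg (le_add_of_nonneg_of_le hJ (htriv.trans_eq ?_)) hlast
    rw [pow_zero, pow_zero]
  have hk1 : (1 : ℝ) ≤ k := by exact_mod_cast hk
  -- For bounded `n` the deterministic bound gives `(3 n) ^ k ≤ (B k) ^ k`.
  rcases lt_or_ge (n : ℝ) n₀ with hnlt | hnge
  · have : (3 * n : ℝ) ^ k ≤ (B * k) ^ k := by
      refine pow_le_pow_left₀ (by positivity) ?_ k
      calc 3 * (n : ℝ) ≤ B * 1 := by linarith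
        _ ≤ B * k := by gcongr
    linarith
  have hC4 : 0 < C' ^ (4 * C) := by positivity
  have hn3 : 3 ≤ n := by
    have : (3 : ℝ) ≤ n := by linarith
    exact_mod_cast this
  have hpow : (3 * n : ℝ) ^ k * (n : ℝ) ^ 5 ≤ (n : ℝ) ^ (B * k) :=
    Wigner.three_mul_pow_mul_le hB7 hn3 hk
  have hn5 : (1 : ℝ) ≤ (n : ℝ) ^ 5 := one_le_pow₀ hn1
  -- For bounded `n η` the exponential factor is bounded below, and the last term alone exceeds `(3
  -- n) ^ k`.
  rcases lt_or_ge X N₀ with hXlt | hXge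
  · have h1 : 1 ≤ B * Real.exp (-X ^ c) := by
      calc 1 = Real.exp (N₀ ^ c) * Real.exp (-N₀ ^ c) := by
            rw [← Real.exp_add, add_neg_cancel, Real.exp_zero]
        _ ≤ B * Real.exp (-X ^ c) := by
          gcongr
          linarith
    have h2 : (3 * n : ℝ) ^ k ≤ B * (n : ℝ) ^ (B * k) * Real.exp (-X ^ c) := by
      calc (3 * n : ℝ) ^ k ≤ (3 * n : ℝ) ^ k * (n : ℝ) ^ 5 :=
            le_mul_of_one_le_right (by positivity) hn5
        _ ≤ (n : ℝ) ^ (B * k) := hpow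
        _ ≤ (n : ℝ) ^ (B * k) * (B * Real.exp (-X ^ c)) :=
            le_mul_of_one_le_right (by positivity) h1
        _ = _ := by ring
    linarith
  set ε := Real.exp (-X ^ c) with hε
  set δ := Real.exp (-(n : ℝ) ^ (1 / (4 * C))) with hδ
  have hX1 : 1 ≤ X := by
    have : (0 : ℝ) ≤ (288 * Real.exp 1 * Wigner.momentConst C C') ^ 8 := by positivity
    linarith
  have hnC : C' ≤ (n : ℝ) ^ (1 / (4 * C)) := by
    calc C' = (C' ^ (4 * C)) ^ (1 / (4 * C)) := by
          rw [← Real.rpow_mul hC'.le, mul_one_div_cancel (by positivity), Real.rpow_one]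
      _ ≤ _ := by
        refine Real.rpow_le_rpow hC4.le ?_ (by positivity)
        linarith
  have hδε : δ ≤ D * ε := by
    refine Wigner.exp_neg_rpow_le hC hK hc0 (min_le_right _ _) hn hX0.le ?_
    calc X ≤ n * (K * (n : ℝ) ^ 100) := mul_le_mul_of_nonneg_left hzK (by positivity)
      _ = _ := by ring
  have hq : (n : ℝ) ^ (1 / 4 : ℝ) ≤ √n / 224 := by
    rw [Wigner.sqrt_eq_rpow_quarter_sq (by positivity)]
    have h4 := Wigner.rpow_quarter_pow_four (x := (n : ℝ)) (by positivity)
    have h5 : 224 ≤ (n : ℝ) ^ (1 / 4 : ℝ) := by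
      refine le_of_pow_le_pow_left₀ (n := 4) (by norm_num) (by positivity) ?_
      rw [h4]; linarith
    nlinarith
  have hβ := Wigner.measureReal_not_norm_green_le hn hM hC hC'.le hexp hnC hE' hz
    (by rw [← hX]; refine le_trans ?_ hXge; rw [hN₀]; exact le_add_of_nonneg_right (by positivity))
    (by rw [← hX]; refine le_trans ?_ hXge; rw [hN₀]; exact le_add_of_nonneg_left (by positivity))
  have hεX : Real.exp (-X ^ (1 / (8 * (2 + 2 * C)))) ≤ ε := by
    rw [hε, Real.exp_le_exp, neg_le_neg_iff]
    exact Real.rpow_le_rpow_of_exponent_le hX1 (min_le_left _ _)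
  have hmain := Wigner.integral_norm_deviation_pow_le_of_adjacent hn hM hM' hC hC'.le hexp hexp'
    hadj hmom
    (fun i j => (measureReal_mono fun ω hω => hq.trans (le_of_lt hω)).trans
      (Wigner.measureReal_rpow_quarter_le hC hexp hnC i j))
    (fun i j => (measureReal_mono fun ω hω => hq.trans (le_of_lt hω)).trans
      (Wigner.measureReal_rpow_quarter_le hC hexp' hnC i j))
    hz hβ hk hk2 hBs
  refine hmain.trans ?_
  have h1 : (1 + Bs * (n : ℝ) ^ (-((m : ℝ) + 1) / 2)) * I
      ≤ (1 + B * (n : ℝ) ^ (-((m : ℝ) + 1) / 2)) * I := by gcongr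
  have h2 : Bs * (k : ℝ) ^ k ≤ (B * k) ^ k :=
    Wigner.mul_natCast_pow_self_le hBBs (by linarith) hk
  have h3 : Bs * (3 * n : ℝ) ^ k * δ + (3 * n : ℝ) ^ k *
      ((n : ℝ) ^ 5 * (δ + Real.exp (-X ^ (1 / (8 * (2 + 2 * C))))) + δ)
      ≤ B * (n : ℝ) ^ (B * k) * ε := by
    have hF0 : (0 : ℝ) ≤ (3 * n : ℝ) ^ k := by positivity
    have hε0 : 0 < ε := Real.exp_pos _
    calc _ ≤ Bs * (3 * n : ℝ) ^ k * (D * ε) + (3 * n : ℝ) ^ k *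
          ((n : ℝ) ^ 5 * (D * ε + ε) + D * ε) := by gcongr
      _ ≤ Bs * ((3 * n : ℝ) ^ k * (n : ℝ) ^ 5) * (D * ε) + (3 * n : ℝ) ^ k *
          ((n : ℝ) ^ 5 * (D * ε + ε) + (n : ℝ) ^ 5 * (D * ε)) := by
        have h4 : (3 * n : ℝ) ^ k ≤ (3 * n : ℝ) ^ k * (n : ℝ) ^ 5 :=
          le_mul_of_one_le_right hF0 hn5
        have h5 : D * ε ≤ (n : ℝ) ^ 5 * (D * ε) := le_mul_of_one_le_left (by positivity) hn5
        gcongr ?_ * (D * ε) + _ * (_ + ?_)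
        gcongr
      _ = (Bs * D + 2 * D + 1) * ((3 * n : ℝ) ^ k * (n : ℝ) ^ 5) * ε := by ring
      _ ≤ B * (n : ℝ) ^ (B * k) * ε := by
        gcongr
        linarith
  linarith
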